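/- **Setting.** Let $d\ge 1$, $p\ge 0$ be integers, $\mathbf t\in[-1/2,1/2]^d$, and let $\{Z(\mathbf s):\mathbf s\in \mathbf t+\mathbb Z^d\}$ be a strictly stationary random field with values in $\mathbb R^p$, with mean $\mu=\mathrm E Z(\mathbf t)$. Let $H:\mathbb R^p\to\mathbb R$. Write $\|\cdot\|$ for the Euclidean norm, $\nabla$ for the gradient of $H$ at $\mu$, and $\mathrm{dis}(E_1,E_2)$ for the $\ell^\infty$ distance of two sets. *Regions.* Let $R_0\subset(-1/2,1/2]^d$ be a Borel set containing a neighbourhood of the origin such that for every sequence of positive reals $a_n\to0$ the number of cubes $a_n(\mathbf k+[0,1]^d)$, $\mathbf k\in\mathbb Z^d$, that intersect both $\overline{R_0}$ and $\overline{R_0^c}$ is $O(a_n^{-(d-1)})$ (boundary condition). Let $\Delta_n$ and ${}_s\Delta_n$ be $d\times d$ diagonal matrices with positive diagonal entries $\lambda_i^{(n)}\to\infty$ and ${}_s\lambda_i^{(n)}\to\infty$, with ${}_s\lambda_i^{(n)}/\lambda_i^{(n)}\to0$, $i=1,\dots,d$. Put $R_n=\Delta_nR_0$. For a bounded $A\subset\mathbb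 R^d$ let $N(A)$ be the number of points of $\mathbf t+\mathbb Z^d$ in $A$, let $\bar Z(A)$ be the average of $Z$ over these points, and let $\hat\theta(A)=H(\bar Z(A))$. Put $N_n=N(R_n)$, $\hat\theta_n=\hat\theta(R_n)$ and $\tau_n^2=N_n\mathrm{Var}(\hat\theta_n)$. *Estimators.* Let $J_{\mathrm{OL}}=\{\mathbf i\in\mathbb Z^d:\mathbf i+{}_s\Delta_nR_0\subset R_n\}$ and $R_{\mathbf i,n}=\mathbf i+{}_s\Delta_nR_0$; let $J_{\mathrm{NOL}}=\{\mathbf i\in\mathbb Z^d:{}_s\Delta_n(\mathbf i+(-1/2,1/2]^d)\subset R_n\}$ and $\tilde R_{\mathbf i,n}={}_s\Delta_n(\mathbf i+R_0)$. The overlapping and nonoverlapping subsample variance estimators are $$\hat\tau^2_{n,\mathrm{OL}}=\frac1{|J_{\mathrm{OL}}|}\sum_{\mathbf i\in J_{\mathrm{OL}}}N({}_s\Delta_nR_0)\Big(\hat\theta(R_{\mathbf i,n})-\frac1{|J_{\mathrm{OL}}|}\sum_{\mathbf j\in J_{\mathrm{OL}}}\hat\theta(R_{\mathbf j,n})\Big)^2,$$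 $$\hat\tau^2_{n,\mathrm{NOL}}=\frac1{|J_{\mathrm{NOL}}|}\sum_{\mathbf i\in J_{\mathrm{NOL}}}N(\tilde R_{\mathbf i,n})\Big(\hat\theta(\tilde R_{\mathbf i,n})-\frac1{|J_{\mathrm{NOL}}|}\sum_{\mathbf j\in J_{\mathrm{NOL}}}\hat\theta(\tilde R_{\mathbf j,n})\Big)^2.$$ (Averages over an empty set, which can occur only for finitely many $n$, are set to $0$.) *Mixing.* For sets of sites $T_1,T_2\subset\mathbf t+\mathbb Z^d$ let $\tilde\alpha(T_1,T_2)=\sup|P(A\cap B)-P(A)P(B)|$ over $A\in\sigma\langle Z(\mathbf s):\mathbf s\in T_1\rangle$, $B\in\sigma\langle Z(\mathbf s):\mathbf s\in T_2\rangle$, and let $\alpha(k,l)=\sup\{\tilde\alpha(T_1,T_2):|T_1|,|T_2|\le l,\ \mathrm{dis}(T_1,T_2)\ge k\}$. **Assumptions.** - A.1. There is a diagonal matrix $\Delta_0$ with $\det\Delta_0>0$ and ${}_s\Delta_n/{}_s\lambda_1^{(n)}\to\Delta_0$. - A.2. $\sum_{i=1}^d\frac1{{}_s\lambda_i^{(n)}}+\sum_{i=1}^d\frac{{}_s\lambda_i^{(n)}}{\lambda_i^{(n)}}+\frac{[\det({}_s\Delta_n)]^{(d+1)/d}}{\det(\Delta_n)}=o(1)$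 and $\max_i\lambda_i^{(n)}=O(\min_i\lambda_i^{(n)})$. - A.3. There are nonnegative functions $\alpha_1,g$ with $\alpha_1(k)\to0$ as $k\to\infty$, $g(l)\to\infty$ as $l\to\infty$ and $\alpha(k,l)\le\alpha_1(k)g(l)$ for all real $k,l>0$. - A.4. $\sup\{\tilde\alpha(T_1,T_2):|T_1|=1,\ \mathrm{dis}(T_1,T_2)\ge k\}=o(k^{-d})$ as $k\to\infty$ ($T_2$ may be infinite). - A.5. $\tau^2=\sum_{\mathbf k\in\mathbb Z^d}\sigma(\mathbf k)>0$, where $\sigma(\mathbf k)=\mathrm{Cov}(\nabla'Z(\mathbf t),\nabla'Z(\mathbf t+\mathbf k))$. For an integer $r\ge1$ and an integer $a\ge 0$: - Condition $D_r$ (with exponent $a$). $H$ is $r$ times continuously differentiable and, for some $C>0$, every partial derivative of order $r$ satisfies $|D^\nu H(x)|\le C(1+\|x\|^a)$ for all $x\in\mathbb R^p$. - Condition $M_r$. For some $0<\delta\le1$, $0<\kappa<(2r-1-1/d)(2r+\delta)/\delta$ and $C>0$: $\mathrm E\|Z(\mathbf t)\|^{2r+\delta}<\infty$, $\sum_{m=1}^\infty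 m^{(2r-1)d-1}\alpha_1(m)^{\delta/(2r+\delta)}<\infty$, and $g(x)\le Cx^\kappa$ for all $x\ge1$, with $\alpha_1,g$ from A.3. **Lemma.** Suppose that A.1–A.5 hold, and that either $d\ge2$ and, for some integer $a\ge0$, Conditions $D_2$ (with exponent $a$) and $M_{2+a}$ hold, or $d=1$ and, for some integer $a\ge0$, Conditions $D_3$ (with exponent $a$) and $M_{3+a}$ hold. Then $\hat\theta_n$ has a finite second moment, $\hat\tau^2_{n,\mathrm{OL}}$ and $\hat\tau^2_{n,\mathrm{NOL}}$ have finite expectations for every $n$, and, as $n\to\infty$, $$\mathrm E(\hat\tau^2_{n,\mathrm{OL}})=\tau_n^2+O(1/{}_s\lambda_1^{(n)})\quad\text{and}\quad \mathrm E(\hat\tau^2_{n,\mathrm{NOL}})=\tau_n^2+O(1/{}_s\lambda_1^{(n)}).$$ -/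

import Mathlib

open MeasureTheory ProbabilityTheory Filter Asymptotics
open scoped Topology

namespace SpatialSubsampling

noncomputable section

/- Points of the sampling space `ℝ^d` are `Fin d → ℝ`; values of the field live in
`EuclideanSpace ℝ (Fin p)`, so that `‖·‖` is the Euclidean norm there. A diagonal `d × d` matrix
is given by its vector of diagonal entries, and its determinant is the product of the entries. -/

/-! ### Sampling regions -/

/-- The image `Δ A` of `A ⊆ ℝ^d` under the diagonal matrix with diagonal entries `l`. -/
def scaleSet {d : ℕ} (l : Fin d → ℝ) (A : Set (Fin d → ℝ)) : Set (Fin d → ℝ) :=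
  (fun x i => l i * x i) '' A

/-- The translate `i + A` of `A ⊆ ℝ^d` by an integer vector. -/
def shiftSet {d : ℕ} (i : Fin d → ℤ) (A : Set (Fin d → ℝ)) : Set (Fin d → ℝ) :=
  (fun x j => (i j : ℝ) + x j) '' A

/-- The cube `(-1/2, 1/2]^d`. -/
def unitCube (d : ℕ) : Set (Fin d → ℝ) :=
  {x | ∀ i, -(1 / 2) < x i ∧ x i ≤ 1 / 2}

/-- The cube `a (k + [0, 1]^d)` of the scaled lattice `a ℤ^d`. -/
def latticeCube {d : ℕ} (a : ℝ) (k : Fin d → ℤ) : Set (Fin d → ℝ) :=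
  {x | ∀ i, a * k i ≤ x i ∧ x i ≤ a * (k i + 1)}

/-- The number of cubes of the scaled lattice `a ℤ^d` that intersect both the closure of `A` and
the closure of the complement of `A`. -/
def boundaryCubeCount {d : ℕ} (A : Set (Fin d → ℝ)) (a : ℝ) : ℕ :=
  {k : Fin d → ℤ | (latticeCube a k ∩ closure A).Nonempty ∧
    (latticeCube a k ∩ closure Aᶜ).Nonempty}.ncard

/-- The requirements on the template set `R₀`, including the boundary condition. -/
structure IsTemplate {d : ℕ} (R₀ : Set (Fin d → ℝ)) : Prop where
  borel : MeasurableSet R₀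
  subset_unitCube : R₀ ⊆ unitCube d
  nhds_origin : R₀ ∈ 𝓝 (0 : Fin d → ℝ)
  boundary : ∀ a : ℕ → ℝ, (∀ n, 0 < a n) → Tendsto a atTop (𝓝 0) →
    (fun n => (boundaryCubeCount R₀ (a n) : ℝ)) =O[atTop] fun n => (a n)⁻¹ ^ ((d : ℝ) - 1)

/-- The standing requirements on the diagonal entries `lam n i` of the scaling matrix of the
sampling region and `slam n i` of the scaling matrix of the subsamples. -/
structure IsScaling {d : ℕ} (lam slam : ℕ → Fin d → ℝ) : Prop where
  lam_pos : ∀ n i, 0 < lam n i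
  slam_pos : ∀ n i, 0 < slam n i
  lam_tendsto : ∀ i, Tendsto (fun n => lam n i) atTop atTop
  slam_tendsto : ∀ i, Tendsto (fun n => slam n i) atTop atTop
  ratio_tendsto : ∀ i, Tendsto (fun n => slam n i / lam n i) atTop (𝓝 0)

/-! ### The statistic and the two subsample variance estimators

The field is observed on the translated lattice `t + ℤ^d`. The observation at the site `t + k` is
written `Z k`, `k : Fin d → ℤ`. -/

/-- The sites of the lattice `t + ℤ^d` that lie in `A`, indexed by their integer part `k`. -/
def sites {d : ℕ} (t : Fin d → ℝ) (A : Set (Fin d → ℝ)) : Set (Fin d → ℤ) :=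
  {k | (fun i => t i + (k i : ℝ)) ∈ A}

/-- The number of sites in `A`. -/
def siteCount {d : ℕ} (t : Fin d → ℝ) (A : Set (Fin d → ℝ)) : ℕ :=
  (sites t A).ncard

/-- The average of `f` over a finite index set `J`. -/
def finAverage {ι E : Type*} [AddCommGroup E] [Module ℝ E] (J : Set ι) (f : ι → E) : E :=
  (J.ncard : ℝ)⁻¹ • ∑ᶠ i ∈ J, f i

section Estimators

variable {d p : ℕ} {Ω : Type*} (t : Fin d → ℝ) (Z : (Fin d → ℤ) → Ω → EuclideanSpace ℝ (Fin p))
  (H : EuclideanSpace ℝ (Fin p) → ℝ) (R₀ : Set (Fin d → ℝ))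

/-- The statistic computed from the region `A`: `H` at the sample mean of the observations at
the sites in `A`. -/
def thetaHat (A : Set (Fin d → ℝ)) (ω : Ω) : ℝ :=
  H (finAverage (sites t A) fun k => Z k ω)

/-- `τ_n² = N_n Var(θ̂_n)` when `l` is the diagonal of `Δ_n`. -/
def tauSqN [MeasurableSpace Ω] (P : Measure Ω) (l : Fin d → ℝ) : ℝ :=
  (siteCount t (scaleSet l R₀) : ℝ) * variance (thetaHat t Z H (scaleSet l R₀)) P

/-- Integer translates of the subsampling region `ₛΔ R₀` that lie inside `Δ R₀`; `l` and `s` are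
the diagonals of `Δ` and `ₛΔ`. -/
def JOL (l s : Fin d → ℝ) : Set (Fin d → ℤ) :=
  {i | shiftSet i (scaleSet s R₀) ⊆ scaleSet l R₀}

/-- The overlapping (OL) subsample variance estimator. -/
def tauHatOL (l s : Fin d → ℝ) (ω : Ω) : ℝ :=
  finAverage (JOL R₀ l s) fun i =>
    (siteCount t (scaleSet s R₀) : ℝ) *
      (thetaHat t Z H (shiftSet i (scaleSet s R₀)) ω -
        finAverage (JOL R₀ l s) fun j => thetaHat t Z H (shiftSet j (scaleSet s R₀)) ω) ^ 2

/-- The inflated cubes `ₛΔ (i + (-1/2, 1/2]^d)` that lie inside `Δ R₀`. -/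
def JNOL (l s : Fin d → ℝ) : Set (Fin d → ℤ) :=
  {i | scaleSet s (shiftSet i (unitCube d)) ⊆ scaleSet l R₀}

/-- The nonoverlapping (NOL) subsample variance estimator, based on the regions
`ₛΔ (i + R₀)`. -/
def tauHatNOL (l s : Fin d → ℝ) (ω : Ω) : ℝ :=
  finAverage (JNOL R₀ l s) fun i =>
    (siteCount t (scaleSet s (shiftSet i R₀)) : ℝ) *
      (thetaHat t Z H (scaleSet s (shiftSet i R₀)) ω -
        finAverage (JNOL R₀ l s) fun j => thetaHat t Z H (scaleSet s (shiftSet j R₀)) ω) ^ 2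

end Estimators

/-! ### Stationarity and mixing -/

section Mixing

variable {d p : ℕ} {Ω : Type*} [MeasurableSpace Ω]

/-- Strict stationarity: the law of the field is invariant under lattice translations. -/
def IsStationary (P : Measure Ω) (Z : (Fin d → ℤ) → Ω → EuclideanSpace ℝ (Fin p)) : Prop :=
  ∀ h : Fin d → ℤ, P.map (fun ω k => Z (k + h) ω) = P.map (fun ω k => Z k ω)

/-- The σ-field generated by the observations at the sites in `T`. -/
abbrev sigmaField (Z : (Fin d → ℤ) → Ω → EuclideanSpace ℝ (Fin p)) (T : Set (Fin d → ℤ)) :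
    MeasurableSpace Ω :=
  ⨆ k ∈ T, MeasurableSpace.comap (Z k) inferInstance

/-- `dis(T₁, T₂) ≥ r` in the `ℓ^∞` distance (which is `dist` on `Fin d → ℤ`). -/
def DisGE (T₁ T₂ : Set (Fin d → ℤ)) (r : ℝ) : Prop :=
  ∀ x ∈ T₁, ∀ y ∈ T₂, r ≤ dist x y

/-- `α̃(T₁, T₂)`. -/
def alphaTilde (P : Measure Ω) (Z : (Fin d → ℤ) → Ω → EuclideanSpace ℝ (Fin p))
    (T₁ T₂ : Set (Fin d → ℤ)) : ℝ :=
  sSup {x | ∃ A B : Set Ω, MeasurableSet[sigmaField Z T₁] A ∧ MeasurableSet[sigmaField Z T₂] B ∧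
    x = |P.real (A ∩ B) - P.real A * P.real B|}

/-- The strong mixing coefficient `α(k, l)`, a supremum over finite sets of sites. -/
def mixingCoeff (P : Measure Ω) (Z : (Fin d → ℤ) → Ω → EuclideanSpace ℝ (Fin p))
    (k l : ℝ) : ℝ :=
  sSup {x | ∃ T₁ T₂ : Finset (Fin d → ℤ), (T₁.card : ℝ) ≤ l ∧ (T₂.card : ℝ) ≤ l ∧
    DisGE (T₁ : Set (Fin d → ℤ)) T₂ k ∧ x = alphaTilde P Z T₁ T₂}

/-- The supremum of `α̃(T₁, T₂)` over one-point sets `T₁` and arbitrary sets `T₂` at distance at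
least `k`. -/
def pointMixingCoeff (P : Measure Ω) (Z : (Fin d → ℤ) → Ω → EuclideanSpace ℝ (Fin p))
    (k : ℝ) : ℝ :=
  sSup {x | ∃ (u : Fin d → ℤ) (T₂ : Set (Fin d → ℤ)),
    DisGE {u} T₂ k ∧ x = alphaTilde P Z {u} T₂}

/-! ### Assumptions on the design, the field and the function `H` -/

/-- The subsample scaling factors, relative to the first one, converge to the entries of a
diagonal matrix with positive determinant. -/
def AssumptionA1 [NeZero d] (slam : ℕ → Fin d → ℝ) : Prop :=
  ∃ l₀ : Fin d → ℝ, 0 < ∏ i, l₀ i ∧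
    ∀ i, Tendsto (fun n => 1 / slam n 0 * slam n i) atTop (𝓝 (l₀ i))

/-- Growth conditions on the scaling factors of the sampling region and of the subsamples. -/
def AssumptionA2 (lam slam : ℕ → Fin d → ℝ) : Prop :=
  Tendsto (fun n => ∑ i, 1 / slam n i + ∑ i, slam n i / lam n i +
      (∏ i, slam n i) ^ (((d : ℝ) + 1) / d) / ∏ i, lam n i) atTop (𝓝 0) ∧
    (fun n => ⨆ i, lam n i) =O[atTop] fun n => ⨅ i, lam n i

/-- The strong mixing coefficient is bounded by `α₁ k * g l`. -/
structure AssumptionA3 (P : Measure Ω) (Z : (Fin d → ℤ) → Ω → EuclideanSpace ℝ (Fin p))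
    (α₁ g : ℝ → ℝ) : Prop where
  alpha_nonneg : ∀ k, 0 < k → 0 ≤ α₁ k
  g_nonneg : ∀ l, 0 < l → 0 ≤ g l
  alpha_tendsto : Tendsto α₁ atTop (𝓝 0)
  g_tendsto : Tendsto g atTop atTop
  bound : ∀ k l, 0 < k → 0 < l → mixingCoeff P Z k l ≤ α₁ k * g l

/-- The mixing coefficient between one site and arbitrary remote sets is `o(k^{-d})`. -/
def AssumptionA4 (P : Measure Ω) (Z : (Fin d → ℤ) → Ω → EuclideanSpace ℝ (Fin p)) : Prop :=
  (fun k : ℕ => pointMixingCoeff P Z k) =o[atTop] fun k : ℕ => ((k : ℝ) ^ d)⁻¹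

/-- The mean `μ = E Z(t)` of the field. -/
def fieldMean (P : Measure Ω) (Z : (Fin d → ℤ) → Ω → EuclideanSpace ℝ (Fin p)) :
    EuclideanSpace ℝ (Fin p) :=
  ∫ ω, Z 0 ω ∂P

/-- `σ(k) = Cov(∇' Z(t), ∇' Z(t + k))`, where `∇` is the gradient of `H` at `μ`. -/
def sigmaCov (P : Measure Ω) (Z : (Fin d → ℤ) → Ω → EuclideanSpace ℝ (Fin p))
    (H : EuclideanSpace ℝ (Fin p) → ℝ) (k : Fin d → ℤ) : ℝ :=
  covariance (fun ω => inner ℝ (gradient H (fieldMean P Z)) (Z 0 ω))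
    (fun ω => inner ℝ (gradient H (fieldMean P Z)) (Z k ω)) P

/-- The asymptotic variance `τ² = ∑ σ(k)` is positive. -/
def AssumptionA5 (P : Measure Ω) (Z : (Fin d → ℤ) → Ω → EuclideanSpace ℝ (Fin p))
    (H : EuclideanSpace ℝ (Fin p) → ℝ) : Prop :=
  0 < ∑' k : Fin d → ℤ, sigmaCov P Z H k

/-- Condition `D_r` with exponent `a`. The partial derivatives of order `r` of the `C^r` function
`H` are the values `∂^r H / ∂x_{j 0} ⋯ ∂x_{j (r-1)}` of its `r`-th derivative at tuples of
standard basis vectors. -/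
def ConditionD (H : EuclideanSpace ℝ (Fin p) → ℝ) (r a : ℕ) : Prop :=
  ContDiff ℝ r H ∧ ∃ C : ℝ, 0 < C ∧ ∀ (x : EuclideanSpace ℝ (Fin p)) (j : Fin r → Fin p),
    |iteratedFDeriv ℝ r H x fun i => EuclideanSpace.single (j i) (1 : ℝ)| ≤ C * (1 + ‖x‖ ^ a)

/-- Condition `M_r` for the functions `α₁` and `g` of the mixing bound. -/
def ConditionM (P : Measure Ω) (Z : (Fin d → ℤ) → Ω → EuclideanSpace ℝ (Fin p))
    (α₁ g : ℝ → ℝ) (r : ℕ) : Prop :=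
  ∃ δ κ C : ℝ, 0 < δ ∧ δ ≤ 1 ∧ 0 < κ ∧ κ < (2 * r - 1 - 1 / d) * (2 * r + δ) / δ ∧ 0 < C ∧
    Integrable (fun ω => ‖Z 0 ω‖ ^ (2 * (r : ℝ) + δ)) P ∧
    Summable (fun m : ℕ => ((m : ℝ) + 1) ^ ((2 * (r : ℝ) - 1) * d - 1) *
      α₁ ((m : ℝ) + 1) ^ (δ / (2 * r + δ))) ∧
    ∀ x : ℝ, 1 ≤ x → g x ≤ C * x ^ κ

end Mixing

end

end SpatialSubsampling

open SpatialSubsampling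

/-! Linearization. Put `Y k = ⟨∇, Z k - μ⟩`. For a finite nonempty set `S` of `N` sites, `H` of the
sample mean equals `H μ` plus the mean of `Y` over `S` plus a remainder `R`. By Taylor's formula `R`
is of second order in the centred sample mean, whose moments of order `2ρ` are `O(N^(-ρ))`; hence `E
R² = O(N^(-2))`. The correlation of `R` with the mean of `Y` is `O(N^(-1-γ))`. Cauchy-Schwarz yields
`γ = 1/2`, which suffices for `d ≥ 2`. For `d = 1` one more Taylor term is used: its correlation
with the linear part is a third mixed moment, which is small enough for `γ = 1`. In both cases `1 ≤
γ * d` (`exists_isAsymptoticallyLinear`).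

Moments. They rest on a Davydov-type factorization of expectations of products
(`abs_integral_prod_sub_mul_le`). A tuple of sites is cut at a large gap, the expectation factorizes
up to a function of the gap, and induction on the order bounds the sum of all mixed moments of order
`n` by `N^⌊n/2⌋` (`IsWeaklyDependent.exists_sum_le`). The summability in Condition M is the one that
this argument needs for `n = 2r`.

Variance of one block. `N` times the second moment of the mean of `Y` differs from `τ² = ∑ σ(v)` by
`N⁻¹ ∑ σ(v) #{k ∈ S : k + v ∉ S}`. For a template scaled by factors of order `λ`, the boundary
condition makes the count `O(‖v‖ λ^(d-1))`, while `N` is of order `λ^d`. The remainders cost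
`N^(-γ)` and `N⁻¹`, so the total error is `O(1/λ)`, uniformly in the position of the lattice
(`IsAsymptoticallyLinear.exists_abs_card_mul_variance_sub_le`). This covers the sampling region and
every subsample at once.

Centring. Replacing `H μ` by the average of the block statistics costs `O(1/V + M/|J|)`, where `V`
is the block volume and `M` the largest number of blocks that share a site
(`IsAsymptoticallyLinear.abs_integral_blockVariance_sub_le`). For overlapping blocks `M` is of order
`V` and `|J|` at least of order `det Δ`; for nonoverlapping ones `M = 1` and `|J|` is at least of
order `det Δ / V`. Either way `M/|J|` is `O(det ₛΔ / det Δ)`, and the exponent `(d+1)/d` in A.2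
bounds this ratio by a multiple of the inverse subsample scaling factor. -/

namespace SpatialSubsampling

/-! ### The covariance inequality for strongly mixing σ-fields -/

/-- The covariance of a bounded `m`-measurable function with `g` is controlled by the covariance
of `g` with the indicator of an `m`-measurable set. -/
lemma exists_set_abs_cov_le {Ω : Type*} {m m0 : MeasurableSpace Ω} (hm : m ≤ m0)
    (P : Measure Ω) [IsProbabilityMeasure P] {f g : Ω → ℝ} {A : ℝ}
    (hf : StronglyMeasurable[m] f) (hA : ∀ ω, |f ω| ≤ A) (hg : Integrable g P) :
    ∃ S : Set Ω, MeasurableSet[m] S ∧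
      |(∫ ω, f ω * g ω ∂P) - (∫ ω, f ω ∂P) * ∫ ω, g ω ∂P| ≤
        2 * A * |(∫ ω in S, g ω ∂P) - P.real S * ∫ ω, g ω ∂P| := by
  set c := ∫ ω, g ω ∂P with hc
  set h : Ω → ℝ := fun ω => (P[g|m]) ω - c with hh
  have hcm : StronglyMeasurable[m] (P[g|m]) := stronglyMeasurable_condExp
  have hhm : StronglyMeasurable[m] h := hcm.sub stronglyMeasurable_const
  have hhi : Integrable h P := integrable_condExp.sub (integrable_const c)
  have hfm : AEStronglyMeasurable f P := (hf.mono hm).aestronglyMeasurable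
  have hfb : ∀ᵐ ω ∂P, ‖f ω‖ ≤ A := Eventually.of_forall hA
  have hA0 : 0 ≤ A := by
    obtain ⟨ω⟩ : Nonempty Ω := nonempty_of_isProbabilityMeasure P
    exact (abs_nonneg _).trans (hA ω)
  have hfi : Integrable f P := Integrable.of_bound hfm A hfb
  have hfg : Integrable (fun ω => f ω * g ω) P := hg.bdd_mul hfm hfb
  have e1 : ∫ ω, f ω * g ω ∂P = ∫ ω, f ω * (P[g|m]) ω ∂P := by
    rw [← integral_condExp hm (f := fun ω => f ω * g ω)]
    exact integral_congr_ae (condExp_mul_of_stronglyMeasurable_left hf hfg hg)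
  have e2 : (∫ ω, f ω * g ω ∂P) - (∫ ω, f ω ∂P) * c = ∫ ω, f ω * h ω ∂P := by
    simp only [hh, mul_sub]
    rw [integral_sub (integrable_condExp.bdd_mul hfm hfb) (hfi.mul_const c), e1,
      integral_mul_const]
  have e3 : ∫ ω, h ω ∂P = 0 := by
    simp only [hh]
    rw [integral_sub integrable_condExp (integrable_const c), integral_condExp hm]
    simp [hc]
  -- The witness is the set where `E[g|m] ≥ E g`. As `h` integrates to zero, its positive part
  -- carries half of its `L¹` norm; this is the factor `2`.
  have hS : MeasurableSet[m] {ω | 0 ≤ h ω} :=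
    measurableSet_le measurable_const hhm.measurable
  refine ⟨{ω | 0 ≤ h ω}, hS, ?_⟩
  have e4 : ∫ ω in {ω | 0 ≤ h ω}, h ω ∂P
      = (∫ ω in {ω | 0 ≤ h ω}, g ω ∂P) - P.real {ω | 0 ≤ h ω} * c := by
    simp only [hh]
    rw [integral_sub integrable_condExp.integrableOn (integrable_const c).integrableOn]
    have := setIntegral_condExp hm hg hS
    simp only [hh] at this
    rw [this]
    simp
  have e5 : ∫ ω, |h ω| ∂P = 2 * ∫ ω in {ω | 0 ≤ h ω}, h ω ∂P := by
    have h1 := integral_add_compl (hm _ hS) hhi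
    have h2 := integral_add_compl (hm _ hS) hhi.abs
    have h3 : ∫ ω in {ω | 0 ≤ h ω}, |h ω| ∂P = ∫ ω in {ω | 0 ≤ h ω}, h ω ∂P :=
      setIntegral_congr_fun (hm _ hS) fun ω hω => abs_of_nonneg hω
    have h4 : ∫ ω in {ω | 0 ≤ h ω}ᶜ, |h ω| ∂P = ∫ ω in {ω | 0 ≤ h ω}ᶜ, -h ω ∂P := by
      refine setIntegral_congr_fun (hm _ hS).compl fun ω hω => abs_of_neg ?_
      simpa using hω
    rw [integral_neg] at h4
    linarith
  rw [e2]
  calc |∫ ω, f ω * h ω ∂P| ≤ ∫ ω, |f ω * h ω| ∂P := abs_integral_le_integral_abs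
    _ ≤ ∫ ω, A * |h ω| ∂P := by
        refine integral_mono (hhi.bdd_mul hfm hfb).abs (hhi.abs.const_mul A) fun ω => ?_
        simp only [abs_mul]
        exact mul_le_mul_of_nonneg_right (hA ω) (abs_nonneg _)
    _ = 2 * A * ∫ ω in {ω | 0 ≤ h ω}, h ω ∂P := by rw [integral_const_mul, e5]; ring
    _ ≤ 2 * A * |∫ ω in {ω | 0 ≤ h ω}, h ω ∂P| := by gcongr; exact le_abs_self _
    _ = _ := by rw [e4]

/-- The covariance inequality for bounded functions measurable with respect to two σ-fields with
mixing coefficient at most `α`. -/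
lemma abs_cov_le_of_mixing {Ω : Type*} {m₁ m₂ m0 : MeasurableSpace Ω} (h₁ : m₁ ≤ m0) (h₂ : m₂ ≤ m0)
    (P : Measure Ω) [IsProbabilityMeasure P] {f g : Ω → ℝ} {A B α : ℝ}
    (hα : ∀ S T : Set Ω, MeasurableSet[m₁] S → MeasurableSet[m₂] T →
      |P.real (S ∩ T) - P.real S * P.real T| ≤ α)
    (hf : StronglyMeasurable[m₁] f) (hA : ∀ ω, |f ω| ≤ A)
    (hg : StronglyMeasurable[m₂] g) (hB : ∀ ω, |g ω| ≤ B) :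
    |(∫ ω, f ω * g ω ∂P) - (∫ ω, f ω ∂P) * ∫ ω, g ω ∂P| ≤ 4 * A * B * α := by
  obtain ⟨ω⟩ : Nonempty Ω := nonempty_of_isProbabilityMeasure P
  have hA0 : 0 ≤ A := (abs_nonneg _).trans (hA ω)
  have hB0 : 0 ≤ B := (abs_nonneg _).trans (hB ω)
  have hgi : Integrable g P :=
    Integrable.of_bound (hg.mono h₂).aestronglyMeasurable B (Eventually.of_forall hB)
  -- `f` is first replaced by the indicator of a set `S`, then `g` by the indicator of a set `T`;
  -- each replacement contributes a factor `2`, whence `4 * A * B`.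
  obtain ⟨S, hS, h1⟩ := exists_set_abs_cov_le h₁ P hf hA hgi
  have hSi : Integrable (S.indicator (fun _ => (1 : ℝ))) P :=
    (integrable_const (1 : ℝ)).indicator (h₁ _ hS)
  obtain ⟨T, hT, h2⟩ := exists_set_abs_cov_le h₂ P hg hB hSi
  have e1 : ∫ ω, g ω * S.indicator (fun _ => (1 : ℝ)) ω ∂P = ∫ ω in S, g ω ∂P := by
    rw [← integral_indicator (h₁ _ hS)]
    congr 1; ext ω
    by_cases h : ω ∈ S <;> simp [h]
  have e2 : ∫ ω, S.indicator (fun _ => (1 : ℝ)) ω ∂P = P.real S := by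
    rw [integral_indicator (h₁ _ hS)]; simp
  have e3 : ∫ ω in T, S.indicator (fun _ => (1 : ℝ)) ω ∂P = P.real (S ∩ T) := by
    rw [setIntegral_indicator (h₁ _ hS), Set.inter_comm]; simp
  rw [e1, e2, e3, mul_comm (∫ ω, g ω ∂P)] at h2
  calc _ ≤ _ := h1
    _ ≤ 2 * A * (2 * B * |P.real (S ∩ T) - P.real T * P.real S|) := by gcongr
    _ ≤ 2 * A * (2 * B * α) := by
        gcongr
        rw [mul_comm (P.real T)]
        exact hα S T hS hT
    _ = _ := by ring

/-! ### Mixing coefficients as bounds for covariances of events -/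

section AlphaTilde

variable {d p : ℕ} {Ω : Type*} [MeasurableSpace Ω]

lemma sigmaField_le {Z : (Fin d → ℤ) → Ω → EuclideanSpace ℝ (Fin p)} (hZ : ∀ k, Measurable (Z k))
    (T : Set (Fin d → ℤ)) : sigmaField Z T ≤ (inferInstance : MeasurableSpace Ω) :=
  iSup₂_le fun k _ => (hZ k).comap_le

lemma measurable_sigmaField {Z : (Fin d → ℤ) → Ω → EuclideanSpace ℝ (Fin p)}
    {T : Set (Fin d → ℤ)} {k : Fin d → ℤ} (hk : k ∈ T) : Measurable[sigmaField Z T] (Z k) :=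
  (comap_measurable (Z k)).mono (le_iSup₂_of_le k hk le_rfl) le_rfl

/-- This crude bound makes the sets under the suprema bounded above; otherwise the real `sSup` could
take its default value `0` and bound nothing. It also replaces the mixing bound when the latter
exceeds `1`. -/
lemma abs_cov_sets_le_one (P : Measure Ω) [IsProbabilityMeasure P] (A B : Set Ω) :
    |P.real (A ∩ B) - P.real A * P.real B| ≤ 1 := by
  have h1 := measureReal_nonneg (μ := P) (s := A ∩ B)
  have h2 := measureReal_le_one (μ := P) (s := A ∩ B)
  have h3 := mul_nonneg (measureReal_nonneg (μ := P) (s := A)) (measureReal_nonneg (μ := P) (s := B))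
  have h4 := mul_le_one₀ (measureReal_le_one (μ := P) (s := A))
    (measureReal_nonneg (μ := P) (s := B)) (measureReal_le_one (μ := P) (s := B))
  rw [abs_le]; constructor <;> linarith

lemma alphaTilde_le_one (P : Measure Ω) [IsProbabilityMeasure P]
    (Z : (Fin d → ℤ) → Ω → EuclideanSpace ℝ (Fin p)) (T₁ T₂ : Set (Fin d → ℤ)) :
    alphaTilde P Z T₁ T₂ ≤ 1 := by
  refine Real.sSup_le ?_ zero_le_one
  rintro x ⟨A, B, -, -, rfl⟩
  exact abs_cov_sets_le_one P A B

lemma le_alphaTilde (P : Measure Ω) [IsProbabilityMeasure P]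
    (Z : (Fin d → ℤ) → Ω → EuclideanSpace ℝ (Fin p)) {T₁ T₂ : Set (Fin d → ℤ)} {A B : Set Ω}
    (hA : MeasurableSet[sigmaField Z T₁] A) (hB : MeasurableSet[sigmaField Z T₂] B) :
    |P.real (A ∩ B) - P.real A * P.real B| ≤ alphaTilde P Z T₁ T₂ := by
  refine le_csSup ⟨1, ?_⟩ ⟨A, B, hA, hB, rfl⟩
  rintro x ⟨A, B, -, -, rfl⟩
  exact abs_cov_sets_le_one P A B

lemma alphaTilde_le_mixingCoeff (P : Measure Ω) [IsProbabilityMeasure P]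
    (Z : (Fin d → ℤ) → Ω → EuclideanSpace ℝ (Fin p)) {T₁ T₂ : Finset (Fin d → ℤ)} {k l : ℝ}
    (h1 : (T₁.card : ℝ) ≤ l) (h2 : (T₂.card : ℝ) ≤ l)
    (h : DisGE (T₁ : Set (Fin d → ℤ)) T₂ k) :
    alphaTilde P Z T₁ T₂ ≤ mixingCoeff P Z k l := by
  refine le_csSup ⟨1, ?_⟩ ⟨T₁, T₂, h1, h2, h, rfl⟩
  rintro x ⟨T₁, T₂, -, -, -, rfl⟩
  exact alphaTilde_le_one P Z _ _

end AlphaTilde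

/-! ### Covariances of products of mixing random variables -/

/-- The value `x` if `|x| ≤ T`, and `0` otherwise. -/
noncomputable def trunc (T x : ℝ) : ℝ := if |x| ≤ T then x else 0

lemma measurable_trunc (T : ℝ) : Measurable (trunc T) :=
  Measurable.ite (measurableSet_le measurable_id.abs measurable_const) measurable_id
    measurable_const

lemma abs_trunc_le {T : ℝ} (hT : 0 ≤ T) (x : ℝ) : |trunc T x| ≤ T := by
  unfold trunc; split_ifs with h
  · exact h
  · simpa

lemma abs_trunc_le_abs (T x : ℝ) : |trunc T x| ≤ |x| := by
  unfold trunc; split_ifs with h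
  · exact le_rfl
  · simp

section Products

variable {ι : Type*} [Fintype ι]

/-- The largest factor `x j` exceeds `T ≥ 1`, and the product is at most `|x j| ^ (s - δ)`; the
factor `|x j| ^ (-δ)` is then at most `T ^ (-δ)`. -/
lemma abs_prod_le_of_exists_lt {s δ T : ℝ} (hδ : 0 ≤ δ) (hs : Fintype.card ι + δ ≤ s)
    (hT : 1 ≤ T) (x : ι → ℝ) (h : ∃ i, T < |x i|) :
    |∏ i, x i| ≤ T ^ (-δ) * ∑ i, |x i| ^ s := by
  obtain ⟨i, hi⟩ := h
  have : Nonempty ι := ⟨i⟩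
  obtain ⟨j, hj⟩ := Finite.exists_max fun i => |x i|
  have hM : T < |x j| := hi.trans_le (hj i)
  have hM1 : 1 ≤ |x j| := hT.trans hM.le
  have hM0 : 0 < |x j| := by linarith
  calc |∏ i, x i| = ∏ i, |x i| := Finset.abs_prod _ _
    _ ≤ ∏ _i : ι, |x j| := Finset.prod_le_prod (fun _ _ => abs_nonneg _) fun i _ => hj i
    _ = |x j| ^ (Fintype.card ι : ℝ) := by simp
    _ ≤ |x j| ^ (-δ + s) := Real.rpow_le_rpow_of_exponent_le hM1 (by linarith)
    _ = |x j| ^ (-δ) * |x j| ^ s := Real.rpow_add hM0 _ _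
    _ ≤ T ^ (-δ) * ∑ i, |x i| ^ s := by
        refine mul_le_mul ?_ ?_ (by positivity) (by positivity)
        · exact Real.rpow_le_rpow_of_nonpos (by linarith) hM.le (by linarith)
        · exact Finset.single_le_sum (f := fun i => |x i| ^ s) (fun i _ => by positivity)
            (Finset.mem_univ j)

lemma abs_prod_le_one_add {s : ℝ} (hs : Fintype.card ι ≤ s) (x : ι → ℝ) :
    |∏ i, x i| ≤ 1 + ∑ i, |x i| ^ s := by
  have h0 : 0 ≤ ∑ i, |x i| ^ s := Finset.sum_nonneg fun i _ => by positivity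
  by_cases h : ∃ i, 1 < |x i|
  · have := abs_prod_le_of_exists_lt le_rfl (by simpa using hs) le_rfl x h
    simp only [neg_zero, Real.rpow_zero, one_mul] at this
    linarith
  · push Not at h
    have : ∏ i, |x i| ≤ 1 := Finset.prod_le_one (fun i _ => abs_nonneg _) fun i _ => h i
    rw [Finset.abs_prod]
    linarith

lemma abs_prod_sub_prod_trunc_le {s δ T : ℝ} (hδ : 0 ≤ δ) (hs : Fintype.card ι + δ ≤ s)
    (hT : 1 ≤ T) (x : ι → ℝ) :
    |∏ i, x i - ∏ i, trunc T (x i)| ≤ T ^ (-δ) * ∑ i, |x i| ^ s := by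
  by_cases h : ∃ i, T < |x i|
  · have h1 := abs_prod_le_of_exists_lt hδ hs hT x h
    obtain ⟨i, hi⟩ := h
    have : ∏ i, trunc T (x i) = 0 :=
      Finset.prod_eq_zero (Finset.mem_univ i) (by simp [trunc, not_le.2 hi])
    rwa [this, sub_zero]
  · push Not at h
    have : ∏ i, trunc T (x i) = ∏ i, x i := Finset.prod_congr rfl fun i _ => by simp [trunc, h i]
    rw [this, sub_self, abs_zero]
    positivity

variable {Ω : Type*} {m0 : MeasurableSpace Ω} {P : Measure Ω} [IsProbabilityMeasure P]
  {X : ι → Ω → ℝ} {s δ K : ℝ}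

lemma integrable_prod_of_moment (hX : ∀ i, Measurable (X i)) (hs : Fintype.card ι ≤ s)
    (hXi : ∀ i, Integrable (fun ω => |X i ω| ^ s) P) :
    Integrable (fun ω => ∏ i, X i ω) P := by
  refine Integrable.mono' ((integrable_const (1 : ℝ)).add
    (integrable_finsetSum Finset.univ fun i _ => hXi i))
    (Finset.measurable_fun_prod _ fun i _ => hX i).aestronglyMeasurable
    (Eventually.of_forall fun ω => ?_)
  exact abs_prod_le_one_add hs fun i => X i ω

lemma abs_integral_prod_le (hX : ∀ i, Measurable (X i)) (hs : Fintype.card ι ≤ s)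
    (hXi : ∀ i, Integrable (fun ω => |X i ω| ^ s) P) (hK : ∀ i, ∫ ω, |X i ω| ^ s ∂P ≤ K) :
    |∫ ω, ∏ i, X i ω ∂P| ≤ 1 + Fintype.card ι * K := by
  calc |∫ ω, ∏ i, X i ω ∂P| ≤ ∫ ω, |∏ i, X i ω| ∂P := abs_integral_le_integral_abs
    _ ≤ ∫ ω, (1 + ∑ i, |X i ω| ^ s) ∂P :=
        integral_mono (integrable_prod_of_moment hX hs hXi).abs
          ((integrable_const (1 : ℝ)).add (integrable_finsetSum Finset.univ fun i _ => hXi i))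
          fun ω => abs_prod_le_one_add hs fun i => X i ω
    _ = 1 + ∑ i, ∫ ω, |X i ω| ^ s ∂P := by
        rw [integral_add (integrable_const _)
          (integrable_finsetSum Finset.univ fun i _ => hXi i),
          integral_finsetSum _ fun i _ => hXi i]
        simp
    _ ≤ 1 + Fintype.card ι * K := by
        have := Finset.sum_le_sum fun i (_ : i ∈ Finset.univ) => hK i
        simpa using this

lemma abs_integral_prod_sub_trunc_le (hX : ∀ i, Measurable (X i)) (hδ : 0 ≤ δ)
    (hs : Fintype.card ι + δ ≤ s)
    (hXi : ∀ i, Integrable (fun ω => |X i ω| ^ s) P) (hK : ∀ i, ∫ ω, |X i ω| ^ s ∂P ≤ K)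
    {T : ℝ} (hT : 1 ≤ T) :
    |(∫ ω, ∏ i, X i ω ∂P) - ∫ ω, ∏ i, trunc T (X i ω) ∂P| ≤ T ^ (-δ) * (Fintype.card ι * K) := by
  have hT0 : 0 ≤ T := by linarith
  have h1 := integrable_prod_of_moment (P := P) hX (by linarith) hXi
  have h2 : Integrable (fun ω => ∏ i, trunc T (X i ω)) P := by
    refine h1.mono (Finset.measurable_fun_prod _ fun i _ =>
      (measurable_trunc T).comp (hX i)).aestronglyMeasurable (Eventually.of_forall fun ω => ?_)
    simp only [Real.norm_eq_abs, Finset.abs_prod]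
    exact Finset.prod_le_prod (fun i _ => abs_nonneg _) fun i _ => abs_trunc_le_abs _ _
  rw [← integral_sub h1 h2]
  calc _ ≤ ∫ ω, |∏ i, X i ω - ∏ i, trunc T (X i ω)| ∂P := abs_integral_le_integral_abs
    _ ≤ ∫ ω, T ^ (-δ) * ∑ i, |X i ω| ^ s ∂P :=
        integral_mono (h1.sub h2).abs
          ((integrable_finsetSum Finset.univ fun i _ => hXi i).const_mul _)
          fun ω => abs_prod_sub_prod_trunc_le hδ hs hT fun i => X i ω
    _ = T ^ (-δ) * ∑ i, ∫ ω, |X i ω| ^ s ∂P := by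
        rw [integral_const_mul, integral_finsetSum _ fun i _ => hXi i]
    _ ≤ _ := by
        gcongr
        have := Finset.sum_le_sum fun i (_ : i ∈ Finset.univ) => hK i
        simpa using this

lemma abs_prod_trunc_le {T : ℝ} (hT : 1 ≤ T) {u : ℝ} (hu : Fintype.card ι ≤ u) (x : ι → ℝ) :
    |∏ i, trunc T (x i)| ≤ T ^ u := by
  have hT0 : 0 ≤ T := by linarith
  rw [Finset.abs_prod]
  calc ∏ i, |trunc T (x i)| ≤ ∏ _i : ι, T :=
        Finset.prod_le_prod (fun _ _ => abs_nonneg _) fun i _ => abs_trunc_le hT0 _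
    _ = T ^ (Fintype.card ι : ℝ) := by simp
    _ ≤ T ^ u := Real.rpow_le_rpow_of_exponent_le hT hu

/-- A Davydov-type inequality for products: if the factors split into two groups that are
measurable with respect to σ-fields with mixing coefficient at most `α`, the expectation of the
product factorizes up to an error of order `α ^ (δ / s)`. -/
lemma abs_integral_prod_sub_mul_le {ι Ω : Type*} [Fintype ι] {m₁ m₂ m0 : MeasurableSpace Ω}
    {P : Measure Ω} [IsProbabilityMeasure P] {X : ι → Ω → ℝ} {s δ K : ℝ} (h₁ : m₁ ≤ m0) (h₂ : m₂ ≤ m0)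
    (q : ι → Prop) [DecidablePred q] (hq₁ : ∀ i, q i → Measurable[m₁] (X i))
    (hq₂ : ∀ i, ¬ q i → Measurable[m₂] (X i)) (hδ : 0 < δ) (hs : Fintype.card ι + δ ≤ s)
    (hXi : ∀ i, Integrable (fun ω => |X i ω| ^ s) P) (hK : ∀ i, ∫ ω, |X i ω| ^ s ∂P ≤ K)
    (hK0 : 0 ≤ K) {α : ℝ} (hα0 : 0 ≤ α)
    (hα : ∀ S T : Set Ω, MeasurableSet[m₁] S → MeasurableSet[m₂] T →
      |P.real (S ∩ T) - P.real S * P.real T| ≤ α) :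
    |(∫ ω, ∏ i, X i ω ∂P) -
      (∫ ω, ∏ i : {i // q i}, X i ω ∂P) * ∫ ω, ∏ i : {i // ¬ q i}, X i ω ∂P| ≤
      (4 + 3 * (1 + Fintype.card ι * K) ^ 2) * α ^ (δ / s) := by
  set n : ℝ := (Fintype.card ι : ℝ) with hn
  have hn0 : 0 ≤ n := Nat.cast_nonneg _
  have hs0 : 0 < s := by linarith
  have hX : ∀ i, Measurable (X i) := fun i => by
    by_cases h : q i
    · exact (hq₁ i h).mono h₁ le_rfl
    · exact (hq₂ i h).mono h₂ le_rfl
  have hcU : (Fintype.card {i // q i} : ℝ) ≤ n := by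
    rw [hn]; exact_mod_cast Fintype.card_subtype_le q
  have hcV : (Fintype.card {i // ¬ q i} : ℝ) ≤ n := by
    rw [hn]; exact_mod_cast Fintype.card_subtype_le fun i => ¬ q i
  have hcUV : (Fintype.card {i // q i} : ℝ) + Fintype.card {i // ¬ q i} = n := by
    have := Fintype.card_subtype_compl q
    have h2 := Fintype.card_subtype_le q
    rw [hn, this]
    push_cast [h2]
    ring
  set B : ℝ := 1 + n * K with hB
  have hB1 : 1 ≤ B := by rw [hB]; linarith [mul_nonneg hn0 hK0]
  set EA := ∫ ω, ∏ i, X i ω ∂P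
  set EU := ∫ ω, ∏ i : {i // q i}, X i ω ∂P
  set EV := ∫ ω, ∏ i : {i // ¬ q i}, X i ω ∂P
  have hEV : |EV| ≤ B := by
    refine (abs_integral_prod_le (X := fun i : {i // ¬ q i} => X i) (fun i => hX i) (by linarith) (fun i => hXi i)
      fun i => hK i).trans ?_
    rw [hB]; gcongr
  have hEU : |EU| ≤ B := by
    refine (abs_integral_prod_le (X := fun i : {i // q i} => X i) (fun i => hX i) (by linarith) (fun i => hXi i)
      fun i => hK i).trans ?_
    rw [hB]; gcongr
  -- the bound for `α` replaced by a larger number in `(0, 1]`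
  have key : ∀ β : ℝ, 0 < β → β ≤ 1 → (∀ S T : Set Ω, MeasurableSet[m₁] S → MeasurableSet[m₂] T →
      |P.real (S ∩ T) - P.real S * P.real T| ≤ β) →
      |EA - EU * EV| ≤ (4 + 3 * B ^ 2) * β ^ (δ / s) := by
    intro β hβ hβ1 hmix
    -- This level balances the truncation error `T ^ (-δ)` and the covariance bound `β * T ^ (s -
    -- δ)`: both equal `β ^ (δ / s)`.
    set T : ℝ := β ^ (-(1 / s)) with hT
    have hT1 : 1 ≤ T := Real.one_le_rpow_of_pos_of_le_one_of_nonpos hβ hβ1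
      (by simpa using hs0.le)
    have hT0 : 0 < T := by linarith
    have eTδ : T ^ (-δ) = β ^ (δ / s) := by
      rw [hT, ← Real.rpow_mul hβ.le]; congr 1; ring
    have eTs : β * T ^ (s - δ) = β ^ (δ / s) := by
      rw [hT, ← Real.rpow_mul hβ.le]
      nth_rewrite 1 [← Real.rpow_one β]
      rw [← Real.rpow_add hβ]; congr 1; field_simp; ring
    set EA' := ∫ ω, ∏ i, trunc T (X i ω) ∂P with hEA'
    set EU' := ∫ ω, ∏ i : {i // q i}, trunc T (X i ω) ∂P
    set EV' := ∫ ω, ∏ i : {i // ¬ q i}, trunc T (X i ω) ∂P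
    have dA : |EA - EA'| ≤ B * β ^ (δ / s) := by
      have := abs_integral_prod_sub_trunc_le hX hδ.le hs hXi hK hT1
      rw [eTδ] at this
      refine this.trans ?_
      rw [mul_comm]
      gcongr
      linarith
    have dU : |EU - EU'| ≤ B * β ^ (δ / s) := by
      have := abs_integral_prod_sub_trunc_le (X := fun i : {i // q i} => X i) (fun i => hX i)
        hδ.le (by linarith) (fun i => hXi i) (fun i => hK i) hT1
      rw [eTδ] at this
      refine this.trans ?_
      rw [mul_comm]
      gcongr
      rw [hB]
      linarith [mul_le_mul_of_nonneg_right hcU hK0]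
    have dV : |EV - EV'| ≤ B * β ^ (δ / s) := by
      have := abs_integral_prod_sub_trunc_le (X := fun i : {i // ¬ q i} => X i) (fun i => hX i)
        hδ.le (by linarith) (fun i => hXi i) (fun i => hK i) hT1
      rw [eTδ] at this
      refine this.trans ?_
      rw [mul_comm]
      gcongr
      rw [hB]
      linarith [mul_le_mul_of_nonneg_right hcV hK0]
    have hEU' : |EU'| ≤ B := by
      have hle : ∀ i : {i // q i}, ∀ ω, |trunc T (X i ω)| ^ s ≤ |X i ω| ^ s := fun i ω =>
        Real.rpow_le_rpow (abs_nonneg _) (abs_trunc_le_abs _ _) hs0.le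
      have hmeas : ∀ i : {i // q i}, Measurable fun ω => trunc T (X i ω) := fun i =>
        (measurable_trunc T).comp (hX i)
      have hint : ∀ i : {i // q i}, Integrable (fun ω => |trunc T (X i ω)| ^ s) P := fun i => by
        refine (hXi i).mono' ((hmeas i).abs.pow_const s).aestronglyMeasurable
          (Eventually.of_forall fun ω => ?_)
        rw [Real.norm_eq_abs, abs_of_nonneg (by positivity)]
        exact hle i ω
      refine (abs_integral_prod_le (X := fun (i : {i // q i}) ω => trunc T (X i ω)) hmeas
        (by linarith) hint fun i => (integral_mono (hint i) (hXi i) (hle i)).trans (hK i)).trans ?_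
      rw [hB]; gcongr
    have dUV : |EA' - EU' * EV'| ≤ 4 * β ^ (δ / s) := by
      have e : ∀ ω, ∏ i, trunc T (X i ω) =
          (∏ i : {i // q i}, trunc T (X i ω)) * ∏ i : {i // ¬ q i}, trunc T (X i ω) := fun ω =>
        (Fintype.prod_subtype_mul_prod_subtype q fun i => trunc T (X i ω)).symm
      have hmU : Measurable[m₁] fun ω => ∏ i : {i // q i}, trunc T (X i ω) :=
        Finset.measurable_fun_prod _ fun i _ => (measurable_trunc T).comp (hq₁ i i.2)
      have hmV : Measurable[m₂] fun ω => ∏ i : {i // ¬ q i}, trunc T (X i ω) :=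
        Finset.measurable_fun_prod _ fun i _ => (measurable_trunc T).comp (hq₂ i i.2)
      have := abs_cov_le_of_mixing h₁ h₂ P hmix hmU.stronglyMeasurable
        (fun ω => abs_prod_trunc_le hT1 le_rfl fun i : {i // q i} => X i ω) hmV.stronglyMeasurable
        (fun ω => abs_prod_trunc_le hT1 le_rfl fun i : {i // ¬ q i} => X i ω)
      simp only [← e] at this
      refine this.trans ?_
      rw [← eTs, mul_assoc 4, ← Real.rpow_add hT0, mul_assoc, mul_comm (T ^ _)]
      have hexp : (Fintype.card {i // q i} : ℝ) + Fintype.card {i // ¬ q i} ≤ s - δ := by linarith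
      gcongr
    have e0 : EA - EU * EV = (EA - EA') + (EA' - EU' * EV') - EU' * (EV - EV')
        - EV * (EU - EU') := by ring
    have hβ0 : 0 ≤ β ^ (δ / s) := by positivity
    calc |EA - EU * EV| ≤ |EA - EA'| + |EA' - EU' * EV'| + |EU' * (EV - EV')|
          + |EV * (EU - EU')| := by
          rw [e0]
          exact (abs_sub _ _).trans (add_le_add_left ((abs_sub _ _).trans
            (add_le_add_left (abs_add_le _ _) _)) _)
      _ ≤ B * β ^ (δ / s) + 4 * β ^ (δ / s) + B * (B * β ^ (δ / s)) + B * (B * β ^ (δ / s)) := by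
          rw [abs_mul, abs_mul]; gcongr
      -- Since `1 ≤ B`, the term `B` is absorbed into `B ^ 2`.
      _ ≤ _ := by nlinarith [mul_nonneg (mul_nonneg (by linarith : 0 ≤ B) (by linarith : 0 ≤ B - 1)) hβ0]
  have key2 : ∀ β : ℝ, α < β → |EA - EU * EV| ≤ (4 + 3 * B ^ 2) * β ^ (δ / s) := by
    intro β hβ
    have hβ0 : 0 < β := hα0.trans_lt hβ
    rcases le_or_gt β 1 with h | h
    · exact key β hβ0 h fun S T hS hT => (hα S T hS hT).trans hβ.le
    · refine (key 1 one_pos le_rfl fun S T _ _ => abs_cov_sets_le_one P S T).trans ?_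
      gcongr
  -- Letting `β` decrease to `α` also covers `α = 0`, for which no truncation level is available.
  have hcont : Tendsto (fun β : ℝ => (4 + 3 * B ^ 2) * β ^ (δ / s)) (𝓝[>] α)
      (𝓝 ((4 + 3 * B ^ 2) * α ^ (δ / s))) :=
    (((Real.continuous_rpow_const (by positivity)).tendsto α).const_mul _).mono_left
      nhdsWithin_le_nhds
  exact ge_of_tendsto hcont (eventually_nhdsWithin_of_forall key2)

end Products

/-! ### Sums over integer lattices -/

/-- The `ℓ^∞` norm of an integer vector, as a natural number. -/
def supNorm {κ : Type*} [Fintype κ] (v : κ → ℤ) : ℕ := Finset.univ.sup fun i => (v i).natAbs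

lemma supNorm_le_iff {κ : Type*} [Fintype κ] {v : κ → ℤ} {R : ℕ} :
    supNorm v ≤ R ↔ ∀ i, (v i).natAbs ≤ R := by
  simp [supNorm, Finset.sup_le_iff]

lemma natAbs_le_supNorm {κ : Type*} [Fintype κ] (v : κ → ℤ) (i : κ) :
    (v i).natAbs ≤ supNorm v := supNorm_le_iff.1 le_rfl i

lemma exists_le_natAbs {κ : Type*} [Fintype κ] {v : κ → ℤ} {R : ℕ} (hR : 0 < R)
    (h : R ≤ supNorm v) : ∃ i, R ≤ (v i).natAbs := by
  by_contra! hc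
  have : supNorm v ≤ R - 1 := supNorm_le_iff.2 fun i => Nat.le_sub_one_of_lt (hc i)
  omega

lemma supNorm_add_le {κ : Type*} [Fintype κ] (v w : κ → ℤ) :
    supNorm (v + w) ≤ supNorm v + supNorm w :=
  supNorm_le_iff.2 fun i => (Int.natAbs_add_le _ _).trans
    (add_le_add (natAbs_le_supNorm v i) (natAbs_le_supNorm w i))

lemma supNorm_le_dist {κ : Type*} [Fintype κ] (v w : κ → ℤ) : (supNorm (v - w) : ℝ) ≤ dist v w := by
  have : supNorm (v - w) ≤ ⌊dist v w⌋₊ := supNorm_le_iff.2 fun i => Nat.le_floor <| by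
    refine le_trans (le_of_eq ?_) (dist_le_pi_dist v w i)
    rw [Int.dist_eq]
    simp [Nat.cast_natAbs]
  exact (Nat.cast_le.2 this).trans (Nat.floor_le dist_nonneg)

/-- The natural number `⌈a / q⌉`. -/
def ceilDivNat (a q : ℕ) : ℕ := (a + (q - 1)) / q

lemma ceilDivNat_le_iff {a q m : ℕ} (hq : 0 < q) : ceilDivNat a q ≤ m ↔ a ≤ q * m := by
  unfold ceilDivNat
  rw [Nat.div_le_iff_le_mul_add_pred hq]
  omega

/-- The integer vectors with `ℓ^∞` norm at most `R`. -/
noncomputable def latticeBox (κ : Type*) [Fintype κ] [DecidableEq κ] (R : ℕ) : Finset (κ → ℤ) :=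
  Fintype.piFinset fun _ => Finset.Icc (-(R : ℤ)) R

lemma mem_latticeBox {κ : Type*} [Fintype κ] [DecidableEq κ] {R : ℕ} {v : κ → ℤ} :
    v ∈ latticeBox κ R ↔ supNorm v ≤ R := by
  simp only [latticeBox, Fintype.mem_piFinset, Finset.mem_Icc, supNorm_le_iff]
  refine forall_congr' fun i => ?_
  omega

lemma card_latticeBox (κ : Type*) [Fintype κ] [DecidableEq κ] (R : ℕ) :
    (latticeBox κ R).card = (2 * R + 1) ^ Fintype.card κ := by
  have : ((R : ℤ) + 1 + R).toNat = 2 * R + 1 := by omega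
  simp [latticeBox, Fintype.card_piFinset, this]

/-- A discrete mean value inequality. It bounds the number of lattice points between two cubes by a
power one below the dimension. -/
lemma pow_sub_pow_le_mul (D a b : ℕ) : (a + b) ^ D - a ^ D ≤ b * D * (a + b) ^ (D - 1) := by
  induction D with
  | zero => simp
  | succ D ih =>
    rcases Nat.eq_zero_or_pos D with rfl | hD
    · simp
    · have h1 : (a + b) ^ D ≤ a ^ D + b * D * (a + b) ^ (D - 1) := by omega
      have h2 : (a + b) ^ (D - 1) * (a + b) = (a + b) ^ D := by
        rw [← pow_succ, Nat.sub_add_cancel hD]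
      rw [Nat.add_sub_cancel, Nat.sub_le_iff_le_add]
      calc (a + b) ^ (D + 1) = (a + b) ^ D * b + (a + b) ^ D * a := by ring
        _ ≤ (a + b) ^ D * b + (a ^ D + b * D * (a + b) ^ (D - 1)) * a := by gcongr
        _ = (a + b) ^ D * b + a ^ (D + 1) + b * D * ((a + b) ^ (D - 1) * a) := by ring
        _ ≤ (a + b) ^ D * b + a ^ (D + 1) + b * D * ((a + b) ^ (D - 1) * (a + b)) := by
            gcongr; omega
        _ = b * (D + 1) * (a + b) ^ D + a ^ (D + 1) := by rw [h2]; ring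

/-- The level set lies in the shell `q * m < ‖v‖ ≤ q * (m + 1)` between two lattice cubes with `2 *
q * m + 1` and `2 * q * (m + 1) + 1 ≤ 3 * q * (m + 1)` points per side. -/
lemma card_filter_ceilDivNat_le {κ : Type*} [Fintype κ] {q : ℕ} (hq : 0 < q)
    (W : Finset (κ → ℤ)) (m : ℕ) :
    (W.filter fun v => ceilDivNat (supNorm v) q = m + 1).card ≤
      2 * q * Fintype.card κ * (3 * q) ^ (Fintype.card κ - 1) *
        (m + 1) ^ (Fintype.card κ - 1) := by
  classical
  have hsub : (W.filter fun v => ceilDivNat (supNorm v) q = m + 1) ⊆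
      latticeBox κ (q * (m + 1)) \ latticeBox κ (q * m) := by
    intro v hv
    obtain ⟨-, hv⟩ := Finset.mem_filter.1 hv
    rw [Finset.mem_sdiff, mem_latticeBox, mem_latticeBox, ← ceilDivNat_le_iff hq,
      ← ceilDivNat_le_iff hq, hv]
    omega
  refine (Finset.card_le_card hsub).trans ?_
  rw [Finset.card_sdiff_of_subset fun v hv => by
      rw [mem_latticeBox] at hv ⊢
      exact hv.trans (Nat.mul_le_mul_left _ (Nat.le_succ m)),
    card_latticeBox, card_latticeBox]
  have e : 2 * (q * (m + 1)) + 1 = (2 * (q * m) + 1) + 2 * q := by ring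
  rw [e]
  refine (pow_sub_pow_le_mul _ _ _).trans ?_
  rw [mul_assoc (2 * q * _), ← mul_pow]
  gcongr
  nlinarith

/-- Sums of radial functions over a lattice of dimension `D` are controlled by weighted
one-dimensional sums. -/
lemma exists_sum_radial_le {D q : ℕ} (hq : 0 < q) {f : ℕ → ℝ} (hf0 : ∀ m, 0 ≤ f m)
    (hf : Summable fun m : ℕ => ((m : ℝ) + 1) ^ (D - 1) * f (m + 1)) :
    ∃ C, 0 ≤ C ∧ ∀ (κ : Type) [Fintype κ], Fintype.card κ = D → ∀ W : Finset (κ → ℤ),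
      ∑ v ∈ W, f (ceilDivNat (supNorm v) q) ≤ C := by
  set A : ℝ := 2 * q * D * (3 * q) ^ (D - 1) with hA
  have hA0 : 0 ≤ A := by positivity
  set g : ℕ → ℝ := fun m => if m = 0 then f 0 else A * ((m : ℝ) ^ (D - 1) * f m) with hg
  have hg0 : ∀ m, 0 ≤ g m := fun m => by
    have := hf0 m
    have := hf0 0
    simp only [hg]; split_ifs <;> positivity
  have hgs : Summable g := by
    rw [← summable_nat_add_iff 1]
    simpa [hg] using hf.mul_left A
  refine ⟨∑' m, g m, tsum_nonneg hg0, fun κ _ hκ W => ?_⟩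
  classical
  rw [← Finset.sum_fiberwise_of_maps_to (t := W.image fun v => ceilDivNat (supNorm v) q)
    (g := fun v => ceilDivNat (supNorm v) q) fun v hv => Finset.mem_image_of_mem _ hv]
  refine (Finset.sum_le_sum fun m _ => ?_).trans (hgs.sum_le_tsum _ fun m _ => hg0 m)
  rw [Finset.sum_congr rfl fun v hv => by rw [(Finset.mem_filter.1 hv).2], Finset.sum_const,
    nsmul_eq_mul]
  rcases m with _ | m
  · simp only [hg, if_pos]
    have hc : (W.filter fun v => ceilDivNat (supNorm v) q = 0).card ≤ 1 := by
      refine Finset.card_le_one.2 fun v hv w hw => ?_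
      have key : ∀ u ∈ W.filter fun v => ceilDivNat (supNorm v) q = 0, u = 0 := fun u hu => by
        have h1 := (ceilDivNat_le_iff hq).1 (Finset.mem_filter.1 hu).2.le
        ext i
        have := natAbs_le_supNorm u i
        simp only [Pi.zero_apply]
        omega
      rw [key v hv, key w hw]
    have hc' : ((W.filter fun v => ceilDivNat (supNorm v) q = 0).card : ℝ) ≤ 1 := by
      exact_mod_cast hc
    nlinarith [hf0 0]
  · have hc := card_filter_ceilDivNat_le hq W m
    rw [hκ] at hc
    have hc' : ((W.filter fun v => ceilDivNat (supNorm v) q = m + 1).card : ℝ) ≤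
        A * ((m + 1 : ℕ) : ℝ) ^ (D - 1) := by
      rw [hA]; exact_mod_cast hc
    simp only [hg, Nat.add_eq_zero_iff, one_ne_zero, and_false, if_false]
    rw [← mul_assoc]
    exact mul_le_mul_of_nonneg_right hc' (hf0 _)

/-- Pigeonhole: numbers indexed by `q` indices, one of them `0` and one of them at least `M`, have
a gap of length at least `⌈M / q⌉`. -/
lemma exists_gap {ι : Type*} [Fintype ι] (r : ι → ℕ) {i₀ j₀ : ι} {M : ℕ} (hi₀ : r i₀ = 0)
    (hM : 0 < M) (hj₀ : M ≤ r j₀) :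
    ∃ c : ℕ, r i₀ ≤ c ∧ c < r j₀ ∧
      ∀ i j, r i ≤ c → c < r j → r i + ceilDivNat M (Fintype.card ι) ≤ r j := by
  classical
  set q := Fintype.card ι with hq
  have hq0 : 0 < q := Fintype.card_pos_iff.2 ⟨i₀⟩
  -- For `r i > 0`, `(q * r i - 1) / M` is the index of the interval `(k * M, (k + 1) * M]`
  -- containing `q * r i`. The index `i₀` sits at `0`, outside all of them, so the other `q - 1`
  -- indices leave one of the first `q` intervals free. Truncated subtraction assigns further zeros
  -- to interval `0`, which does no harm.
  have hcard : ((Finset.univ.erase i₀).image fun i => (q * r i - 1) / M).card <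
      (Finset.range q).card := by
    refine Finset.card_image_le.trans_lt ?_
    rw [Finset.card_erase_of_mem (Finset.mem_univ _), Finset.card_univ, Finset.card_range]
    omega
  obtain ⟨k, hk, hk'⟩ := Finset.exists_mem_notMem_of_card_lt_card hcard
  have hkq : k < q := Finset.mem_range.1 hk
  have hgap : ∀ j, k * M < q * r j → (k + 1) * M < q * r j := by
    intro j hj
    by_contra! hc
    refine hk' (Finset.mem_image.2 ⟨j, Finset.mem_erase.2 ⟨?_, Finset.mem_univ _⟩, ?_⟩)
    · rintro rfl
      simp [hi₀] at hj
    · refine Nat.div_eq_of_lt_le ?_ ?_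
      · omega
      · omega
  have hc : ∀ j, k * M / q < r j ↔ k * M < q * r j := fun j => by
    rw [Nat.div_lt_iff_lt_mul hq0, mul_comm q]
  refine ⟨k * M / q, by simp [hi₀], ?_, fun i j hi hj => ?_⟩
  · rw [hc]
    calc k * M < q * M := Nat.mul_lt_mul_of_pos_right hkq hM
      _ ≤ q * r j₀ := Nat.mul_le_mul_left _ hj₀
  · rw [hc] at hj
    rw [← not_lt, hc, not_lt] at hi
    have h1 := hgap j hj
    have hle : r i ≤ r j := by
      by_contra! h
      have := Nat.mul_le_mul_left q h.le
      linarith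
    have : ceilDivNat M q ≤ r j - r i := by
      rw [ceilDivNat_le_iff hq0, Nat.mul_sub]
      have e : (k + 1) * M = k * M + M := by ring
      omega
    omega

/-! ### Sums of mixed moments -/

/-- If one index of `s` is fixed, radial functions of the remaining ones sum to a constant. -/
lemma exists_sum_piFinset_radial_le {d n : ℕ} (hn : 2 ≤ n) {f : ℕ → ℝ} (hf0 : ∀ m, 0 ≤ f m)
    (hf : Summable fun m : ℕ => ((m : ℝ) + 1) ^ ((n - 1) * d - 1) * f (m + 1)) :
    ∃ C, 0 ≤ C ∧ ∀ (ι : Type) [Fintype ι] [DecidableEq ι], Fintype.card ι = n → ∀ i₀ : ι,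
      ∀ S : Finset (Fin d → ℤ),
      ∑ s ∈ Fintype.piFinset fun _ : ι => S,
        f (ceilDivNat (supNorm fun x : {i // i ≠ i₀} × Fin d => s x.1 x.2 - s i₀ x.2) n) ≤
        C * S.card := by
  obtain ⟨C, hC0, hC⟩ := exists_sum_radial_le (by omega : 0 < n) hf0 hf
  refine ⟨C, hC0, fun ι _ _ hι i₀ S => ?_⟩
  -- A tuple is determined by its base site and its differences from it. The base site contributes
  -- the factor `S.card`, the differences a radial sum in dimension `(n - 1) * d`.
  set φ : (ι → Fin d → ℤ) → (Fin d → ℤ) × ({i // i ≠ i₀} × Fin d → ℤ) :=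
    fun s => (s i₀, fun x => s x.1 x.2 - s i₀ x.2) with hφ
  have hinj : Function.Injective φ := by
    intro s s' h
    simp only [hφ, Prod.mk.injEq] at h
    obtain ⟨h1, h2⟩ := h
    funext i j
    by_cases hi : i = i₀
    · rw [hi, h1]
    · have := congrFun h2 (⟨i, hi⟩, j)
      simp only [h1] at this
      omega
  set W := (Fintype.piFinset fun _ : ι => S).image fun s => (φ s).2 with hW
  have hcard : Fintype.card ({i // i ≠ i₀} × Fin d) = (n - 1) * d := by
    simp [Fintype.card_prod, Fintype.card_subtype_compl, hι]
  calc _ = ∑ y ∈ (Fintype.piFinset fun _ : ι => S).image φ, f (ceilDivNat (supNorm y.2) n) := by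
        rw [Finset.sum_image fun _ _ _ _ h => hinj h]
    _ ≤ ∑ y ∈ S ×ˢ W, f (ceilDivNat (supNorm y.2) n) := by
        refine Finset.sum_le_sum_of_subset_of_nonneg (fun y hy => ?_) fun _ _ _ => hf0 _
        obtain ⟨s, hs, rfl⟩ := Finset.mem_image.1 hy
        exact Finset.mem_product.2 ⟨Fintype.mem_piFinset.1 hs i₀, Finset.mem_image_of_mem _ hs⟩
    _ = S.card * ∑ v ∈ W, f (ceilDivNat (supNorm v) n) := by
        rw [Finset.sum_product]; simp
    _ ≤ S.card * C := by gcongr; exact hC _ hcard W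
    _ = _ := mul_comm _ _

lemma sum_piFinset_mul_subtype {ι E : Type*} [Fintype ι] [DecidableEq ι] (q : ι → Prop)
    [DecidablePred q] (S : Finset E) (F : ({i // q i} → E) → ℝ) (G : ({i // ¬ q i} → E) → ℝ) :
    ∑ s ∈ Fintype.piFinset fun _ : ι => S, F (fun i => s i) * G (fun i => s i) =
      (∑ s ∈ Fintype.piFinset fun _ : {i // q i} => S, F s) *
        ∑ s ∈ Fintype.piFinset fun _ : {i // ¬ q i} => S, G s := by
  rw [Finset.sum_mul_sum, ← Finset.sum_product']
  refine Finset.sum_equiv (Equiv.piEquivPiSubtypeProd q fun _ => E) (fun s => ?_) fun s _ => rfl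
  simp only [Fintype.mem_piFinset, Finset.mem_product, Equiv.piEquivPiSubtypeProd,
    Equiv.coe_fn_mk, Subtype.forall]
  exact ⟨fun h => ⟨fun i _ => h i, fun i _ => h i⟩,
    fun h i => if hi : q i then h.1 i hi else h.2 i hi⟩

section MomentSums

variable {d : ℕ} {κ Ω : Type*} [MeasurableSpace Ω]

/-- A centred family of random fields on `ℤ^d` whose mixed moments of order at most `Q` are
bounded by `f 0` and factorize up to `f m` when the sites split into groups at distance `m`. -/
structure IsWeaklyDependent (P : Measure Ω) (X : κ → (Fin d → ℤ) → Ω → ℝ) (Q : ℕ)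
    (f : ℕ → ℝ) : Prop where
  nonneg : ∀ m, 0 ≤ f m
  summable : Summable fun m : ℕ => ((m : ℝ) + 1) ^ ((Q - 1) * d - 1) * f (m + 1)
  mean_zero : ∀ c k, ∫ ω, X c k ω ∂P = 0
  integrable : ∀ (ι : Type) [Fintype ι] (c : ι → κ) (s : ι → Fin d → ℤ), Fintype.card ι ≤ Q →
    Integrable (fun ω => ∏ i, X (c i) (s i) ω) P
  bound : ∀ (ι : Type) [Fintype ι] (c : ι → κ) (s : ι → Fin d → ℤ), Fintype.card ι ≤ Q →
    |∫ ω, ∏ i, X (c i) (s i) ω ∂P| ≤ f 0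
  split : ∀ (ι : Type) [Fintype ι] (c : ι → κ) (s : ι → Fin d → ℤ) (q : ι → Prop)
    [DecidablePred q] (m : ℕ), Fintype.card ι ≤ Q → 1 ≤ m →
    (∀ i j, q i → ¬ q j → m ≤ supNorm (s j - s i)) →
    |(∫ ω, ∏ i, X (c i) (s i) ω ∂P) - (∫ ω, ∏ i : {i // q i}, X (c i) (s i) ω ∂P) *
      ∫ ω, ∏ i : {i // ¬ q i}, X (c i) (s i) ω ∂P| ≤ f m

variable {P : Measure Ω} {X : κ → (Fin d → ℤ) → Ω → ℝ} {Q : ℕ} {f : ℕ → ℝ}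

lemma IsWeaklyDependent.summable_of_le (h : IsWeaklyDependent P X Q f) {n : ℕ} (hn : n ≤ Q) :
    Summable fun m : ℕ => ((m : ℝ) + 1) ^ ((n - 1) * d - 1) * f (m + 1) := by
  refine h.summable.of_nonneg_of_le (fun m => mul_nonneg (by positivity) (h.nonneg _)) fun m => ?_
  refine mul_le_mul_of_nonneg_right (pow_le_pow_right₀ (by linarith [m.cast_nonneg (α := ℝ)]) ?_)
    (h.nonneg _)
  exact Nat.sub_le_sub_right (Nat.mul_le_mul_right d (Nat.sub_le_sub_right hn 1)) 1

/-- Sort the sites by their distance from `s i₀`. The pigeonhole lemma finds a gap of at least the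
largest distance divided by the number of sites, and the sites before and after the gap are that far
apart, so the expectation factorizes up to `f` of the gap. The splitting depends on `s`; summing
over all splittings into two nonempty groups removes this dependence, so that the bound can be
summed over `s`. If all sites coincide, the trivial bound `f 0` is enough. -/
lemma IsWeaklyDependent.abs_integral_prod_le (h : IsWeaklyDependent P X Q f) {ι : Type} [Fintype ι]
    [DecidableEq ι] (hι : Fintype.card ι ≤ Q) (i₀ : ι) (c : ι → κ)
    (s : ι → Fin d → ℤ) :
    |∫ ω, ∏ i, X (c i) (s i) ω ∂P| ≤
      f (ceilDivNat (supNorm fun x : {i // i ≠ i₀} × Fin d => s x.1 x.2 - s i₀ x.2)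
        (Fintype.card ι)) +
      ∑ U ∈ Finset.univ.filter fun U : ι → Bool => (∃ i, U i) ∧ ∃ i, ¬ U i,
        |∫ ω, ∏ i : {i // U i}, X (c i) (s i) ω ∂P| *
        |∫ ω, ∏ i : {i // ¬ U i}, X (c i) (s i) ω ∂P| := by
  have hq0 : 0 < Fintype.card ι := Fintype.card_pos_iff.2 ⟨i₀⟩
  set v : {i // i ≠ i₀} × Fin d → ℤ := fun x => s x.1 x.2 - s i₀ x.2 with hv
  rcases Nat.eq_zero_or_pos (supNorm v) with h0 | hpos
  · have : ceilDivNat (supNorm v) (Fintype.card ι) = 0 := by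
      have := (ceilDivNat_le_iff hq0 (a := supNorm v) (m := 0)).2 (by simp [h0])
      omega
    rw [this]
    refine (h.bound ι c s hι).trans (le_add_of_nonneg_right ?_)
    exact Finset.sum_nonneg fun _ _ => by positivity
  · obtain ⟨⟨⟨j₀, hj₀'⟩, b⟩, hx⟩ := exists_le_natAbs hpos le_rfl
    have hj₀ : supNorm v ≤ supNorm (s j₀ - s i₀) :=
      hx.trans (natAbs_le_supNorm (s j₀ - s i₀) b)
    obtain ⟨a, ha1, ha2, ha3⟩ := exists_gap (fun i => supNorm (s i - s i₀)) (i₀ := i₀) (j₀ := j₀)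
      (by simp [supNorm]) hpos hj₀
    set U : ι → Bool := fun i => decide (supNorm (s i - s i₀) ≤ a) with hU
    have hmem : ∀ i, U i ↔ supNorm (s i - s i₀) ≤ a := fun i => by simp [hU]
    have hm1 : 1 ≤ ceilDivNat (supNorm v) (Fintype.card ι) := by
      by_contra! hc
      have := (ceilDivNat_le_iff hq0 (a := supNorm v) (m := 0)).1 (by omega)
      omega
    have hsplit := h.split ι c s (fun i => U i) _ hι hm1 fun i j hi hj => by
      rw [hmem] at hi hj
      have h1 := ha3 i j hi (not_le.1 hj)
      have h2 := supNorm_add_le (s j - s i) (s i - s i₀)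
      rw [sub_add_sub_cancel] at h2
      omega
    have hUmem : U ∈ Finset.univ.filter fun U : ι → Bool => (∃ i, U i) ∧ ∃ i, ¬ U i := by
      refine Finset.mem_filter.2 ⟨Finset.mem_univ _, ⟨i₀, (hmem _).2 ha1⟩, j₀, fun hc => ?_⟩
      have := (hmem j₀).1 hc
      omega
    have hsingle := Finset.single_le_sum (f := fun U : ι → Bool =>
        |∫ ω, ∏ i : {i // U i}, X (c i) (s i) ω ∂P| *
        |∫ ω, ∏ i : {i // ¬ U i}, X (c i) (s i) ω ∂P|) (fun _ _ => by positivity) hUmem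
    rw [← abs_mul] at hsingle
    have := abs_sub_abs_le_abs_sub (∫ ω, ∏ i, X (c i) (s i) ω ∂P)
      ((∫ ω, ∏ i : {i // U i}, X (c i) (s i) ω ∂P) *
        ∫ ω, ∏ i : {i // ¬ U i}, X (c i) (s i) ω ∂P)
    linarith

/-- The sum of the mixed moments of order `n` over all `n`-tuples of sites in a set of size `N` is
of order `N ^ ⌊n / 2⌋`. -/
theorem IsWeaklyDependent.exists_sum_le (h : IsWeaklyDependent P X Q f) (n : ℕ) (hn1 : 1 ≤ n)
    (hn : n ≤ Q) :
    ∃ C, 0 ≤ C ∧ ∀ (ι : Type) [Fintype ι] [DecidableEq ι], Fintype.card ι = n → ∀ (c : ι → κ)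
      (S : Finset (Fin d → ℤ)), S.Nonempty →
      ∑ s ∈ Fintype.piFinset fun _ : ι => S, |∫ ω, ∏ i, X (c i) (s i) ω ∂P| ≤
        C * (S.card : ℝ) ^ (n / 2) := by
  induction n using Nat.strong_induction_on with
  | _ n ih =>
  rcases Nat.lt_or_ge n 2 with hn2 | hn2
  · obtain rfl : n = 1 := by omega
    refine ⟨0, le_rfl, fun ι _ _ hι c S _ => ?_⟩
    obtain ⟨i₀, hi₀⟩ := Fintype.card_eq_one_iff.1 hι
    have : Unique ι := ⟨⟨i₀⟩, hi₀⟩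
    simp [h.mean_zero]
  · obtain ⟨T, hT0, hT⟩ := exists_sum_piFinset_radial_le hn2 h.nonneg (h.summable_of_le hn)
    have ih' : ∀ k : ℕ, ∃ C, 0 ≤ C ∧ (1 ≤ k → k < n → ∀ (ι : Type) [Fintype ι] [DecidableEq ι],
        Fintype.card ι = k → ∀ (c : ι → κ) (S : Finset (Fin d → ℤ)), S.Nonempty →
        ∑ s ∈ Fintype.piFinset fun _ : ι => S, |∫ ω, ∏ i, X (c i) (s i) ω ∂P| ≤
          C * (S.card : ℝ) ^ (k / 2)) := fun k => by
      by_cases hk : 1 ≤ k ∧ k < n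
      · obtain ⟨C, hC0, hC⟩ := ih k hk.2 hk.1 (hk.2.le.trans hn)
        exact ⟨C, hC0, fun _ _ => hC⟩
      · exact ⟨0, le_rfl, fun h1 h2 => absurd ⟨h1, h2⟩ hk⟩
    choose C hC0 hC using ih'
    set B := ∑ k ∈ Finset.range n, C k with hB
    have hB0 : 0 ≤ B := Finset.sum_nonneg fun k _ => hC0 k
    have hCB : ∀ k, k < n → C k ≤ B := fun k hk =>
      Finset.single_le_sum (fun k _ => hC0 k) (Finset.mem_range.2 hk)
    -- `T` comes from the gap errors, of total size `O(N)`, which `2 ≤ n` allows. At most `2 ^ n`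
    -- splittings remain, each bounded by induction with `B ^ 2`.
    refine ⟨T + 2 ^ n * B ^ 2, by positivity, fun ι _ _ hι c S hS => ?_⟩
    obtain ⟨i₀⟩ : Nonempty ι := Fintype.card_pos_iff.1 (by omega)
    have hN1 : (1 : ℝ) ≤ S.card := by exact_mod_cast hS.card_pos
    have hU : ∀ U ∈ Finset.univ.filter fun U : ι → Bool => (∃ i, U i) ∧ ∃ i, ¬ U i,
        ∑ s ∈ Fintype.piFinset fun _ : ι => S,
          |∫ ω, ∏ i : {i // U i}, X (c i) (s i) ω ∂P| *
          |∫ ω, ∏ i : {i // ¬ U i}, X (c i) (s i) ω ∂P| ≤ B ^ 2 * (S.card : ℝ) ^ (n / 2) := by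
      intro U hU
      obtain ⟨-, hU1, hU2⟩ := Finset.mem_filter.1 hU
      rw [sum_piFinset_mul_subtype (fun i => U i) S
        (fun s => |∫ ω, ∏ i : {i // U i}, X (c i) (s i) ω ∂P|)
        (fun s => |∫ ω, ∏ i : {i // ¬ U i}, X (c i) (s i) ω ∂P|)]
      obtain ⟨k, hk1⟩ : ∃ k, Fintype.card {i // U i} = k := ⟨_, rfl⟩
      have hk2 : Fintype.card {i // ¬ U i} = n - k := by
        rw [Fintype.card_subtype_compl, hk1, hι]
      have hpos : 1 ≤ k := by
        obtain ⟨i, hi⟩ := hU1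
        rw [← hk1]
        exact Fintype.card_pos_iff.2 ⟨⟨i, hi⟩⟩
      have hlt : k < n := by
        obtain ⟨i, hi⟩ := hU2
        rw [← hk1, ← hι]
        exact Fintype.card_subtype_lt hi
      have e1 := hC _ hpos hlt {i // U i} hk1 (fun i => c i) S hS
      have e2 := hC (n - k) (by omega) (by omega) {i // ¬ U i} hk2 (fun i => c i) S hS
      calc _ ≤ (C k * (S.card : ℝ) ^ (k / 2)) *
            (C (n - k) * (S.card : ℝ) ^ ((n - k) / 2)) :=
            mul_le_mul e1 e2 (Finset.sum_nonneg fun _ _ => abs_nonneg _)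
              (mul_nonneg (hC0 _) (by positivity))
        _ = (C k * C (n - k)) * (S.card : ℝ) ^ (k / 2 + (n - k) / 2) := by
            rw [pow_add]; ring
        -- The induction closes because `⌊k / 2⌋ + ⌊(n - k) / 2⌋ ≤ ⌊n / 2⌋`.
        _ ≤ (B * B) * (S.card : ℝ) ^ (n / 2) := by
            refine mul_le_mul (mul_le_mul (hCB _ hlt) (hCB _ (by omega)) (hC0 _) hB0)
              (pow_le_pow_right₀ hN1 (by omega)) (by positivity) (by positivity)
        _ = _ := by ring
    calc _ ≤ ∑ s ∈ Fintype.piFinset fun _ : ι => S,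
          (f (ceilDivNat (supNorm fun x : {i // i ≠ i₀} × Fin d => s x.1 x.2 - s i₀ x.2)
            (Fintype.card ι)) +
          ∑ U ∈ Finset.univ.filter fun U : ι → Bool => (∃ i, U i) ∧ ∃ i, ¬ U i,
            |∫ ω, ∏ i : {i // U i}, X (c i) (s i) ω ∂P| *
            |∫ ω, ∏ i : {i // ¬ U i}, X (c i) (s i) ω ∂P|) :=
          Finset.sum_le_sum fun s _ => h.abs_integral_prod_le (by omega) i₀ c s
      _ ≤ T * S.card + ∑ _U ∈ Finset.univ.filter fun U : ι → Bool => (∃ i, U i) ∧ ∃ i, ¬ U i,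
            B ^ 2 * (S.card : ℝ) ^ (n / 2) := by
          rw [Finset.sum_add_distrib, Finset.sum_comm]
          refine add_le_add ?_ (Finset.sum_le_sum hU)
          rw [hι]
          exact hT ι hι i₀ S
      _ ≤ T * (S.card : ℝ) ^ (n / 2) + 2 ^ n * (B ^ 2 * (S.card : ℝ) ^ (n / 2)) := by
          refine add_le_add (mul_le_mul_of_nonneg_left ?_ hT0) ?_
          · exact le_self_pow₀ hN1 (by omega)
          · rw [Finset.sum_const, nsmul_eq_mul]
            refine mul_le_mul_of_nonneg_right ?_ (by positivity)
            have : (Finset.univ.filter fun U : ι → Bool => (∃ i, U i) ∧ ∃ i, ¬ U i).card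
                ≤ 2 ^ n := by
              refine (Finset.card_filter_le _ _).trans ?_
              simp [hι]
            exact_mod_cast this
      _ = _ := by ring

end MomentSums

/-! ### Moments of sample means of a stationary mixing field -/

section Field

variable {d p : ℕ} {Ω : Type*} [MeasurableSpace Ω]

lemma IsStationary.identDistrib_pair {P : Measure Ω}
    {Z : (Fin d → ℤ) → Ω → EuclideanSpace ℝ (Fin p)} (hstat : IsStationary P Z)
    (hZ : ∀ k, Measurable (Z k)) (j k : Fin d → ℤ) :
    IdentDistrib (fun ω => (Z j ω, Z k ω)) (fun ω => (Z 0 ω, Z (k - j) ω)) P P where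
  aemeasurable_fst := ((hZ j).prodMk (hZ k)).aemeasurable
  aemeasurable_snd := ((hZ 0).prodMk (hZ (k - j))).aemeasurable
  map_eq := by
    have hπ : Measurable fun z : (Fin d → ℤ) → EuclideanSpace ℝ (Fin p) => (z 0, z (k - j)) :=
      (measurable_pi_apply _).prodMk (measurable_pi_apply _)
    have := congrArg (Measure.map fun z : (Fin d → ℤ) → EuclideanSpace ℝ (Fin p) =>
      (z 0, z (k - j))) (hstat j)
    rw [Measure.map_map hπ (measurable_pi_lambda _ fun i => hZ (i + j)),
      Measure.map_map hπ (measurable_pi_lambda _ fun i => hZ i)] at this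
    simpa [Function.comp_def] using this

lemma IsStationary.identDistrib {P : Measure Ω}
    {Z : (Fin d → ℤ) → Ω → EuclideanSpace ℝ (Fin p)} (hstat : IsStationary P Z)
    (hZ : ∀ k, Measurable (Z k)) (k : Fin d → ℤ) : IdentDistrib (Z k) (Z 0) P P :=
  (hstat.identDistrib_pair hZ k 0).comp measurable_fst

/-- The coordinates of the centred field. -/
noncomputable def centered (P : Measure Ω) (Z : (Fin d → ℤ) → Ω → EuclideanSpace ℝ (Fin p)) (c : Fin p)
    (k : Fin d → ℤ) (ω : Ω) : ℝ := Z k ω c - fieldMean P Z c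

lemma measurable_coord (c : Fin p) : Measurable fun x : EuclideanSpace ℝ (Fin p) => x c :=
  (EuclideanSpace.proj (𝕜 := ℝ) c).continuous.measurable

variable {P : Measure Ω}
  {Z : (Fin d → ℤ) → Ω → EuclideanSpace ℝ (Fin p)}

lemma measurable_centered (hZ : ∀ k, Measurable (Z k)) (c : Fin p) (k : Fin d → ℤ) :
    Measurable (centered P Z c k) :=
  ((measurable_coord c).comp (hZ k)).sub_const _

lemma measurable_centered_sigmaField {T : Set (Fin d → ℤ)} (c : Fin p) {k : Fin d → ℤ}
    (hk : k ∈ T) : Measurable[sigmaField Z T] (centered P Z c k) :=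
  ((measurable_coord c).comp (measurable_sigmaField hk)).sub_const _

lemma memLp_of_integrable_rpow (hZ : ∀ k, Measurable (Z k)) (hstat : IsStationary P Z) {s : ℝ}
    (hs : 0 < s) (hint : Integrable (fun ω => ‖Z 0 ω‖ ^ s) P) (k : Fin d → ℤ) :
    MemLp (Z k) (ENNReal.ofReal s) P := by
  rw [(hstat.identDistrib hZ k).memLp_iff]
  rw [← integrable_norm_rpow_iff (hZ 0).aestronglyMeasurable (by simpa using hs)
    ENNReal.ofReal_ne_top, ENNReal.toReal_ofReal hs.le]
  exact hint

lemma identDistrib_centered (hZ : ∀ k, Measurable (Z k)) (hstat : IsStationary P Z) (c : Fin p)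
    (k : Fin d → ℤ) : IdentDistrib (centered P Z c k) (centered P Z c 0) P P :=
  (hstat.identDistrib hZ k).comp ((measurable_coord c).sub_const _)

lemma integral_centered [IsProbabilityMeasure P] (hZ : ∀ k, Measurable (Z k)) (hstat : IsStationary P Z)
    (hint : Integrable (Z 0) P) (c : Fin p) (k : Fin d → ℤ) : ∫ ω, centered P Z c k ω ∂P = 0 := by
  rw [(identDistrib_centered hZ hstat c k).integral_eq]
  have hc : Integrable (fun ω => Z 0 ω c) P := (EuclideanSpace.proj (𝕜 := ℝ) c).integrable_comp hint
  simp only [centered]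
  rw [integral_sub hc (integrable_const _)]
  have := (EuclideanSpace.proj (𝕜 := ℝ) c).integral_comp_comm hint
  simp only [PiLp.proj_apply] at this
  simp [this, fieldMean]

/-- A stationary field with finite moments of order `2 r + δ` and summable mixing coefficients is
weakly dependent up to order `2 r`. -/
theorem exists_isWeaklyDependent [NeZero d] [IsProbabilityMeasure P]
    (hZ : ∀ k, Measurable (Z k)) (hstat : IsStationary P Z)
    {α₁ g : ℝ → ℝ} (hA3 : AssumptionA3 P Z α₁ g) {r : ℕ} (hr : 1 ≤ r)
    (hM : ConditionM P Z α₁ g r) :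
    (∀ k, MemLp (Z k) ((2 * r : ℕ) : ENNReal) P) ∧
      ∃ f, IsWeaklyDependent P (centered P Z) (2 * r) f := by
  obtain ⟨δ, -, -, hδ, -, -, -, -, hint, hsum, -⟩ := hM
  set s : ℝ := 2 * (r : ℝ) + δ with hs
  have hr1 : (1 : ℝ) ≤ r := by exact_mod_cast hr
  have hs0 : 0 < s := by linarith
  have hLp := memLp_of_integrable_rpow hZ hstat hs0 hint
  have hLp2 : ∀ k, MemLp (Z k) ((2 * r : ℕ) : ENNReal) P := fun k => by
    refine (hLp k).mono_exponent ?_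
    rw [← ENNReal.ofReal_natCast]
    refine ENNReal.ofReal_le_ofReal ?_
    push_cast
    linarith
  refine ⟨hLp2, ?_⟩
  have hZint : Integrable (Z 0) P := (hLp2 0).integrable (by exact_mod_cast (by omega : 1 ≤ 2 * r))
  have hcLp : ∀ c k, MemLp (centered P Z c k) (ENNReal.ofReal s) P := fun c k =>
    ((EuclideanSpace.proj (𝕜 := ℝ) c).comp_memLp' (hLp k)).sub (memLp_const _)
  have hcint : ∀ c k, Integrable (fun ω => |centered P Z c k ω| ^ s) P := fun c k => by
    have := (hcLp c k).integrable_norm_rpow (by simpa using hs0) ENNReal.ofReal_ne_top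
    rwa [ENNReal.toReal_ofReal hs0.le] at this
  set K : ℝ := ∑ c, ∫ ω, |centered P Z c 0 ω| ^ s ∂P with hKdef
  have hK0 : 0 ≤ K := Finset.sum_nonneg fun c _ => integral_nonneg fun ω => by positivity
  have hK : ∀ c k, ∫ ω, |centered P Z c k ω| ^ s ∂P ≤ K := fun c k => by
    have h1 := ((identDistrib_centered hZ hstat c k).comp
      (measurable_id.abs.pow_const s)).integral_eq
    simp only [Function.comp_def, id] at h1
    rw [h1]
    exact Finset.single_le_sum (f := fun c => ∫ ω, |centered P Z c 0 ω| ^ s ∂P)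
      (fun c _ => integral_nonneg fun ω => by positivity) (Finset.mem_univ c)
  set B : ℝ := 1 + (2 * r : ℕ) * K with hB
  have hB1 : 1 ≤ B := by rw [hB]; linarith [mul_nonneg (Nat.cast_nonneg (α := ℝ) (2 * r)) hK0]
  have hgQ : 0 ≤ g ((2 * r : ℕ) : ℝ) := hA3.g_nonneg _ (by exact_mod_cast (by omega : 0 < 2 * r))
  have hα₁ : ∀ m : ℕ, 0 ≤ α₁ ((m : ℝ) + 1) := fun m => hA3.alpha_nonneg _ (by positivity)
  -- `f 0` bounds all mixed moments; for `m > 0` the value is the error of the product inequality.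
  -- At most `2 * r` sites are ever involved, so `g` enters only through the constant `g (2 * r)`.
  set f : ℕ → ℝ := fun m => if m = 0 then B else
    (4 + 3 * B ^ 2) * (α₁ m * g ((2 * r : ℕ) : ℝ)) ^ (δ / s) with hf
  have hα₁' : ∀ m : ℕ, m ≠ 0 → 0 ≤ α₁ m * g ((2 * r : ℕ) : ℝ) := fun m hm =>
    mul_nonneg (hA3.alpha_nonneg _ (by exact_mod_cast Nat.pos_of_ne_zero hm)) hgQ
  have hXm := measurable_centered (P := P) hZ
  have hcard : ∀ (ι : Type) [Fintype ι], Fintype.card ι ≤ 2 * r →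
      (Fintype.card ι : ℝ) + δ ≤ s := fun ι _ hι => by
    have : (Fintype.card ι : ℝ) ≤ ((2 * r : ℕ) : ℝ) := by exact_mod_cast hι
    push_cast at this
    linarith
  have hcB : ∀ (ι : Type) [Fintype ι], Fintype.card ι ≤ 2 * r →
      1 + (Fintype.card ι : ℝ) * K ≤ B := fun ι _ hι => by
    rw [hB]
    gcongr
  refine ⟨f, ⟨fun m => ?_, ?_, fun c k => integral_centered hZ hstat hZint c k,
    fun ι _ c x hι => ?_, fun ι _ c x hι => ?_, fun ι _ c x q _ m hι hm hdist => ?_⟩⟩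
  · simp only [hf]
    split_ifs with h
    · linarith
    · have := hα₁' m h
      positivity
  · have hd1 : 1 ≤ d := Nat.one_le_iff_ne_zero.2 (NeZero.ne d)
    -- The weight in Condition M is the weight of a radial sum in dimension `(2 * r - 1) * d`. That
    -- dimension is at least `1`, so the natural subtraction is not truncated.
    have hexp : (2 * (r : ℝ) - 1) * d - 1 = (((2 * r - 1) * d - 1 : ℕ) : ℝ) := by
      have h1 : 1 ≤ (2 * r - 1) * d := Nat.one_le_iff_ne_zero.2 (by
        simp only [ne_eq, mul_eq_zero, not_or]; omega)
      push_cast [Nat.cast_sub h1, Nat.cast_sub (by omega : 1 ≤ 2 * r)]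
      ring
    refine (hsum.mul_left ((4 + 3 * B ^ 2) * g ((2 * r : ℕ) : ℝ) ^ (δ / s))).congr fun m => ?_
    rw [hexp, Real.rpow_natCast]
    simp only [hf, Nat.add_eq_zero_iff, one_ne_zero, and_false, if_false]
    push_cast
    rw [Real.mul_rpow (hα₁ m) (by exact_mod_cast hgQ)]
    ring
  · exact integrable_prod_of_moment (fun i => hXm (c i) (x i)) (by linarith [hcard ι hι])
      fun i => hcint (c i) (x i)
  · refine (abs_integral_prod_le (fun i => hXm (c i) (x i)) (by linarith [hcard ι hι])
      (fun i => hcint (c i) (x i)) fun i => hK (c i) (x i)).trans ?_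
    simpa [hf] using hcB ι hι
  · classical
    set T₁ : Finset (Fin d → ℤ) := (Finset.univ.filter q).image x with hT₁
    set T₂ : Finset (Fin d → ℤ) := (Finset.univ.filter fun i => ¬ q i).image x with hT₂
    have hcT : ∀ (u : ι → Prop) [DecidablePred u],
        (((Finset.univ.filter u).image x).card : ℝ) ≤ ((2 * r : ℕ) : ℝ) := fun u _ => by
      exact_mod_cast Finset.card_image_le.trans ((Finset.card_filter_le _ _).trans hι)
    have hdis : DisGE (T₁ : Set (Fin d → ℤ)) T₂ m := by
      intro a ha b hb
      simp only [hT₁, hT₂, Finset.coe_image, Finset.coe_filter, Set.mem_image,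
        Set.mem_ofPred_eq, Finset.mem_univ, true_and] at ha hb
      obtain ⟨i, hi, rfl⟩ := ha
      obtain ⟨j, hj, rfl⟩ := hb
      have h1 : (m : ℝ) ≤ supNorm (x j - x i) := by exact_mod_cast hdist i j hi hj
      rw [dist_comm]
      exact h1.trans (supNorm_le_dist _ _)
    have hmix : alphaTilde P Z T₁ T₂ ≤ α₁ m * g ((2 * r : ℕ) : ℝ) :=
      (alphaTilde_le_mixingCoeff P Z (hcT _) (hcT _) hdis).trans
        (hA3.bound _ _ (by exact_mod_cast hm) (by exact_mod_cast (by omega : 0 < 2 * r)))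
    have hm0 : m ≠ 0 := by omega
    refine (abs_integral_prod_sub_mul_le (X := fun i => centered P Z (c i) (x i))
      (sigmaField_le hZ (T₁ : Set (Fin d → ℤ))) (sigmaField_le hZ (T₂ : Set (Fin d → ℤ))) q
      (fun i hi => measurable_centered_sigmaField (c i) ?_)
      (fun i hi => measurable_centered_sigmaField (c i) ?_) hδ (hcard ι hι)
      (fun i => hcint (c i) (x i)) (fun i => hK (c i) (x i)) hK0 (hα₁' m hm0)
      fun S T hS hT => (le_alphaTilde P Z hS hT).trans hmix).trans ?_
    · simp only [hT₁, Finset.coe_image, Finset.coe_filter, Set.mem_image, Set.mem_ofPred_eq,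
        Finset.mem_univ, true_and]
      exact ⟨i, hi, rfl⟩
    · simp only [hT₂, Finset.coe_image, Finset.coe_filter, Set.mem_image, Set.mem_ofPred_eq,
        Finset.mem_univ, true_and]
      exact ⟨i, hi, rfl⟩
    · simp only [hf, if_neg hm0]
      have h1 := hcB ι hι
      have h2 : 0 ≤ 1 + (Fintype.card ι : ℝ) * K := by positivity
      have h3 := hα₁' m hm0
      gcongr

end Field

/-! ### Covariances and moments of sums under weak dependence -/

section WeakDependence

variable {d : ℕ} {κ Ω : Type*} [MeasurableSpace Ω] {P : Measure Ω}
  {X : κ → (Fin d → ℤ) → Ω → ℝ} {Q : ℕ} {f : ℕ → ℝ}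

/-- Splitting two distinct sites leaves single factors of mean zero, so the factorization error is a
bound for the covariance itself. -/
lemma IsWeaklyDependent.abs_integral_mul_le (h : IsWeaklyDependent P X Q f) (hQ : 2 ≤ Q)
    (a b : κ) (j k : Fin d → ℤ) :
    |∫ ω, X a j ω * X b k ω ∂P| ≤ f (supNorm (k - j)) := by
  have e : ∀ ω, X a j ω * X b k ω = ∏ i : Fin 2, X (![a, b] i) (![j, k] i) ω := fun ω => by
    simp [Fin.prod_univ_two]
  simp only [e]
  rcases Nat.eq_zero_or_pos (supNorm (k - j)) with h0 | h0
  · rw [h0]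
    exact h.bound (Fin 2) ![a, b] ![j, k] (by simpa using hQ)
  · have hs := h.split (Fin 2) ![a, b] ![j, k] (fun i => i = 0) _ (by simpa using hQ) h0
      fun u v hu hv => by
        have hv1 : v = 1 := by omega
        subst hu hv1
        simp
    have hz : ∀ inst : Fintype {i : Fin 2 // i = 0},
        ∫ ω, @Finset.prod {i : Fin 2 // i = 0} ℝ _ (@Finset.univ _ inst)
          (fun i => X (![a, b] i) (![j, k] i) ω) ∂P = 0 := fun inst => by
      rw [← h.mean_zero a j]
      refine integral_congr_ae (Eventually.of_forall fun ω => ?_)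
      exact Fintype.prod_subsingleton _ (⟨0, rfl⟩ : {i : Fin 2 // i = 0})
    rwa [hz, zero_mul, sub_zero] at hs

/-- The extra weight `supNorm k` pays for the boundary effect in the variance of a mean. It raises
the power of `m` from `d - 1` to `d`, which `(Q - 1) * d - 1` dominates as soon as `3 ≤ Q`. -/
lemma IsWeaklyDependent.exists_sum_weighted_le [NeZero d] (h : IsWeaklyDependent P X Q f)
    (hQ : 3 ≤ Q) : ∃ C, 0 ≤ C ∧ ∀ W : Finset (Fin d → ℤ),
      ∑ k ∈ W, ((supNorm k : ℝ) + 1) * f (supNorm k) ≤ C := by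
  have hd1 : 1 ≤ d := Nat.one_le_iff_ne_zero.2 (NeZero.ne d)
  obtain ⟨C, hC0, hC⟩ := exists_sum_radial_le (D := d) (q := 1) one_pos
    (f := fun m => ((m : ℝ) + 1) * f m) (fun m => mul_nonneg (by positivity) (h.nonneg m)) (by
      refine (h.summable.mul_left 2).of_nonneg_of_le
        (fun m => mul_nonneg (by positivity) (mul_nonneg (by positivity) (h.nonneg _)))
        fun m => ?_
      have hm : (1 : ℝ) ≤ (m : ℝ) + 1 := by linarith [m.cast_nonneg (α := ℝ)]
      have hle : d ≤ (Q - 1) * d - 1 := by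
        have : 2 * d ≤ (Q - 1) * d := Nat.mul_le_mul_right d (by omega)
        omega
      calc ((m : ℝ) + 1) ^ (d - 1) * ((((m + 1 : ℕ) : ℝ) + 1) * f (m + 1))
          ≤ ((m : ℝ) + 1) ^ (d - 1) * ((2 * ((m : ℝ) + 1)) * f (m + 1)) := by
            have := h.nonneg (m + 1)
            gcongr
            push_cast
            linarith
        _ = 2 * (((m : ℝ) + 1) ^ (d - 1 + 1) * f (m + 1)) := by ring
        _ ≤ 2 * (((m : ℝ) + 1) ^ ((Q - 1) * d - 1) * f (m + 1)) := by
            have := h.nonneg (m + 1)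
            gcongr ?_ * (?_ * _)
            exact pow_le_pow_right₀ hm (by omega))
  refine ⟨C, hC0, fun W => ?_⟩
  have := hC (Fin d) (by simp) W
  simpa [ceilDivNat] using this

/-- Mixed moments of order `n` of sums over `N` sites are of order `N ^ ⌊n / 2⌋`. -/
lemma IsWeaklyDependent.exists_abs_integral_prod_sum_le (h : IsWeaklyDependent P X Q f) {n : ℕ}
    (hn1 : 1 ≤ n) (hn : n ≤ Q) :
    ∃ C, 0 ≤ C ∧ ∀ (c : Fin n → κ) (S : Finset (Fin d → ℤ)), S.Nonempty →
      |∫ ω, ∏ i, ∑ k ∈ S, X (c i) k ω ∂P| ≤ C * (S.card : ℝ) ^ (n / 2) := by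
  obtain ⟨C, hC0, hC⟩ := h.exists_sum_le n hn1 hn
  refine ⟨C, hC0, fun c S hS => ?_⟩
  simp only [Finset.prod_univ_sum]
  rw [integral_finsetSum _ fun s _ => h.integrable (Fin n) c s (by simpa using hn)]
  exact (Finset.abs_sum_le_sum_abs _ _).trans (hC (Fin n) (by simp) c S hS)

end WeakDependence

/-! ### Taylor expansion under polynomial growth of the highest derivatives -/

section Taylor

variable {p : ℕ}

lemma multilinear_diagonal_eq_sum {r : ℕ}
    (f : ContinuousMultilinearMap ℝ (fun _ : Fin r => EuclideanSpace ℝ (Fin p)) ℝ)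
    (y : EuclideanSpace ℝ (Fin p)) :
    f (fun _ => y) = ∑ j : Fin r → Fin p,
      f (fun i => EuclideanSpace.single (j i) (1 : ℝ)) * ∏ i, y (j i) := by
  have hy : y = ∑ c, y c • EuclideanSpace.single c (1 : ℝ) := by
    ext c
    simp [Finset.sum_apply, Pi.single_apply]
  conv_lhs => rw [hy]
  rw [f.map_sum]
  refine Finset.sum_congr rfl fun j _ => ?_
  rw [f.map_smul_univ, smul_eq_mul, mul_comm]

/-- Condition D controls derivatives only on tuples of basis vectors. Expanding `y` in the basis
yields `p ^ r` terms, each with coordinates of size at most `‖y‖`. -/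
lemma abs_multilinear_diagonal_le {r : ℕ}
    (f : ContinuousMultilinearMap ℝ (fun _ : Fin r => EuclideanSpace ℝ (Fin p)) ℝ) {M : ℝ}
    (hM : ∀ j : Fin r → Fin p, |f (fun i => EuclideanSpace.single (j i) (1 : ℝ))| ≤ M)
    (y : EuclideanSpace ℝ (Fin p)) :
    |f (fun _ => y)| ≤ p ^ r * (M * ‖y‖ ^ r) := by
  rw [multilinear_diagonal_eq_sum]
  refine (Finset.abs_sum_le_sum_abs _ _).trans ?_
  calc _ ≤ ∑ _j : Fin r → Fin p, M * ‖y‖ ^ r := by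
        refine Finset.sum_le_sum fun j _ => ?_
        rw [abs_mul, Finset.abs_prod]
        refine mul_le_mul (hM j) ?_ (Finset.prod_nonneg fun _ _ => abs_nonneg _)
          ((abs_nonneg _).trans (hM j))
        calc ∏ i, |y (j i)| ≤ ∏ _i : Fin r, ‖y‖ :=
              Finset.prod_le_prod (fun _ _ => abs_nonneg _) fun i _ =>
                PiLp.norm_apply_le y (j i)
          _ = ‖y‖ ^ r := by simp
    _ = _ := by simp

/-- Polynomial growth around the origin becomes polynomial growth around `μ`, at the cost of a
constant depending on `‖μ‖`. -/
lemma one_add_norm_pow_le {E : Type*} [SeminormedAddCommGroup E] (a : ℕ) {x y z : E}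
    (h : ‖z‖ ≤ ‖x‖ + ‖y‖) : 1 + ‖z‖ ^ a ≤ (1 + 2 ^ (a - 1) * (1 + ‖x‖ ^ a)) * (1 + ‖y‖ ^ a) := by
  have h1 : ‖z‖ ^ a ≤ 2 ^ (a - 1) * (‖x‖ ^ a + ‖y‖ ^ a) :=
    (pow_le_pow_left₀ (norm_nonneg _) h a).trans (add_pow_le (norm_nonneg _) (norm_nonneg _) a)
  have h2 : 0 ≤ ‖x‖ ^ a := by positivity
  have h3 : 0 ≤ ‖y‖ ^ a := by positivity
  have h4 : (0 : ℝ) ≤ 2 ^ (a - 1) := by positivity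
  nlinarith [mul_nonneg h4 (mul_nonneg h2 h3)]

/-- Taylor expansion around `μ` with a polynomial bound on the remainder. -/
lemma ConditionD.exists_taylor_bound {H : EuclideanSpace ℝ (Fin p) → ℝ} {n a : ℕ}
    (hD : ConditionD H (n + 1) a) (μ : EuclideanSpace ℝ (Fin p)) :
    ∃ C, 0 ≤ C ∧ ∀ y, |H (μ + y) - ∑ k ∈ Finset.range (n + 1),
      (k.factorial : ℝ)⁻¹ * iteratedFDeriv ℝ k H μ (fun _ => y)| ≤
      C * (‖y‖ ^ (n + 1) * (1 + ‖y‖ ^ a)) := by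
  obtain ⟨hH, C, hC, hb⟩ := hD
  refine ⟨p ^ (n + 1) * (C * (1 + 2 ^ (a - 1) * (1 + ‖μ‖ ^ a))), by positivity, fun y => ?_⟩
  have key := map_add_eq_sum_add_integral_iteratedFDeriv (f := H) (x := μ) (y := y) (n := n)
    fun t _ => by exact_mod_cast hH.contDiffAt
  simp only [smul_eq_mul] at key
  rw [key, add_sub_cancel_left, abs_mul]
  have hfac : |((n.factorial : ℝ))⁻¹| ≤ 1 := by
    rw [abs_of_nonneg (by positivity)]
    exact inv_le_one_of_one_le₀ (by exact_mod_cast Nat.one_le_iff_ne_zero.2 n.factorial_ne_zero)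
  have hint : |∫ t in (0 : ℝ)..1, (1 - t) ^ n *
      iteratedFDeriv ℝ (n + 1) H (μ + t • y) (fun _ => y)| ≤
      p ^ (n + 1) * (C * (1 + 2 ^ (a - 1) * (1 + ‖μ‖ ^ a))) * (‖y‖ ^ (n + 1) * (1 + ‖y‖ ^ a)) := by
    have := intervalIntegral.norm_integral_le_of_norm_le_const (a := (0 : ℝ)) (b := 1)
      (f := fun t => (1 - t) ^ n * iteratedFDeriv ℝ (n + 1) H (μ + t • y) (fun _ => y))
      (C := p ^ (n + 1) * (C * (1 + 2 ^ (a - 1) * (1 + ‖μ‖ ^ a))) *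
        (‖y‖ ^ (n + 1) * (1 + ‖y‖ ^ a))) fun t ht => by
      rw [Set.uIoc_of_le zero_le_one] at ht
      rw [norm_mul, Real.norm_eq_abs, Real.norm_eq_abs]
      have h1 : |(1 - t) ^ n| ≤ 1 := by
        rw [abs_pow]
        exact pow_le_one₀ (abs_nonneg _) (by rw [abs_le]; constructor <;> linarith [ht.1, ht.2])
      have h2 := abs_multilinear_diagonal_le _ (hb (μ + t • y)) y
      have h3 : ‖μ + t • y‖ ≤ ‖μ‖ + ‖y‖ := by
        refine (norm_add_le _ _).trans (add_le_add_right ?_ _)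
        rw [norm_smul, Real.norm_eq_abs, abs_of_pos ht.1]
        exact mul_le_of_le_one_left (norm_nonneg _) ht.2
      have h4 := one_add_norm_pow_le a h3
      calc |(1 - t) ^ n| * |iteratedFDeriv ℝ (n + 1) H (μ + t • y) (fun _ => y)|
          ≤ 1 * (p ^ (n + 1) * (C * (1 + ‖μ + t • y‖ ^ a) * ‖y‖ ^ (n + 1))) := by
            gcongr
        _ ≤ 1 * (p ^ (n + 1) * (C * ((1 + 2 ^ (a - 1) * (1 + ‖μ‖ ^ a)) * (1 + ‖y‖ ^ a)) *
              ‖y‖ ^ (n + 1))) := by gcongr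
        _ = _ := by ring
    simpa using this
  calc _ ≤ 1 * _ := mul_le_mul hfac hint (abs_nonneg _) zero_le_one
    _ = _ := one_mul _

lemma ConditionD.exists_linear_remainder_le {H : EuclideanSpace ℝ (Fin p) → ℝ} {a : ℕ}
    (hD : ConditionD H 2 a) (μ : EuclideanSpace ℝ (Fin p)) :
    ∃ C, 0 ≤ C ∧ ∀ y, |H (μ + y) - H μ - inner ℝ (gradient H μ) y| ≤
      C * (‖y‖ ^ 2 * (1 + ‖y‖ ^ a)) := by
  obtain ⟨C, hC0, hC⟩ := hD.exists_taylor_bound (n := 1) μ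
  refine ⟨C, hC0, fun y => ?_⟩
  have := hC y
  rw [Finset.sum_range_succ, Finset.sum_range_one] at this
  simpa [iteratedFDeriv_zero_apply, iteratedFDeriv_one_apply, inner_gradient_left, sub_sub]
    using this

/-- The quadratic term is kept as a polynomial in the coordinates, so that its product with the
linear term becomes a combination of third mixed moments. -/
lemma ConditionD.exists_quadratic_remainder_le {H : EuclideanSpace ℝ (Fin p) → ℝ} {a : ℕ}
    (hD : ConditionD H 3 a) (μ : EuclideanSpace ℝ (Fin p)) :
    ∃ (q : (Fin 2 → Fin p) → ℝ) (C : ℝ), 0 ≤ C ∧ ∀ y, |H (μ + y) - H μ - inner ℝ (gradient H μ) y -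
      ∑ j, q j * ∏ i, y (j i)| ≤ C * (‖y‖ ^ 3 * (1 + ‖y‖ ^ a)) := by
  obtain ⟨C, hC0, hC⟩ := hD.exists_taylor_bound (n := 2) μ
  refine ⟨fun j => (2 : ℝ)⁻¹ * iteratedFDeriv ℝ 2 H μ
    (fun i => EuclideanSpace.single (j i) (1 : ℝ)), C, hC0, fun y => ?_⟩
  have := hC y
  rw [Finset.sum_range_succ, Finset.sum_range_succ, Finset.sum_range_one,
    multilinear_diagonal_eq_sum (iteratedFDeriv ℝ 2 H μ), Finset.mul_sum] at this
  simp only [← mul_assoc] at this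
  simpa [iteratedFDeriv_zero_apply, iteratedFDeriv_one_apply, inner_gradient_left, sub_sub,
    mul_assoc] using this

end Taylor

/-! ### Moments of the sample mean -/

section Means

variable {d p : ℕ} {Ω : Type*} [MeasurableSpace Ω]

/-- The sample mean over a finite set of sites. -/
noncomputable def siteMean {E : Type*} [AddCommGroup E] [Module ℝ E] (Y : (Fin d → ℤ) → Ω → E)
    (S : Finset (Fin d → ℤ)) (ω : Ω) : E := (S.card : ℝ)⁻¹ • ∑ k ∈ S, Y k ω

variable {P : Measure Ω} {Z : (Fin d → ℤ) → Ω → EuclideanSpace ℝ (Fin p)} {r : ℕ} {f : ℕ → ℝ}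

lemma siteMean_sub_apply {S : Finset (Fin d → ℤ)} (hS : S.Nonempty) (ω : Ω) (c : Fin p) :
    (siteMean Z S ω - fieldMean P Z) c = (S.card : ℝ)⁻¹ * ∑ k ∈ S, centered P Z c k ω := by
  have h0 : (S.card : ℝ) ≠ 0 := by exact_mod_cast hS.card_pos.ne'
  simp only [siteMean, centered, PiLp.sub_apply, PiLp.smul_apply, smul_eq_mul,
    Finset.sum_sub_distrib, Finset.sum_const, nsmul_eq_mul]
  rw [mul_sub, inv_mul_cancel_left₀ h0]
  congr 2
  exact map_sum (EuclideanSpace.proj (𝕜 := ℝ) c) (fun k => Z k ω) S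

lemma memLp_siteMean_sub [IsProbabilityMeasure P] {u : ENNReal} (hLp : ∀ k, MemLp (Z k) u P)
    (S : Finset (Fin d → ℤ)) : MemLp (fun ω => siteMean Z S ω - fieldMean P Z) u P := by
  have h1 : MemLp (fun ω => ∑ k ∈ S, Z k ω) u P := memLp_finsetSum S fun k _ => hLp k
  have h2 : MemLp (fun ω => siteMean Z S ω) u P := h1.const_smul (S.card : ℝ)⁻¹
  exact h2.sub (memLp_const (fieldMean P Z))

lemma norm_pow_le_sum_pow (ρ : ℕ) (v : EuclideanSpace ℝ (Fin p)) :
    ‖v‖ ^ (2 * (ρ + 1)) ≤ p ^ ρ * ∑ c, (v c) ^ (2 * (ρ + 1)) := by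
  have := pow_sum_le_card_mul_sum_pow (s := Finset.univ) (f := fun c => (v c) ^ 2)
    (fun c _ => sq_nonneg _) ρ
  rw [← EuclideanSpace.real_norm_sq_eq] at this
  simpa [← pow_mul] using this

/-- The moment of order `2 ρ ≤ 2 r` of the centred mean over `N` sites is of order `N ^ (-ρ)`. -/
lemma IsWeaklyDependent.exists_integral_norm_pow_le [IsProbabilityMeasure P]
    (h : IsWeaklyDependent P (centered P Z) (2 * r) f)
    (hLp : ∀ k, MemLp (Z k) ((2 * r : ℕ) : ENNReal) P) {ρ : ℕ} (hρ1 : 1 ≤ ρ) (hρ : ρ ≤ r) :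
    ∃ C, 0 ≤ C ∧ ∀ S : Finset (Fin d → ℤ), S.Nonempty →
      Integrable (fun ω => ‖siteMean Z S ω - fieldMean P Z‖ ^ (2 * ρ)) P ∧
      ∫ ω, ‖siteMean Z S ω - fieldMean P Z‖ ^ (2 * ρ) ∂P ≤ C * ((S.card : ℝ)⁻¹) ^ ρ := by
  obtain ⟨C, hC0, hC⟩ := h.exists_abs_integral_prod_sum_le (n := 2 * ρ) (by omega) (by omega)
  obtain ⟨ρ, rfl⟩ : ∃ k, ρ = k + 1 := ⟨ρ - 1, by omega⟩
  refine ⟨p ^ ρ * (p * C), by positivity, fun S hS => ?_⟩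
  have hD := memLp_siteMean_sub (P := P) hLp S
  have hDi : Integrable (fun ω => ‖siteMean Z S ω - fieldMean P Z‖ ^ (2 * (ρ + 1))) P := by
    refine MemLp.integrable_norm_pow (hD.mono_exponent ?_) (by omega)
    exact_mod_cast (by omega : 2 * (ρ + 1) ≤ 2 * r)
  refine ⟨hDi, ?_⟩
  have hN : (0 : ℝ) < S.card := by exact_mod_cast hS.card_pos
  have hci : ∀ c, Integrable (fun ω => ((siteMean Z S ω - fieldMean P Z) c) ^ (2 * (ρ + 1))) P := by
    intro c
    refine hDi.mono' (((measurable_coord c).comp_aemeasurable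
      hD.aestronglyMeasurable.aemeasurable).pow_const _).aestronglyMeasurable
      (Eventually.of_forall fun ω => ?_)
    rw [norm_pow]
    exact pow_le_pow_left₀ (norm_nonneg _) (PiLp.norm_apply_le _ c) _
  calc ∫ ω, ‖siteMean Z S ω - fieldMean P Z‖ ^ (2 * (ρ + 1)) ∂P
      ≤ ∫ ω, p ^ ρ * ∑ c, ((siteMean Z S ω - fieldMean P Z) c) ^ (2 * (ρ + 1)) ∂P :=
        integral_mono hDi ((integrable_finsetSum _ fun c _ => hci c).const_mul _)
          fun ω => norm_pow_le_sum_pow ρ _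
    _ = p ^ ρ * ∑ c, ∫ ω, ((siteMean Z S ω - fieldMean P Z) c) ^ (2 * (ρ + 1)) ∂P := by
        rw [integral_const_mul, integral_finsetSum _ fun c _ => hci c]
    _ ≤ p ^ ρ * ∑ _c : Fin p, C * ((S.card : ℝ)⁻¹) ^ (ρ + 1) := by
        gcongr with c
        have e : ∀ ω, ((siteMean Z S ω - fieldMean P Z) c) ^ (2 * (ρ + 1)) =
            ((S.card : ℝ)⁻¹) ^ (2 * (ρ + 1)) *
              ∏ _i : Fin (2 * (ρ + 1)), ∑ k ∈ S, centered P Z c k ω := fun ω => by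
          rw [siteMean_sub_apply hS, mul_pow]; simp
        simp only [e]
        rw [integral_const_mul]
        have h1 := (le_abs_self _).trans (hC (fun _ => c) S hS)
        rw [Nat.mul_div_cancel_left _ two_pos] at h1
        calc _ ≤ ((S.card : ℝ)⁻¹) ^ (2 * (ρ + 1)) * (C * (S.card : ℝ) ^ (ρ + 1)) := by gcongr
          _ = C * ((S.card : ℝ)⁻¹) ^ (ρ + 1) * ((S.card : ℝ)⁻¹ * S.card) ^ (ρ + 1) := by
              rw [mul_pow]; ring
          _ = _ := by rw [inv_mul_cancel₀ hN.ne', one_pow, mul_one]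
    _ = _ := by simp; ring

end Means

/-! ### Asymptotic linearity of smooth functions of sample means -/

/-- A statistic `θ` of finite sets of sites that equals a constant plus the sample mean of a
centred second-order stationary field `Y` up to a remainder of order `N⁻¹` in `L²`, with
covariances of `Y` having a finite first absolute moment. -/
structure IsAsymptoticallyLinear {d : ℕ} {Ω : Type*} [MeasurableSpace Ω] (P : Measure Ω)
    (θ : Finset (Fin d → ℤ) → Ω → ℝ) (h₀ : ℝ) (Y : (Fin d → ℤ) → Ω → ℝ) (σ : (Fin d → ℤ) → ℝ)
    (B C γ : ℝ) : Prop where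
  memLp : ∀ k, MemLp (Y k) 2 P
  mean_zero : ∀ k, ∫ ω, Y k ω ∂P = 0
  cov : ∀ j k, ∫ ω, Y j ω * Y k ω ∂P = σ (k - j)
  sum_le : ∀ W : Finset (Fin d → ℤ), ∑ k ∈ W, ((supNorm k : ℝ) + 1) * |σ k| ≤ B
  const_nonneg : 0 ≤ C
  rem_memLp : ∀ S : Finset (Fin d → ℤ), S.Nonempty →
    MemLp (fun ω => θ S ω - h₀ - siteMean Y S ω) 2 P
  rem_sq_le : ∀ S : Finset (Fin d → ℤ), S.Nonempty →
    ∫ ω, (θ S ω - h₀ - siteMean Y S ω) ^ 2 ∂P ≤ C * ((S.card : ℝ)⁻¹) ^ 2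
  rem_mul_le : ∀ S : Finset (Fin d → ℤ), S.Nonempty →
    |∫ ω, siteMean Y S ω * (θ S ω - h₀ - siteMean Y S ω) ∂P| ≤
      C * ((S.card : ℝ)⁻¹ * (S.card : ℝ) ^ (-γ))

/-- Cauchy-Schwarz without square roots. The weight `t` is later chosen to match the two second
moments: `N ^ (-1/2)` or `N⁻¹` for a remainder against a linear part, `V` for block averages. -/
lemma abs_integral_mul_le_of_sq {Ω : Type*} [MeasurableSpace Ω] {P : Measure Ω} {u v : Ω → ℝ}
    (hu : MemLp u 2 P) (hv : MemLp v 2 P) {t : ℝ} (ht : 0 < t) :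
    |∫ ω, u ω * v ω ∂P| ≤ t * (∫ ω, u ω ^ 2 ∂P) + t⁻¹ * ∫ ω, v ω ^ 2 ∂P := by
  rw [← integral_const_mul, ← integral_const_mul,
    ← integral_add (hu.integrable_sq.const_mul t) (hv.integrable_sq.const_mul _)]
  refine abs_integral_le_integral_abs.trans (integral_mono (hu.integrable_mul hv).abs
    ((hu.integrable_sq.const_mul t).add (hv.integrable_sq.const_mul _)) fun ω => ?_)
  simp only [abs_mul]
  have h1 : 0 ≤ (t * |u ω| - |v ω|) ^ 2 := sq_nonneg _
  have h2 : 0 ≤ |u ω| * |v ω| := by positivity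
  rw [← sq_abs (u ω), ← sq_abs (v ω)]
  have e : t * |u ω| ^ 2 + t⁻¹ * |v ω| ^ 2 = t⁻¹ * ((t * |u ω|) ^ 2 + |v ω| ^ 2) := by
    field_simp
  rw [e, ← div_eq_inv_mul, le_div_iff₀ ht]
  nlinarith [mul_nonneg h2 ht.le]

section Linearization

variable {d p : ℕ} {Ω : Type*} [MeasurableSpace Ω] {P : Measure Ω} [IsProbabilityMeasure P]
  {Z : (Fin d → ℤ) → Ω → EuclideanSpace ℝ (Fin p)} {r : ℕ} {f : ℕ → ℝ}

/-- A remainder dominated by a polynomial of the centred sample mean that vanishes to order `m`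
has a second moment of order `N ^ (-m)`. -/
lemma IsWeaklyDependent.exists_integral_sq_le
    (h : IsWeaklyDependent P (centered P Z) (2 * r) f)
    (hLp : ∀ k, MemLp (Z k) ((2 * r : ℕ) : ENNReal) P) {m b : ℕ} (hm : 1 ≤ m) (hmb : m + b ≤ r)
    {R : EuclideanSpace ℝ (Fin p) → ℝ} (hR : Measurable R) {C₀ : ℝ}
    (hC₀ : ∀ y, |R y| ≤ C₀ * (‖y‖ ^ m * (1 + ‖y‖ ^ b))) :
    ∃ C, 0 ≤ C ∧ ∀ S : Finset (Fin d → ℤ), S.Nonempty →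
      MemLp (fun ω => R (siteMean Z S ω - fieldMean P Z)) 2 P ∧
      ∫ ω, R (siteMean Z S ω - fieldMean P Z) ^ 2 ∂P ≤ C * ((S.card : ℝ)⁻¹) ^ m := by
  obtain ⟨C₁, hC₁0, hC₁⟩ := h.exists_integral_norm_pow_le hLp hm (by omega : m ≤ r)
  obtain ⟨C₂, hC₂0, hC₂⟩ := h.exists_integral_norm_pow_le hLp (by omega : 1 ≤ m + b) hmb
  have hsq : ∀ y, R y ^ 2 ≤ 2 * C₀ ^ 2 * (‖y‖ ^ (2 * m) + ‖y‖ ^ (2 * (m + b))) := fun y => by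
    have h1 : R y ^ 2 ≤ (C₀ * (‖y‖ ^ m * (1 + ‖y‖ ^ b))) ^ 2 := by
      rw [← sq_abs]
      exact pow_le_pow_left₀ (abs_nonneg _) (hC₀ y) 2
    refine h1.trans ?_
    have e1 : ‖y‖ ^ (2 * m) = (‖y‖ ^ m) ^ 2 := by ring
    have e2 : ‖y‖ ^ (2 * (m + b)) = (‖y‖ ^ m) ^ 2 * (‖y‖ ^ b) ^ 2 := by ring
    rw [e1, e2]
    nlinarith [mul_nonneg (sq_nonneg (C₀ * ‖y‖ ^ m)) (sq_nonneg (1 - ‖y‖ ^ b))]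
  refine ⟨2 * C₀ ^ 2 * (C₁ + C₂), by positivity, fun S hS => ?_⟩
  obtain ⟨i1, b1⟩ := hC₁ S hS
  obtain ⟨i2, b2⟩ := hC₂ S hS
  have hD := memLp_siteMean_sub (P := P) hLp S
  have hRm : AEStronglyMeasurable (fun ω => R (siteMean Z S ω - fieldMean P Z)) P :=
    (hR.comp_aemeasurable hD.aestronglyMeasurable.aemeasurable).aestronglyMeasurable
  have hdom : Integrable (fun ω => 2 * C₀ ^ 2 * (‖siteMean Z S ω - fieldMean P Z‖ ^ (2 * m) +
      ‖siteMean Z S ω - fieldMean P Z‖ ^ (2 * (m + b)))) P := (i1.add i2).const_mul _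
  have hRi : Integrable (fun ω => R (siteMean Z S ω - fieldMean P Z) ^ 2) P := by
    refine hdom.mono' (hRm.pow 2) (Eventually.of_forall fun ω => ?_)
    rw [Real.norm_eq_abs, abs_of_nonneg (sq_nonneg _)]
    exact hsq _
  refine ⟨(memLp_two_iff_integrable_sq hRm).2 hRi, ?_⟩
  have hN1 : (S.card : ℝ)⁻¹ ≤ 1 := inv_le_one_of_one_le₀ (by exact_mod_cast hS.card_pos)
  have hN0 : 0 ≤ (S.card : ℝ)⁻¹ := by positivity
  calc _ ≤ ∫ ω, 2 * C₀ ^ 2 * (‖siteMean Z S ω - fieldMean P Z‖ ^ (2 * m) +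
        ‖siteMean Z S ω - fieldMean P Z‖ ^ (2 * (m + b))) ∂P :=
        integral_mono hRi hdom fun ω => hsq _
    _ = 2 * C₀ ^ 2 * ((∫ ω, ‖siteMean Z S ω - fieldMean P Z‖ ^ (2 * m) ∂P) +
        ∫ ω, ‖siteMean Z S ω - fieldMean P Z‖ ^ (2 * (m + b)) ∂P) := by
        rw [integral_const_mul, integral_add i1 i2]
    _ ≤ 2 * C₀ ^ 2 * (C₁ * ((S.card : ℝ)⁻¹) ^ m + C₂ * ((S.card : ℝ)⁻¹) ^ m) := by
        have h3 : ((S.card : ℝ)⁻¹) ^ (m + b) ≤ ((S.card : ℝ)⁻¹) ^ m :=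
          pow_le_pow_of_le_one hN0 hN1 (by omega)
        gcongr
        exact b2.trans (by gcongr)
    _ = _ := by ring

lemma inner_eq_sum_coord (v y : EuclideanSpace ℝ (Fin p)) : inner ℝ v y = ∑ c, v c * y c := by
  simp [PiLp.inner_apply, mul_comm]

lemma siteMean_inner (v μ : EuclideanSpace ℝ (Fin p)) {S : Finset (Fin d → ℤ)} (hS : S.Nonempty)
    (ω : Ω) : siteMean (fun k ω => inner ℝ v (Z k ω - μ)) S ω = inner ℝ v (siteMean Z S ω - μ) := by
  have h0 : (S.card : ℝ) ≠ 0 := by exact_mod_cast hS.card_pos.ne'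
  simp only [siteMean, inner_sub_right, Finset.sum_sub_distrib, Finset.sum_const, inner_smul_right,
    inner_sum, smul_eq_mul, nsmul_eq_mul, mul_sub]
  rw [inv_mul_cancel_left₀ h0]

/-- The integrand is cubic in the centred mean. Third mixed moments of sums over `N` sites are
`O(N)`, as `⌊3 / 2⌋ = 1`, and the normalization `N ^ (-3)` leaves `N ^ (-2)`; Cauchy-Schwarz alone
would only give `N ^ (-3/2)`. -/
lemma IsWeaklyDependent.exists_integral_inner_mul_quadratic_le
    (h : IsWeaklyDependent P (centered P Z) (2 * r) f) (hr : 2 ≤ r) (v : EuclideanSpace ℝ (Fin p))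
    (q : (Fin 2 → Fin p) → ℝ) :
    ∃ C, 0 ≤ C ∧ ∀ S : Finset (Fin d → ℤ), S.Nonempty →
      |∫ ω, inner ℝ v (siteMean Z S ω - fieldMean P Z) *
        ∑ j, q j * ∏ i, (siteMean Z S ω - fieldMean P Z) (j i) ∂P| ≤ C * ((S.card : ℝ)⁻¹) ^ 2 := by
  obtain ⟨C, hC0, hC⟩ := h.exists_abs_integral_prod_sum_le (n := 3) (by omega) (by omega)
  refine ⟨∑ c, ∑ j, |v c * q j| * C, by positivity, fun S hS => ?_⟩
  have hN : (0 : ℝ) < S.card := by exact_mod_cast hS.card_pos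
  have e : ∀ ω, inner ℝ v (siteMean Z S ω - fieldMean P Z) *
      ∑ j, q j * ∏ i, (siteMean Z S ω - fieldMean P Z) (j i) = ∑ c, ∑ j,
        (v c * q j * ((S.card : ℝ)⁻¹) ^ 3) * ∏ i : Fin 3, ∑ k ∈ S,
          centered P Z ((Fin.cons c j : Fin 3 → Fin p) i) k ω := fun ω => by
    rw [inner_eq_sum_coord, Finset.sum_mul_sum]
    refine Finset.sum_congr rfl fun c _ => Finset.sum_congr rfl fun j _ => ?_
    rw [Fin.prod_univ_succ (n := 2)]
    simp only [siteMean_sub_apply hS, Fin.cons_zero, Fin.cons_succ, Fin.prod_univ_two]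
    ring
  have hi : ∀ c : Fin 3 → Fin p,
      Integrable (fun ω => ∏ i : Fin 3, ∑ k ∈ S, centered P Z (c i) k ω) P := fun c => by
    simp only [Finset.prod_univ_sum]
    exact integrable_finsetSum _ fun s _ => h.integrable (Fin 3) c s (by simp; omega)
  simp only [e]
  rw [integral_finsetSum _ fun c _ => integrable_finsetSum _ fun j _ => (hi _).const_mul _]
  simp only [integral_finsetSum _ fun j (_ : j ∈ Finset.univ) => (hi _).const_mul _,
    integral_const_mul]
  refine (Finset.abs_sum_le_sum_abs _ _).trans ?_
  rw [Finset.sum_mul]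
  refine Finset.sum_le_sum fun c _ => (Finset.abs_sum_le_sum_abs _ _).trans ?_
  rw [Finset.sum_mul]
  refine Finset.sum_le_sum fun j _ => ?_
  have := hC (Fin.cons c j) S hS
  norm_num at this
  rw [abs_mul, abs_mul _ (((S.card : ℝ)⁻¹) ^ 3), abs_of_nonneg (by positivity : 0 ≤ ((S.card : ℝ)⁻¹) ^ 3)]
  calc _ ≤ |v c * q j| * ((S.card : ℝ)⁻¹) ^ 3 * (C * S.card) := by gcongr
    _ = |v c * q j| * C * ((S.card : ℝ)⁻¹) ^ 2 * ((S.card : ℝ)⁻¹ * S.card) := by ring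
    _ = _ := by rw [inv_mul_cancel₀ hN.ne', mul_one]

lemma integral_inner_sub_mul (hZ : ∀ k, Measurable (Z k)) (hstat : IsStationary P Z)
    (hint : Integrable (Z 0) P) (H : EuclideanSpace ℝ (Fin p) → ℝ) (j k : Fin d → ℤ) :
    ∫ ω, inner ℝ (gradient H (fieldMean P Z)) (Z j ω - fieldMean P Z) *
      inner ℝ (gradient H (fieldMean P Z)) (Z k ω - fieldMean P Z) ∂P = sigmaCov P Z H (k - j) := by
  set v := gradient H (fieldMean P Z)
  have hmean : ∀ k, ∫ ω, inner ℝ v (Z k ω) ∂P = inner ℝ v (fieldMean P Z) := fun k => by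
    have hk : Integrable (Z k) P := (hstat.identDistrib hZ k).integrable_iff.2 hint
    rw [integral_inner hk, (hstat.identDistrib hZ k).integral_eq]
    rfl
  have hm : Measurable fun x : EuclideanSpace ℝ (Fin p) × EuclideanSpace ℝ (Fin p) =>
      inner ℝ v (x.1 - fieldMean P Z) * inner ℝ v (x.2 - fieldMean P Z) := by fun_prop
  have := ((hstat.identDistrib_pair hZ j k).comp hm).integral_eq
  simp only [Function.comp_def] at this
  rw [this, sigmaCov, covariance, hmean, hmean]
  simp only [inner_sub_right]
  rfl

/-- By bilinearity `sigmaCov` is a combination of covariances of coordinates, each of which is at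
most `f (supNorm k)`. -/
lemma IsWeaklyDependent.exists_sum_abs_sigmaCov_le [NeZero d]
    (h : IsWeaklyDependent P (centered P Z) (2 * r) f) (hr : 2 ≤ r)
    (hZ : ∀ k, Measurable (Z k)) (hstat : IsStationary P Z)
    (hint : Integrable (Z 0) P) (H : EuclideanSpace ℝ (Fin p) → ℝ) :
    ∃ B, ∀ W : Finset (Fin d → ℤ), ∑ k ∈ W, ((supNorm k : ℝ) + 1) * |sigmaCov P Z H k| ≤ B := by
  obtain ⟨C, hC0, hC⟩ := h.exists_sum_weighted_le (by omega)
  set v := gradient H (fieldMean P Z) with hv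
  set A : ℝ := ∑ a, ∑ b, |v a * v b| with hA
  have hA0 : 0 ≤ A := by positivity
  have hσ : ∀ k, |sigmaCov P Z H k| ≤ A * f (supNorm k) := fun k => by
    have e := integral_inner_sub_mul hZ hstat hint H 0 k
    rw [sub_zero] at e
    have e2 : ∀ ω, inner ℝ v (Z 0 ω - fieldMean P Z) * inner ℝ v (Z k ω - fieldMean P Z) =
        ∑ a, ∑ b, (v a * v b) * (centered P Z a 0 ω * centered P Z b k ω) := fun ω => by
      rw [inner_eq_sum_coord, inner_eq_sum_coord, Finset.sum_mul_sum]
      refine Finset.sum_congr rfl fun a _ => Finset.sum_congr rfl fun b _ => ?_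
      simp only [centered, PiLp.sub_apply]
      ring
    have hi : ∀ a b, Integrable (fun ω => centered P Z a 0 ω * centered P Z b k ω) P :=
      fun a b => by
        simpa [Fin.prod_univ_two] using h.integrable (Fin 2) ![a, b] ![0, k] (by simp; omega)
    rw [← e]
    simp only [← hv, e2]
    rw [integral_finsetSum _ fun a _ => integrable_finsetSum _ fun b _ => (hi a b).const_mul _,
      hA, Finset.sum_mul]
    refine (Finset.abs_sum_le_sum_abs _ _).trans (Finset.sum_le_sum fun a _ => ?_)
    rw [integral_finsetSum _ fun b _ => (hi a b).const_mul _, Finset.sum_mul]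
    refine (Finset.abs_sum_le_sum_abs _ _).trans (Finset.sum_le_sum fun b _ => ?_)
    rw [integral_const_mul, abs_mul]
    have := h.abs_integral_mul_le (by omega) a b 0 k
    rw [sub_zero] at this
    gcongr
  refine ⟨A * C, fun W => ?_⟩
  calc _ ≤ ∑ k ∈ W, A * (((supNorm k : ℝ) + 1) * f (supNorm k)) := by
        refine Finset.sum_le_sum fun k _ => ?_
        calc _ ≤ ((supNorm k : ℝ) + 1) * (A * f (supNorm k)) := by gcongr; exact hσ k
          _ = _ := by ring
    _ ≤ A * C := by
        rw [← Finset.mul_sum]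
        gcongr
        exact hC W

/-- Under the moment, mixing and smoothness conditions, `H` of the sample mean is asymptotically
linear, and the exponent `γ` satisfies `1 ≤ γ d`. -/
theorem exists_isAsymptoticallyLinear [NeZero d] (hZ : ∀ k, Measurable (Z k))
    (hstat : IsStationary P Z) {H : EuclideanSpace ℝ (Fin p) → ℝ} {α₁ g : ℝ → ℝ} {a : ℕ}
    (hA3 : AssumptionA3 P Z α₁ g)
    (hDM : (2 ≤ d ∧ ConditionD H 2 a ∧ ConditionM P Z α₁ g (2 + a)) ∨
      (d = 1 ∧ ConditionD H 3 a ∧ ConditionM P Z α₁ g (3 + a))) :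
    ∃ (Y : (Fin d → ℤ) → Ω → ℝ) (B C γ : ℝ), 1 ≤ γ * d ∧
      IsAsymptoticallyLinear P (fun S ω => H (siteMean Z S ω)) (H (fieldMean P Z)) Y
        (sigmaCov P Z H) B C γ := by
  set μ := fieldMean P Z with hμ
  set v := gradient H μ with hv
  -- the common part of the two cases
  have main : ∀ (r b : ℕ) (C₀ γ : ℝ), 2 + b ≤ r → ConditionM P Z α₁ g r → Continuous H →
      (∀ y, |H (μ + y) - H μ - inner ℝ v y| ≤ C₀ * (‖y‖ ^ 2 * (1 + ‖y‖ ^ b))) → 1 ≤ γ * d →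
      (∀ f, (∀ k, MemLp (Z k) ((2 * r : ℕ) : ENNReal) P) →
        IsWeaklyDependent P (centered P Z) (2 * r) f → ∃ C, 0 ≤ C ∧
        ∀ S : Finset (Fin d → ℤ), S.Nonempty →
        |∫ ω, inner ℝ v (siteMean Z S ω - μ) * (H (siteMean Z S ω) - H μ -
          inner ℝ v (siteMean Z S ω - μ)) ∂P| ≤ C * ((S.card : ℝ)⁻¹ * (S.card : ℝ) ^ (-γ))) →
      ∃ (Y : (Fin d → ℤ) → Ω → ℝ) (B C γ : ℝ), 1 ≤ γ * d ∧
        IsAsymptoticallyLinear P (fun S ω => H (siteMean Z S ω)) (H μ) Y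
          (sigmaCov P Z H) B C γ := by
    intro r b C₀ γ hr hM hH hC₀ hγ hlin
    obtain ⟨hLp, f, hf⟩ := exists_isWeaklyDependent hZ hstat hA3 (by omega) hM
    have hint : ∀ k, Integrable (Z k) P := fun k =>
      (hLp k).integrable (by exact_mod_cast (by omega : 1 ≤ 2 * r))
    have hY : ∀ k, MemLp (fun ω => inner ℝ v (Z k ω - μ)) 2 P := fun k =>
      ((((hLp k).mono_exponent (by exact_mod_cast (by omega : 2 ≤ 2 * r))).sub
        (memLp_const μ)).const_inner v)
    obtain ⟨B, hB⟩ := hf.exists_sum_abs_sigmaCov_le (by omega) hZ hstat (hint 0) H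
    have hRm : Measurable fun y => H (μ + y) - H μ - inner ℝ v y := by
      have := hH.measurable
      fun_prop
    obtain ⟨C₁, hC₁0, hC₁⟩ := hf.exists_integral_sq_le hLp (by omega) hr hRm hC₀
    simp only [← hμ, add_sub_cancel] at hC₁
    obtain ⟨C₂, hC₂0, hC₂⟩ := hlin f hLp hf
    refine ⟨fun k ω => inner ℝ v (Z k ω - μ), B, C₁ + C₂, γ, hγ, hY, fun k => ?_,
      integral_inner_sub_mul hZ hstat (hint 0) H, hB, by positivity, fun S hS => ?_,
      fun S hS => ?_, fun S hS => ?_⟩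
    · have hk := (hint k).sub (integrable_const μ)
      have h1 : ∫ ω, (Z k ω - μ) ∂P = 0 := by
        rw [integral_sub (hint k) (integrable_const μ),
          (hstat.identDistrib hZ k).integral_eq]
        simp [hμ, fieldMean]
      have h2 := integral_inner (𝕜 := ℝ) hk v
      simp only [Pi.sub_apply] at h2
      rw [h2, h1, inner_zero_right]
    · simp only [siteMean_inner v μ hS]
      exact (hC₁ S hS).1
    · simp only [siteMean_inner v μ hS]
      refine (hC₁ S hS).2.trans ?_
      gcongr
      linarith
    · simp only [siteMean_inner v μ hS]
      refine (hC₂ S hS).trans ?_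
      gcongr
      linarith
  have hvb : ∀ y, |inner ℝ v y| ≤ ‖v‖ * (‖y‖ ^ 1 * (1 + ‖y‖ ^ 0)) := fun y => by
    refine (abs_real_inner_le_norm v y).trans ?_
    have := mul_nonneg (norm_nonneg v) (norm_nonneg y)
    simp only [pow_one, pow_zero]
    linarith
  have hvm : Measurable fun y => inner ℝ v y := by fun_prop
  rcases hDM with ⟨hd, hD, hM⟩ | ⟨hd, hD, hM⟩
  · obtain ⟨C₀, hC₀0, hC₀⟩ := hD.exists_linear_remainder_le μ
    have hH : Continuous H := hD.1.continuous
    -- In dimension at least two the cross term may lose a factor `N ^ (1/2)`, since `1 ≤ (1/2) *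
    -- d`.
    refine main (2 + a) a C₀ (1 / 2) le_rfl hM hH hC₀ ?_ fun f hLp hf => ?_
    · have : (2 : ℝ) ≤ d := by exact_mod_cast hd
      linarith
    · have hRm : Measurable fun y => H (μ + y) - H μ - inner ℝ v y := by
        have := hH.measurable
        fun_prop
      obtain ⟨C₁, hC₁0, hC₁⟩ := hf.exists_integral_sq_le hLp (by omega) le_rfl hRm hC₀
      obtain ⟨C₂, hC₂0, hC₂⟩ := hf.exists_integral_sq_le hLp le_rfl (by omega) hvm hvb
      simp only [← hμ, add_sub_cancel] at hC₁ hC₂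
      refine ⟨C₂ + C₁, by positivity, fun S hS => ?_⟩
      have hN : (0 : ℝ) < S.card := by exact_mod_cast hS.card_pos
      obtain ⟨i1, b1⟩ := hC₁ S hS
      obtain ⟨i2, b2⟩ := hC₂ S hS
      -- The linear part has second moment `O(N⁻¹)` and the remainder `O(N⁻²)`; this weight balances
      -- them at `N ^ (-3/2)`.
      have ht : (0 : ℝ) < (S.card : ℝ) ^ (-(1 / 2 : ℝ)) := by positivity
      refine (abs_integral_mul_le_of_sq i2 i1 ht).trans ?_
      have e : ((S.card : ℝ) ^ (-(1 / 2 : ℝ)))⁻¹ * (S.card : ℝ)⁻¹ = (S.card : ℝ) ^ (-(1 / 2 : ℝ)) := by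
        rw [← Real.rpow_neg hN.le, neg_neg, ← Real.rpow_neg_one, ← Real.rpow_add hN]
        norm_num
      calc _ ≤ (S.card : ℝ) ^ (-(1 / 2 : ℝ)) * (C₂ * ((S.card : ℝ)⁻¹) ^ 1) +
            ((S.card : ℝ) ^ (-(1 / 2 : ℝ)))⁻¹ * (C₁ * ((S.card : ℝ)⁻¹) ^ 2) := by gcongr
        _ = C₂ * ((S.card : ℝ)⁻¹ * (S.card : ℝ) ^ (-(1 / 2 : ℝ))) + C₁ * ((S.card : ℝ)⁻¹ *
            (((S.card : ℝ) ^ (-(1 / 2 : ℝ)))⁻¹ * (S.card : ℝ)⁻¹)) := by ring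
        _ = _ := by rw [e]; ring
  -- For `d = 1` the exponent `γ = 1` is required. The remainder is split into its quadratic part,
  -- treated by third moments, and a cubic rest with second moment `O(N⁻³)`, for which
  -- Cauchy-Schwarz suffices.
  · obtain ⟨q, C₀, hC₀0, hC₀⟩ := hD.exists_quadratic_remainder_le μ
    have hH : Continuous H := hD.1.continuous
    set A : ℝ := ∑ j, |q j| with hA
    have hA0 : 0 ≤ A := by positivity
    have hq : ∀ y : EuclideanSpace ℝ (Fin p), |∑ j, q j * ∏ i, y (j i)| ≤ A * ‖y‖ ^ 2 := fun y => by
      refine (Finset.abs_sum_le_sum_abs _ _).trans ?_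
      rw [hA, Finset.sum_mul]
      refine Finset.sum_le_sum fun j _ => ?_
      rw [abs_mul, Finset.abs_prod]
      gcongr
      calc ∏ i, |y (j i)| ≤ ∏ _i : Fin 2, ‖y‖ :=
            Finset.prod_le_prod (fun _ _ => abs_nonneg _) fun i _ => PiLp.norm_apply_le y (j i)
        _ = ‖y‖ ^ 2 := by simp
    -- The `L²` bound of `main` asks for a remainder of order two. The cubic rest is absorbed by
    -- raising the growth exponent to `a + 1`, which the available moments allow because `2 + (a +
    -- 1) = 3 + a`.
    have hlin : ∀ y, |H (μ + y) - H μ - inner ℝ v y| ≤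
        (A + 2 * C₀) * (‖y‖ ^ 2 * (1 + ‖y‖ ^ (a + 1))) := fun y => by
      have h1 := hC₀ y
      have h2 := hq y
      have h3 := abs_sub_abs_le_abs_sub (H (μ + y) - H μ - inner ℝ v y) (∑ j, q j * ∏ i, y (j i))
      have h4 : ‖y‖ ≤ 1 + ‖y‖ ^ (a + 1) := by
        rcases le_total ‖y‖ 1 with hy | hy
        · have : 0 ≤ ‖y‖ ^ (a + 1) := by positivity
          linarith
        · have := le_self_pow₀ hy (by omega : a + 1 ≠ 0)
          linarith
      have h5 : ‖y‖ ^ 3 * (1 + ‖y‖ ^ a) ≤ 2 * (‖y‖ ^ 2 * (1 + ‖y‖ ^ (a + 1))) := by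
        have e : ‖y‖ ^ 3 * (1 + ‖y‖ ^ a) = ‖y‖ ^ 2 * (‖y‖ + ‖y‖ ^ (a + 1)) := by ring
        rw [e]
        have h6 : 0 ≤ ‖y‖ ^ 2 := by positivity
        have h7 : 0 ≤ ‖y‖ ^ (a + 1) := by positivity
        nlinarith
      have h8 : ‖y‖ ^ 2 ≤ ‖y‖ ^ 2 * (1 + ‖y‖ ^ (a + 1)) :=
        le_mul_of_one_le_right (by positivity) (by linarith [pow_nonneg (norm_nonneg y) (a + 1)])
      calc _ ≤ A * ‖y‖ ^ 2 + C₀ * (‖y‖ ^ 3 * (1 + ‖y‖ ^ a)) := by linarith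
        _ ≤ A * (‖y‖ ^ 2 * (1 + ‖y‖ ^ (a + 1))) +
            C₀ * (2 * (‖y‖ ^ 2 * (1 + ‖y‖ ^ (a + 1)))) := by gcongr
        _ = _ := by ring
    refine main (3 + a) (a + 1) (A + 2 * C₀) 1 (by omega) hM hH hlin ?_ fun f hLp hf => ?_
    · simp [hd]
    · have hQm : Measurable fun y : EuclideanSpace ℝ (Fin p) => ∑ j, q j * ∏ i, y (j i) :=
        Finset.measurable_fun_sum _ fun j _ => (Finset.measurable_fun_prod _ fun i _ =>
          measurable_coord (j i)).const_mul _
      have hRm : Measurable fun y => H (μ + y) - H μ - inner ℝ v y - ∑ j, q j * ∏ i, y (j i) := by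
        have := hH.measurable
        exact Measurable.sub (by fun_prop) hQm
      obtain ⟨C₁, hC₁0, hC₁⟩ := hf.exists_integral_sq_le hLp (by omega) le_rfl hRm hC₀
      obtain ⟨C₂, hC₂0, hC₂⟩ := hf.exists_integral_sq_le hLp le_rfl (by omega) hvm hvb
      obtain ⟨C₃, hC₃0, hC₃⟩ := hf.exists_integral_inner_mul_quadratic_le (by omega) v q
      obtain ⟨C₄, -, hC₄⟩ := hf.exists_integral_sq_le hLp (m := 2) (b := 0) (by omega) (by omega)
        hQm (C₀ := A) fun y => (hq y).trans (by
          gcongr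
          simp only [pow_zero]
          linarith [sq_nonneg ‖y‖])
      simp only [← hμ, add_sub_cancel] at hC₁ hC₂ hC₃ hC₄
      refine ⟨C₂ + C₁ + C₃, by positivity, fun S hS => ?_⟩
      have hN : (0 : ℝ) < S.card := by exact_mod_cast hS.card_pos
      obtain ⟨i1, b1⟩ := hC₁ S hS
      obtain ⟨i2, b2⟩ := hC₂ S hS
      have i4 := (hC₄ S hS).1
      have b3 := hC₃ S hS
      have ht : (0 : ℝ) < (S.card : ℝ)⁻¹ := by positivity
      have e : ∀ ω, inner ℝ v (siteMean Z S ω - μ) * (H (siteMean Z S ω) - H μ -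
          inner ℝ v (siteMean Z S ω - μ)) =
          inner ℝ v (siteMean Z S ω - μ) * (H (siteMean Z S ω) - H μ -
            inner ℝ v (siteMean Z S ω - μ) - ∑ j, q j * ∏ i, (siteMean Z S ω - μ) (j i)) +
          inner ℝ v (siteMean Z S ω - μ) * ∑ j, q j * ∏ i, (siteMean Z S ω - μ) (j i) :=
        fun ω => by ring
      simp only [e]
      have i5 : Integrable (fun ω => inner ℝ v (siteMean Z S ω - μ) * (H (siteMean Z S ω) - H μ -
          inner ℝ v (siteMean Z S ω - μ) - ∑ j, q j * ∏ i, (siteMean Z S ω - μ) (j i))) P :=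
        i2.integrable_mul i1
      have i6 : Integrable (fun ω => inner ℝ v (siteMean Z S ω - μ) *
          ∑ j, q j * ∏ i, (siteMean Z S ω - μ) (j i)) P := i2.integrable_mul i4
      rw [integral_add i5 i6, Real.rpow_neg_one]
      refine (abs_add_le _ _).trans ((add_le_add (abs_integral_mul_le_of_sq i2 i1 ht) b3).trans ?_)
      calc _ ≤ (S.card : ℝ)⁻¹ * (C₂ * ((S.card : ℝ)⁻¹) ^ 1) +
            ((S.card : ℝ)⁻¹)⁻¹ * (C₁ * ((S.card : ℝ)⁻¹) ^ 3) + C₃ * ((S.card : ℝ)⁻¹) ^ 2 := by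
            gcongr
        _ = (C₂ + C₁ + C₃) * ((S.card : ℝ)⁻¹ * (S.card : ℝ)⁻¹) := by
            field_simp

end Linearization

/-! ### Variances and subsampling averages of asymptotically linear statistics -/

namespace IsAsymptoticallyLinear

variable {d : ℕ} {Ω : Type*} [MeasurableSpace Ω] {P : Measure Ω}
  {θ : Finset (Fin d → ℤ) → Ω → ℝ} {h₀ : ℝ} {Y : (Fin d → ℤ) → Ω → ℝ} {σ : (Fin d → ℤ) → ℝ}
  {B C γ : ℝ}

lemma bound_nonneg (h : IsAsymptoticallyLinear P θ h₀ Y σ B C γ) : 0 ≤ B := by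
  simpa using h.sum_le ∅

lemma sum_abs_le (h : IsAsymptoticallyLinear P θ h₀ Y σ B C γ) (W : Finset (Fin d → ℤ)) :
    ∑ k ∈ W, |σ k| ≤ B :=
  (Finset.sum_le_sum fun k _ => le_mul_of_one_le_left (abs_nonneg _)
    (by linarith [(supNorm k).cast_nonneg (α := ℝ)])).trans (h.sum_le W)

lemma summable (h : IsAsymptoticallyLinear P θ h₀ Y σ B C γ) : Summable σ :=
  (summable_of_sum_le (fun _ => abs_nonneg _) h.sum_abs_le).of_abs

lemma integral_sum_mul_sum (h : IsAsymptoticallyLinear P θ h₀ Y σ B C γ)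
    (T : Finset (Fin d → ℤ)) (w : (Fin d → ℤ) → ℝ) :
    ∫ ω, (∑ k ∈ T, w k * Y k ω) ^ 2 ∂P = ∑ j ∈ T, ∑ k ∈ T, w j * w k * σ (k - j) := by
  have e : ∀ ω, (∑ k ∈ T, w k * Y k ω) ^ 2 =
      ∑ j ∈ T, ∑ k ∈ T, w j * w k * (Y j ω * Y k ω) := fun ω => by
    rw [sq, Finset.sum_mul_sum]
    exact Finset.sum_congr rfl fun j _ => Finset.sum_congr rfl fun k _ => by ring
  have hi : ∀ j k, Integrable (fun ω => w j * w k * (Y j ω * Y k ω)) P := fun j k =>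
    ((h.memLp j).integrable_mul (h.memLp k)).const_mul _
  simp only [e]
  rw [integral_finsetSum _ fun j _ => integrable_finsetSum _ fun k _ => hi j k]
  refine Finset.sum_congr rfl fun j _ => ?_
  rw [integral_finsetSum _ fun k _ => hi j k]
  refine Finset.sum_congr rfl fun k _ => ?_
  rw [integral_const_mul, h.cov]

/-- Schur's test: `2 |w j * w k| ≤ w j ^ 2 + w k ^ 2`, and every row and column of the kernel `|σ (k
- j)|` sums to at most `B`. -/
lemma integral_sum_sq_le (h : IsAsymptoticallyLinear P θ h₀ Y σ B C γ)
    (T : Finset (Fin d → ℤ)) (w : (Fin d → ℤ) → ℝ) :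
    ∫ ω, (∑ k ∈ T, w k * Y k ω) ^ 2 ∂P ≤ B * ∑ k ∈ T, w k ^ 2 := by
  rw [h.integral_sum_mul_sum]
  have h1 : ∀ j, ∑ k ∈ T, |σ (k - j)| ≤ B := fun j => by
    have := h.sum_abs_le (T.image fun k => k - j)
    rwa [Finset.sum_image fun a _ b _ hab => sub_left_injective hab] at this
  have h2 : ∀ k, ∑ j ∈ T, |σ (k - j)| ≤ B := fun k => by
    have := h.sum_abs_le (T.image fun j => k - j)
    rwa [Finset.sum_image fun a _ b _ hab => sub_right_injective hab] at this
  calc _ ≤ ∑ j ∈ T, ∑ k ∈ T, (w j ^ 2 / 2 * |σ (k - j)| + w k ^ 2 / 2 * |σ (k - j)|) := by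
        refine Finset.sum_le_sum fun j _ => Finset.sum_le_sum fun k _ => ?_
        rw [← add_mul]
        calc w j * w k * σ (k - j) ≤ |w j * w k| * |σ (k - j)| := by
              rw [← abs_mul]; exact le_abs_self _
          _ ≤ (w j ^ 2 / 2 + w k ^ 2 / 2) * |σ (k - j)| := by
              refine mul_le_mul_of_nonneg_right ?_ (abs_nonneg _)
              rw [abs_le]
              constructor <;> nlinarith [sq_nonneg (w j + w k), sq_nonneg (w j - w k)]
    _ = ∑ j ∈ T, w j ^ 2 / 2 * ∑ k ∈ T, |σ (k - j)| +
          ∑ k ∈ T, w k ^ 2 / 2 * ∑ j ∈ T, |σ (k - j)| := by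
        simp only [Finset.sum_add_distrib, Finset.mul_sum]
        congr 1
        exact Finset.sum_comm
    _ ≤ ∑ j ∈ T, w j ^ 2 / 2 * B + ∑ k ∈ T, w k ^ 2 / 2 * B := by
        gcongr with j _ k _
        · exact h1 j
        · exact h2 k
    _ = _ := by
        rw [← Finset.sum_mul, ← Finset.sum_div]; ring

lemma memLp_siteMean (h : IsAsymptoticallyLinear P θ h₀ Y σ B C γ) (S : Finset (Fin d → ℤ)) :
    MemLp (fun ω => siteMean Y S ω) 2 P := by
  have h1 : MemLp (fun ω => ∑ k ∈ S, Y k ω) 2 P := memLp_finsetSum S fun k _ => h.memLp k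
  exact h1.const_mul (S.card : ℝ)⁻¹

lemma integral_siteMean [IsFiniteMeasure P] (h : IsAsymptoticallyLinear P θ h₀ Y σ B C γ)
    (S : Finset (Fin d → ℤ)) : ∫ ω, siteMean Y S ω ∂P = 0 := by
  simp only [siteMean, smul_eq_mul]
  rw [integral_const_mul, integral_finsetSum _ fun k _ => (h.memLp k).integrable (by norm_num)]
  simp [h.mean_zero]

/-- The scaled variance of a sample mean is close to the sum of all covariances if the set of
sites has a small boundary. -/
lemma abs_card_mul_integral_sq_sub_le (h : IsAsymptoticallyLinear P θ h₀ Y σ B C γ)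
    {S : Finset (Fin d → ℤ)} (hS : S.Nonempty) {b : ℝ}
    (hb0 : 0 ≤ b) (hb : ∀ v, ((S.filter fun k => k + v ∉ S).card : ℝ) ≤ b * supNorm v) :
    |S.card * (∫ ω, siteMean Y S ω ^ 2 ∂P) - ∑' k, σ k| ≤ (S.card : ℝ)⁻¹ * (b * B) := by
  have hN : (0 : ℝ) < S.card := by exact_mod_cast hS.card_pos
  have e1 : ∫ ω, siteMean Y S ω ^ 2 ∂P =
      ((S.card : ℝ)⁻¹) ^ 2 * ∑ j ∈ S, ∑ k ∈ S, σ (k - j) := by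
    have := h.integral_sum_mul_sum S fun _ => (S.card : ℝ)⁻¹
    simp only [← Finset.mul_sum] at this
    simp only [siteMean, smul_eq_mul]
    rw [this]
    ring
  -- Seen from the site `j`, the finite sum misses the covariances at lags `v` that leave `S`.
  -- Summed over `j`, the lag `v` is missed once for every `k ∈ S` with `k + v ∉ S`, which is the
  -- quantity bounded by `hb`.
  have e2 : ∀ j ∈ S, HasSum (fun v => if j + v ∈ S then 0 else σ v)
      ((∑' k, σ k) - ∑ k ∈ S, σ (k - j)) := fun j _ => by
    have h1 : HasSum (fun v => if j + v ∈ S then σ v else 0) (∑ k ∈ S, σ (k - j)) := by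
      have h2 : HasSum (fun k => if k ∈ S then σ (k - j) else 0) (∑ k ∈ S, σ (k - j)) := by
        rw [← Finset.sum_congr rfl fun k (hk : k ∈ S) => if_pos (c := k ∈ S) hk]
        exact hasSum_sum_of_ne_finset_zero fun k hk => if_neg hk
      rw [← (Equiv.addLeft j).hasSum_iff] at h2
      simpa [Function.comp_def] using h2
    refine (h.summable.hasSum.sub h1).congr_fun ?_
    intro v
    split_ifs <;> simp
  have e3 : HasSum (fun v => ∑ j ∈ S, if j + v ∈ S then 0 else σ v)
      (S.card * (∑' k, σ k) - ∑ j ∈ S, ∑ k ∈ S, σ (k - j)) := by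
    have := hasSum_sum e2
    simpa [Finset.sum_sub_distrib] using this
  have e4 : ∀ v, |∑ j ∈ S, if j + v ∈ S then 0 else σ v| ≤
      b * (((supNorm v : ℝ) + 1) * |σ v|) := fun v => by
    have : ∑ j ∈ S, (if j + v ∈ S then 0 else σ v) =
        ((S.filter fun k => k + v ∉ S).card : ℝ) * σ v := by
      simp only [← ite_not (_ ∈ S)]
      rw [← Finset.sum_filter]
      simp
    rw [this, abs_mul, abs_of_nonneg (Nat.cast_nonneg _), ← mul_assoc]
    refine mul_le_mul_of_nonneg_right ((hb v).trans ?_) (abs_nonneg _)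
    gcongr
    linarith
  have hnn : ∀ v, 0 ≤ ((supNorm v : ℝ) + 1) * |σ v| := fun v => by positivity
  have e5 : |S.card * (∑' k, σ k) - ∑ j ∈ S, ∑ k ∈ S, σ (k - j)| ≤ b * B := by
    have hs : Summable fun v => ((supNorm v : ℝ) + 1) * |σ v| := summable_of_sum_le hnn h.sum_le
    rw [← e3.tsum_eq]
    refine (tsum_of_norm_bounded (f := fun v => ∑ j ∈ S, if j + v ∈ S then 0 else σ v)
      (hs.hasSum.mul_left b) e4).trans ?_
    gcongr
    exact Real.tsum_le_of_sum_le hnn h.sum_le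
  rw [e1]
  have e6 : S.card * (((S.card : ℝ)⁻¹) ^ 2 * ∑ j ∈ S, ∑ k ∈ S, σ (k - j)) - ∑' k, σ k =
      (S.card : ℝ)⁻¹ * -(S.card * (∑' k, σ k) - ∑ j ∈ S, ∑ k ∈ S, σ (k - j)) := by
    field_simp; ring
  rw [e6, abs_mul, abs_neg, abs_of_pos (inv_pos.2 hN)]
  gcongr

lemma memLp_sub_const (h : IsAsymptoticallyLinear P θ h₀ Y σ B C γ) {S : Finset (Fin d → ℤ)}
    (hS : S.Nonempty) : MemLp (fun ω => θ S ω - h₀) 2 P := by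
  refine ((h.memLp_siteMean S).add (h.rem_memLp S hS)).ae_eq (Eventually.of_forall fun ω => ?_)
  simp

variable [IsProbabilityMeasure P]

lemma memLp_stat (h : IsAsymptoticallyLinear P θ h₀ Y σ B C γ) {S : Finset (Fin d → ℤ)}
    (hS : S.Nonempty) : MemLp (θ S) 2 P := by
  refine ((h.memLp_sub_const hS).add (memLp_const h₀)).ae_eq (Eventually.of_forall fun ω => ?_)
  simp

lemma integral_sub_const (h : IsAsymptoticallyLinear P θ h₀ Y σ B C γ) {S : Finset (Fin d → ℤ)}
    (hS : S.Nonempty) :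
    ∫ ω, (θ S ω - h₀) ∂P = ∫ ω, (θ S ω - h₀ - siteMean Y S ω) ∂P := by
  rw [integral_sub ((h.memLp_sub_const hS).integrable (by norm_num))
    ((h.memLp_siteMean S).integrable (by norm_num)), h.integral_siteMean, sub_zero]

lemma variance_eq (h : IsAsymptoticallyLinear P θ h₀ Y σ B C γ) {S : Finset (Fin d → ℤ)}
    (hS : S.Nonempty) : variance (θ S) P =
      (∫ ω, (θ S ω - h₀) ^ 2 ∂P) - (∫ ω, (θ S ω - h₀ - siteMean Y S ω) ∂P) ^ 2 := by
  rw [← variance_sub_const (h.memLp_stat hS).aestronglyMeasurable h₀,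
    variance_eq_sub (h.memLp_sub_const hS), h.integral_sub_const hS]
  rfl

lemma integral_rem_sq_le (h : IsAsymptoticallyLinear P θ h₀ Y σ B C γ) {S : Finset (Fin d → ℤ)}
    (hS : S.Nonempty) : (∫ ω, (θ S ω - h₀ - siteMean Y S ω) ∂P) ^ 2 ≤
      ∫ ω, (θ S ω - h₀ - siteMean Y S ω) ^ 2 ∂P := by
  have h1 := variance_nonneg (fun ω => θ S ω - h₀ - siteMean Y S ω) P
  rw [variance_eq_sub (h.rem_memLp S hS)] at h1
  simpa using h1

/-- The scaled variance of the statistic is close to the sum of all covariances. -/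
theorem abs_card_mul_variance_sub_le (h : IsAsymptoticallyLinear P θ h₀ Y σ B C γ)
    {S : Finset (Fin d → ℤ)} (hS : S.Nonempty) {b : ℝ} (hb0 : 0 ≤ b)
    (hb : ∀ v, ((S.filter fun k => k + v ∉ S).card : ℝ) ≤ b * supNorm v) :
    |S.card * variance (θ S) P - ∑' k, σ k| ≤
      (S.card : ℝ)⁻¹ * (b * B) + 2 * C * (S.card : ℝ) ^ (-γ) + C * (S.card : ℝ)⁻¹ := by
  have hN : (0 : ℝ) < S.card := by exact_mod_cast hS.card_pos
  have hL := h.memLp_siteMean S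
  have hR := h.rem_memLp S hS
  have h1 := h.abs_card_mul_integral_sq_sub_le hS hb0 hb
  have h2 := h.rem_sq_le S hS
  have h3 := h.rem_mul_le S hS
  have h4 := h.integral_rem_sq_le hS
  rw [h.variance_eq hS]
  have i1 : Integrable (fun ω => siteMean Y S ω ^ 2) P := hL.integrable_sq
  have i2 : Integrable (fun ω => siteMean Y S ω * (θ S ω - h₀ - siteMean Y S ω)) P :=
    hL.integrable_mul hR
  have i3 : Integrable (fun ω => (θ S ω - h₀ - siteMean Y S ω) ^ 2) P := hR.integrable_sq
  have e : ∫ ω, (θ S ω - h₀) ^ 2 ∂P = (∫ ω, siteMean Y S ω ^ 2 ∂P) +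
      2 * (∫ ω, siteMean Y S ω * (θ S ω - h₀ - siteMean Y S ω) ∂P) +
      ∫ ω, (θ S ω - h₀ - siteMean Y S ω) ^ 2 ∂P := by
    have i4 : Integrable (fun ω => siteMean Y S ω ^ 2 +
        2 * (siteMean Y S ω * (θ S ω - h₀ - siteMean Y S ω))) P := i1.add (i2.const_mul 2)
    rw [← integral_const_mul, ← integral_add i1 (i2.const_mul 2), ← integral_add i4 i3]
    exact integral_congr_ae (Eventually.of_forall fun ω => by simp only; ring)
  rw [e]
  set L2 := ∫ ω, siteMean Y S ω ^ 2 ∂P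
  set LR := ∫ ω, siteMean Y S ω * (θ S ω - h₀ - siteMean Y S ω) ∂P
  set R2 := ∫ ω, (θ S ω - h₀ - siteMean Y S ω) ^ 2 ∂P
  set R1 := ∫ ω, (θ S ω - h₀ - siteMean Y S ω) ∂P
  have e2 : S.card * (L2 + 2 * LR + R2 - R1 ^ 2) - ∑' k, σ k =
      (S.card * L2 - ∑' k, σ k) + 2 * (S.card * LR) + S.card * (R2 - R1 ^ 2) := by ring
  have h5 : |S.card * LR| ≤ C * (S.card : ℝ) ^ (-γ) := by
    rw [abs_mul, abs_of_pos hN]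
    calc _ ≤ S.card * (C * ((S.card : ℝ)⁻¹ * (S.card : ℝ) ^ (-γ))) := by gcongr
      _ = C * (S.card : ℝ) ^ (-γ) * (S.card * (S.card : ℝ)⁻¹) := by ring
      _ = _ := by rw [mul_inv_cancel₀ hN.ne', mul_one]
  have h6 : |S.card * (R2 - R1 ^ 2)| ≤ C * (S.card : ℝ)⁻¹ := by
    rw [abs_mul, abs_of_pos hN, abs_of_nonneg (by linarith)]
    calc _ ≤ S.card * (C * ((S.card : ℝ)⁻¹) ^ 2) := by
          gcongr; linarith [sq_nonneg R1]
      _ = C * (S.card : ℝ)⁻¹ * (S.card * (S.card : ℝ)⁻¹) := by ring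
      _ = _ := by rw [mul_inv_cancel₀ hN.ne', mul_one]
  rw [e2]
  refine (abs_add_le _ _).trans (add_le_add ((abs_add_le _ _).trans (add_le_add h1 ?_)) h6)
  rw [abs_mul, abs_two]
  linarith

/-- Second moments of weighted averages of the statistic over a family of sets of sites of
comparable size `V` and multiplicity at most `M`. -/
lemma integral_weighted_sq_le (h : IsAsymptoticallyLinear P θ h₀ Y σ B C γ) {ι : Type*}
    {J : Finset ι} (hJ : J.Nonempty) {S : ι → Finset (Fin d → ℤ)} {V c M A : ℝ} (hV : 0 < V)
    (hc : 0 < c) (hSV : ∀ i ∈ J, c * V ≤ (S i).card) (hM0 : 0 ≤ M)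
    (hM : ∀ k, ((J.filter fun i => k ∈ S i).card : ℝ) ≤ M) (hA0 : 0 ≤ A) {w : ι → ℝ}
    (hw0 : ∀ i ∈ J, 0 ≤ w i) (hw : ∀ i ∈ J, w i ≤ A * (J.card : ℝ)⁻¹) :
    ∫ ω, (∑ i ∈ J, w i * (θ (S i) ω - h₀)) ^ 2 ∂P ≤
      2 * A ^ 2 * (B * (M / (J.card * (c * V))) + C / (c * V) ^ 2) := by
  have hcV : 0 < c * V := mul_pos hc hV
  have hJ0 : (0 : ℝ) < J.card := by exact_mod_cast hJ.card_pos
  have hN0 : ∀ i ∈ J, (0 : ℝ) < (S i).card := fun i hi => hcV.trans_le (hSV i hi)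
  have hSne : ∀ i ∈ J, (S i).Nonempty := fun i hi =>
    Finset.card_pos.1 (by exact_mod_cast hN0 i hi)
  have hsumw : ∑ i ∈ J, w i ≤ A := by
    calc ∑ i ∈ J, w i ≤ ∑ _i ∈ J, A * (J.card : ℝ)⁻¹ := Finset.sum_le_sum hw
      _ = A := by rw [Finset.sum_const, nsmul_eq_mul]; field_simp
  classical
  -- the linear part
  set T := J.biUnion S with hT
  -- `u k` is the total coefficient of `Y k`. The coefficients sum to at most `A`, and each is at
  -- most `A * M / (J.card * (c * V))` by the multiplicity bound; the product of the two bounds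
  -- controls the sum of the squares.
  set u : (Fin d → ℤ) → ℝ := fun k => ∑ i ∈ J.filter fun i => k ∈ S i, w i * ((S i).card : ℝ)⁻¹
    with hu
  have hlin : ∀ ω, ∑ i ∈ J, w i * siteMean Y (S i) ω = ∑ k ∈ T, u k * Y k ω := fun ω => by
    simp only [siteMean, smul_eq_mul, hu, Finset.sum_mul, Finset.mul_sum]
    rw [Finset.sum_comm' (t' := J) (s' := fun i => S i)]
    · exact Finset.sum_congr rfl fun i _ => Finset.sum_congr rfl fun k _ => by ring
    · intro k i
      simp only [hT, Finset.mem_biUnion, Finset.mem_filter]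
      exact ⟨fun ⟨_, hi, hk⟩ => ⟨hk, hi⟩, fun ⟨hk, hi⟩ => ⟨⟨i, hi, hk⟩, hi, hk⟩⟩
  have hu0 : ∀ k, 0 ≤ u k := fun k => Finset.sum_nonneg fun i hi => by
    have := hw0 i (Finset.mem_filter.1 hi).1
    positivity
  have hui : ∀ k, u k ≤ A * M / (J.card * (c * V)) := fun k => by
    calc u k ≤ ∑ _i ∈ J.filter fun i => k ∈ S i, A * (J.card : ℝ)⁻¹ * (c * V)⁻¹ := by
          refine Finset.sum_le_sum fun i hi => ?_
          have hi := (Finset.mem_filter.1 hi).1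
          have h1 := hw i hi
          have h2 := hSV i hi
          have h3 := hw0 i hi
          gcongr
      _ = ((J.filter fun i => k ∈ S i).card : ℝ) * (A * (J.card : ℝ)⁻¹ * (c * V)⁻¹) := by
          rw [Finset.sum_const, nsmul_eq_mul]
      _ ≤ M * (A * (J.card : ℝ)⁻¹ * (c * V)⁻¹) := by gcongr; exact hM k
      _ = _ := by field_simp
  have husum : ∑ k ∈ T, u k ≤ A := by
    refine le_trans (le_of_eq ?_) hsumw
    simp only [hu]
    rw [Finset.sum_comm' (t' := J) (s' := fun i => S i)]
    · refine Finset.sum_congr rfl fun i hi => ?_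
      rw [Finset.sum_const, nsmul_eq_mul]
      have := (hN0 i hi).ne'
      field_simp
    · intro k i
      simp only [hT, Finset.mem_biUnion, Finset.mem_filter]
      exact ⟨fun ⟨_, hi, hk⟩ => ⟨hk, hi⟩, fun ⟨hk, hi⟩ => ⟨⟨i, hi, hk⟩, hi, hk⟩⟩
  have hE1 : ∫ ω, (∑ i ∈ J, w i * siteMean Y (S i) ω) ^ 2 ∂P ≤
      A ^ 2 * (B * (M / (J.card * (c * V)))) := by
    simp only [hlin]
    refine (h.integral_sum_sq_le T u).trans ?_
    have hB := h.bound_nonneg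
    calc B * ∑ k ∈ T, u k ^ 2 ≤ B * ∑ k ∈ T, A * M / (J.card * (c * V)) * u k := by
          gcongr with k _
          rw [sq]
          exact mul_le_mul_of_nonneg_right (hui k) (hu0 k)
      _ = B * (A * M / (J.card * (c * V)) * ∑ k ∈ T, u k) := by
          simp only [Finset.mul_sum]
      _ ≤ B * (A * M / (J.card * (c * V)) * A) := by gcongr
      _ = _ := by ring
  -- the remainder
  have hR : ∀ i ∈ J, MemLp (fun ω => θ (S i) ω - h₀ - siteMean Y (S i) ω) 2 P := fun i hi =>
    h.rem_memLp _ (hSne i hi)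
  have hE2 : ∫ ω, (∑ i ∈ J, w i * (θ (S i) ω - h₀ - siteMean Y (S i) ω)) ^ 2 ∂P ≤
      A ^ 2 * (C / (c * V) ^ 2) := by
    have hi : ∀ i ∈ J, Integrable (fun ω => (A * (J.card : ℝ)⁻¹) ^ 2 *
        (θ (S i) ω - h₀ - siteMean Y (S i) ω) ^ 2) P := fun i hi =>
      (hR i hi).integrable_sq.const_mul _
    have hsum : MemLp (fun ω => ∑ i ∈ J, w i * (θ (S i) ω - h₀ - siteMean Y (S i) ω)) 2 P :=
      memLp_finsetSum J fun i hi => (hR i hi).const_mul (w i)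
    calc _ ≤ ∫ ω, J.card * ∑ i ∈ J, (A * (J.card : ℝ)⁻¹) ^ 2 *
          (θ (S i) ω - h₀ - siteMean Y (S i) ω) ^ 2 ∂P := by
          refine integral_mono hsum.integrable_sq ((integrable_finsetSum J hi).const_mul _)
            fun ω => ?_
          refine sq_sum_le_card_mul_sum_sq.trans ?_
          refine mul_le_mul_of_nonneg_left (Finset.sum_le_sum fun i hi => ?_) (Nat.cast_nonneg _)
          rw [mul_pow]
          have h1 := hw0 i hi
          have h2 := hw i hi
          gcongr
      _ = J.card * ∑ i ∈ J, (A * (J.card : ℝ)⁻¹) ^ 2 *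
          ∫ ω, (θ (S i) ω - h₀ - siteMean Y (S i) ω) ^ 2 ∂P := by
          rw [integral_const_mul, integral_finsetSum J hi]
          simp only [integral_const_mul]
      _ ≤ J.card * ∑ _i ∈ J, (A * (J.card : ℝ)⁻¹) ^ 2 * (C * ((c * V)⁻¹) ^ 2) := by
          have hC := h.const_nonneg
          gcongr with i hi
          refine (h.rem_sq_le _ (hSne i hi)).trans ?_
          have := hSV i hi
          gcongr
      _ = _ := by rw [Finset.sum_const, nsmul_eq_mul]; field_simp
  have hLm : MemLp (fun ω => ∑ i ∈ J, w i * siteMean Y (S i) ω) 2 P :=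
    memLp_finsetSum J fun i _ => (h.memLp_siteMean (S i)).const_mul (w i)
  have hRm : MemLp (fun ω => ∑ i ∈ J, w i * (θ (S i) ω - h₀ - siteMean Y (S i) ω)) 2 P :=
    memLp_finsetSum J fun i hi => (hR i hi).const_mul (w i)
  have hθm : MemLp (fun ω => ∑ i ∈ J, w i * (θ (S i) ω - h₀)) 2 P :=
    memLp_finsetSum J fun i hi => (h.memLp_sub_const (hSne i hi)).const_mul (w i)
  calc _ ≤ ∫ ω, (2 * (∑ i ∈ J, w i * siteMean Y (S i) ω) ^ 2 +
        2 * (∑ i ∈ J, w i * (θ (S i) ω - h₀ - siteMean Y (S i) ω)) ^ 2) ∂P := by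
        refine integral_mono hθm.integrable_sq
          ((hLm.integrable_sq.const_mul 2).add (hRm.integrable_sq.const_mul 2)) fun ω => ?_
        have e : ∑ i ∈ J, w i * (θ (S i) ω - h₀) = ∑ i ∈ J, w i * siteMean Y (S i) ω +
            ∑ i ∈ J, w i * (θ (S i) ω - h₀ - siteMean Y (S i) ω) := by
          rw [← Finset.sum_add_distrib]
          exact Finset.sum_congr rfl fun i _ => by ring
        simp only [e]
        nlinarith [sq_nonneg (∑ i ∈ J, w i * siteMean Y (S i) ω -
            ∑ i ∈ J, w i * (θ (S i) ω - h₀ - siteMean Y (S i) ω))]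
    _ = 2 * (∫ ω, (∑ i ∈ J, w i * siteMean Y (S i) ω) ^ 2 ∂P) +
        2 * ∫ ω, (∑ i ∈ J, w i * (θ (S i) ω - h₀ - siteMean Y (S i) ω)) ^ 2 ∂P := by
        rw [integral_add (hLm.integrable_sq.const_mul 2) (hRm.integrable_sq.const_mul 2),
          integral_const_mul, integral_const_mul]
    _ ≤ 2 * (A ^ 2 * (B * (M / (J.card * (c * V))))) + 2 * (A ^ 2 * (C / (c * V) ^ 2)) := by
        gcongr
    _ = _ := by ring

set_option maxHeartbeats 1000000 in
/-- The expectation of the subsample variance over blocks of comparable size `V` and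
multiplicity at most `M`. -/
theorem abs_integral_blockVariance_sub_le (h : IsAsymptoticallyLinear P θ h₀ Y σ B C γ)
    {c₁ c₂ : ℝ} (hc₁ : 0 < c₁) (hc₂ : 0 ≤ c₂) : ∃ K, 0 ≤ K ∧ ∀ (J : Finset (Fin d → ℤ))
    (S : (Fin d → ℤ) → Finset (Fin d → ℤ)) (V M τ η : ℝ), J.Nonempty → 0 < V → 0 ≤ M →
    (∀ i ∈ J, c₁ * V ≤ (S i).card) → (∀ i ∈ J, ((S i).card : ℝ) ≤ c₂ * V) →
    (∀ k, ((J.filter fun i => k ∈ S i).card : ℝ) ≤ M) →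
    (∀ i ∈ J, |(S i).card * variance (θ (S i)) P - τ| ≤ η) →
    |(∫ ω, (J.card : ℝ)⁻¹ * ∑ i ∈ J, ((S i).card : ℝ) *
      (θ (S i) ω - (J.card : ℝ)⁻¹ * ∑ j ∈ J, θ (S j) ω) ^ 2 ∂P) - τ| ≤
      η + K * (V⁻¹ + M / J.card) := by
  have hB := h.bound_nonneg
  have hC := h.const_nonneg
  set G : ℝ := B / c₁ + C / c₁ ^ 2 with hG
  have hG0 : 0 ≤ G := by positivity
  -- `C / c₁` pays for using second moments about `h₀` instead of variances, `4 + 4 * c₂ ^ 2` for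
  -- the cross term `2 * u * v`, and `2 * c₂` for `n * u ^ 2`.
  refine ⟨C / c₁ + (4 + 4 * c₂ ^ 2 + 2 * c₂) * G, by positivity,
    fun J S V M τ η hJ hV hM0 hS1 hS2 hM hη => ?_⟩
  have hJ0 : (0 : ℝ) < J.card := by exact_mod_cast hJ.card_pos
  have hcV : 0 < c₁ * V := mul_pos hc₁ hV
  have hN0 : ∀ i ∈ J, (0 : ℝ) < (S i).card := fun i hi => hcV.trans_le (hS1 i hi)
  have hSne : ∀ i ∈ J, (S i).Nonempty := fun i hi =>
    Finset.card_pos.1 (by exact_mod_cast hN0 i hi)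
  set q : ℝ := (J.card : ℝ)⁻¹ with hq
  have hq0 : 0 < q := inv_pos.2 hJ0
  set ε : ℝ := V⁻¹ + M / J.card with hε
  have hε0 : 0 ≤ ε := by positivity
  have hθm : ∀ i ∈ J, MemLp (fun ω => θ (S i) ω - h₀) 2 P := fun i hi =>
    h.memLp_sub_const (hSne i hi)
  set u : Ω → ℝ := fun ω => ∑ i ∈ J, q * (θ (S i) ω - h₀) with hu
  set v : Ω → ℝ := fun ω => ∑ i ∈ J, q * (S i).card * (θ (S i) ω - h₀) with hv
  set n : ℝ := q * ∑ i ∈ J, ((S i).card : ℝ) with hn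
  have hum : MemLp u 2 P := memLp_finsetSum J fun i hi => (hθm i hi).const_mul q
  have hvm : MemLp v 2 P := memLp_finsetSum J fun i hi => (hθm i hi).const_mul _
  have hn0 : 0 ≤ n := mul_nonneg hq0.le (Finset.sum_nonneg fun _ _ => Nat.cast_nonneg _)
  have hn2 : n ≤ c₂ * V := by
    calc n ≤ q * ∑ _i ∈ J, c₂ * V := by rw [hn]; gcongr with i hi; exact hS2 i hi
      _ = c₂ * V := by rw [Finset.sum_const, nsmul_eq_mul, hq]; field_simp
  have hVG : V * (B * (M / (J.card * (c₁ * V))) + C / (c₁ * V) ^ 2) ≤ G * ε := by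
    have e : V * (B * (M / (J.card * (c₁ * V))) + C / (c₁ * V) ^ 2) =
        B / c₁ * (M / J.card) + C / c₁ ^ 2 * V⁻¹ := by field_simp
    rw [e, hG, hε]
    have h1 : 0 ≤ B / c₁ * V⁻¹ := by positivity
    have h2 : 0 ≤ C / c₁ ^ 2 * (M / J.card) := by positivity
    nlinarith
  have hu2 : V * ∫ ω, u ω ^ 2 ∂P ≤ 2 * (G * ε) := by
    have := h.integral_weighted_sq_le hJ hV hc₁ hS1 hM0 hM (A := 1) zero_le_one (w := fun _ => q)
      (fun _ _ => hq0.le) (fun _ _ => by rw [one_mul])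
    calc _ ≤ V * _ := mul_le_mul_of_nonneg_left this hV.le
      _ = 2 * (V * (B * (M / (J.card * (c₁ * V))) + C / (c₁ * V) ^ 2)) := by ring
      _ ≤ _ := by linarith
  have hv2 : V⁻¹ * ∫ ω, v ω ^ 2 ∂P ≤ 2 * c₂ ^ 2 * (G * ε) := by
    have := h.integral_weighted_sq_le hJ hV hc₁ hS1 hM0 hM (A := c₂ * V) (by positivity)
      (w := fun i => q * (S i).card) (fun i _ => by positivity) (fun i hi => by
        rw [mul_comm]; exact mul_le_mul_of_nonneg_right (hS2 i hi) hq0.le)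
    calc _ ≤ V⁻¹ * _ := mul_le_mul_of_nonneg_left this (inv_nonneg.2 hV.le)
      _ = 2 * c₂ ^ 2 * (V * (B * (M / (J.card * (c₁ * V))) + C / (c₁ * V) ^ 2)) := by
          field_simp
      _ ≤ _ := mul_le_mul_of_nonneg_left hVG (by positivity)
  -- The second moment about `h₀` exceeds the variance by the squared mean of the remainder, as the
  -- linear part is centred; times the block size this is `O(V⁻¹)`.
  have hE : ∀ i ∈ J, |(S i).card * (∫ ω, (θ (S i) ω - h₀) ^ 2 ∂P) - τ| ≤ η + C / c₁ * ε := by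
    intro i hi
    have h1 := hη i hi
    rw [h.variance_eq (hSne i hi)] at h1
    have h2 := (h.integral_rem_sq_le (hSne i hi)).trans (h.rem_sq_le _ (hSne i hi))
    have h3 : (S i).card * (∫ ω, (θ (S i) ω - h₀ - siteMean Y (S i) ω) ∂P) ^ 2 ≤ C / c₁ * ε := by
      calc _ ≤ (S i).card * (C * (((S i).card : ℝ)⁻¹) ^ 2) := by gcongr
        _ = C * ((S i).card : ℝ)⁻¹ := by
            have := (hN0 i hi).ne'
            field_simp
        _ ≤ C * (c₁ * V)⁻¹ := by
            have := hS1 i hi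
            gcongr
        _ = C / c₁ * V⁻¹ := by field_simp
        _ ≤ _ := by
            gcongr
            rw [hε]
            linarith [div_nonneg hM0 hJ0.le]
    have h4 : 0 ≤ (S i).card * (∫ ω, (θ (S i) ω - h₀ - siteMean Y (S i) ω) ∂P) ^ 2 := by positivity
    rw [mul_sub] at h1
    rw [abs_le] at h1 ⊢
    constructor <;> linarith
  -- Expanding the square around `h₀` isolates the effect of centring by the average. The
  -- size-weighted mean `v` appears because blocks may have different numbers of sites.
  have e : ∀ ω, q * ∑ i ∈ J, ((S i).card : ℝ) * (θ (S i) ω - q * ∑ j ∈ J, θ (S j) ω) ^ 2 =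
      q * (∑ i ∈ J, (S i).card * (θ (S i) ω - h₀) ^ 2) - 2 * (u ω * v ω) + n * u ω ^ 2 := by
    intro ω
    have e1 : q * ∑ j ∈ J, θ (S j) ω = u ω + h₀ := by
      have e0 : u ω = q * (∑ j ∈ J, θ (S j) ω - J.card * h₀) := by
        rw [← nsmul_eq_mul, ← Finset.sum_const, ← Finset.sum_sub_distrib, Finset.mul_sum]
      rw [e0, mul_sub, ← mul_assoc, inv_mul_cancel₀ hJ0.ne']
      ring
    have e2 : v ω = q * ∑ i ∈ J, (S i).card * (θ (S i) ω - h₀) := by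
      simp only [hv, Finset.mul_sum, mul_assoc]
    rw [e1, e2, hn]
    have e3 : ∀ i ∈ J, ((S i).card : ℝ) * (θ (S i) ω - (u ω + h₀)) ^ 2 =
        (S i).card * (θ (S i) ω - h₀) ^ 2 - 2 * u ω * ((S i).card * (θ (S i) ω - h₀)) +
          u ω ^ 2 * (S i).card := fun i _ => by ring
    rw [Finset.sum_congr rfl e3, Finset.sum_add_distrib, Finset.sum_sub_distrib,
      ← Finset.mul_sum, ← Finset.mul_sum]
    ring
  have i1 : ∀ i ∈ J, Integrable (fun ω => ((S i).card : ℝ) * (θ (S i) ω - h₀) ^ 2) P :=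
    fun i hi => (hθm i hi).integrable_sq.const_mul _
  have i2 : Integrable (fun ω => u ω * v ω) P := hum.integrable_mul hvm
  have i3 : Integrable (fun ω => q * ∑ i ∈ J, ((S i).card : ℝ) * (θ (S i) ω - h₀) ^ 2) P :=
    (integrable_finsetSum J i1).const_mul q
  simp only [e]
  have i4 : Integrable (fun ω => q * (∑ i ∈ J, ((S i).card : ℝ) * (θ (S i) ω - h₀) ^ 2) -
      2 * (u ω * v ω)) P := i3.sub (i2.const_mul 2)
  rw [integral_add i4 (hum.integrable_sq.const_mul n),
    integral_sub i3 (i2.const_mul 2), integral_const_mul, integral_const_mul, integral_const_mul,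
    integral_finsetSum J i1]
  simp only [integral_const_mul]
  have h1 : |q * (∑ i ∈ J, ((S i).card : ℝ) * ∫ ω, (θ (S i) ω - h₀) ^ 2 ∂P) - τ| ≤
      η + C / c₁ * ε := by
    have e4 : q * (∑ i ∈ J, ((S i).card : ℝ) * ∫ ω, (θ (S i) ω - h₀) ^ 2 ∂P) - τ =
        q * ∑ i ∈ J, (((S i).card : ℝ) * (∫ ω, (θ (S i) ω - h₀) ^ 2 ∂P) - τ) := by
      rw [Finset.sum_sub_distrib, Finset.sum_const, nsmul_eq_mul, hq]
      field_simp
    rw [e4, abs_mul, abs_of_pos hq0]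
    calc _ ≤ q * ∑ _i ∈ J, (η + C / c₁ * ε) := by
          gcongr
          exact (Finset.abs_sum_le_sum_abs _ _).trans (Finset.sum_le_sum hE)
      _ = _ := by rw [Finset.sum_const, nsmul_eq_mul, hq]; field_simp
  -- The weight `V` reflects that `v` is of the order of `V * u`.
  have h2 := abs_integral_mul_le_of_sq hum hvm hV
  have h3 : 0 ≤ ∫ ω, u ω ^ 2 ∂P := integral_nonneg fun ω => sq_nonneg _
  have h4 : n * ∫ ω, u ω ^ 2 ∂P ≤ 2 * c₂ * (G * ε) := by
    calc _ ≤ c₂ * V * ∫ ω, u ω ^ 2 ∂P := by gcongr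
      _ = c₂ * (V * ∫ ω, u ω ^ 2 ∂P) := by ring
      _ ≤ c₂ * (2 * (G * ε)) := by gcongr
      _ = _ := by ring
  have h5 : 0 ≤ n * ∫ ω, u ω ^ 2 ∂P := mul_nonneg hn0 h3
  rw [abs_le] at h1 h2 ⊢
  have e5 : η + (C / c₁ + (4 + 4 * c₂ ^ 2 + 2 * c₂) * G) * ε =
      η + C / c₁ * ε + 2 * (2 * (G * ε) + 2 * c₂ ^ 2 * (G * ε)) + 2 * c₂ * (G * ε) := by ring
  rw [e5]
  constructor <;> linarith [h1.1, h1.2, h2.1, h2.2, mul_nonneg hc₂ (mul_nonneg hG0 hε0)]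

end IsAsymptoticallyLinear

/-! ### Sites in scaled regions -/

section Geometry

variable {d : ℕ}

lemma mem_scaleSet {l : Fin d → ℝ} (hl : ∀ i, 0 < l i) {A : Set (Fin d → ℝ)} {x : Fin d → ℝ} :
    x ∈ scaleSet l A ↔ (fun i => x i / l i) ∈ A := by
  constructor
  · rintro ⟨y, hy, rfl⟩
    convert hy using 2 with i
    exact mul_div_cancel_left₀ _ (hl _).ne'
  · intro h
    exact ⟨_, h, funext fun i => mul_div_cancel₀ _ (hl i).ne'⟩

lemma mem_shiftSet {i : Fin d → ℤ} {A : Set (Fin d → ℝ)} {x : Fin d → ℝ} :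
    x ∈ shiftSet i A ↔ (fun j => x j - i j) ∈ A := by
  constructor
  · rintro ⟨y, hy, rfl⟩
    convert hy using 2 with j
    ring
  · intro h
    exact ⟨_, h, funext fun j => by ring⟩

lemma mem_sites_scaleSet {l : Fin d → ℝ} (hl : ∀ i, 0 < l i) {A : Set (Fin d → ℝ)}
    {t : Fin d → ℝ} {k : Fin d → ℤ} :
    k ∈ sites t (scaleSet l A) ↔ (fun i => (t i + k i) / l i) ∈ A := mem_scaleSet hl

/-- Translating a region amounts to moving the lattice the other way. All subsamples thus become one
scaled template seen from different lattice positions, and bounds uniform in `t` apply to every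
block. -/
lemma sites_shiftSet (t : Fin d → ℝ) (i : Fin d → ℤ) (A : Set (Fin d → ℝ)) :
    sites t (shiftSet i A) = sites (fun j => t j - i j) A := by
  ext k
  simp only [sites, Set.mem_ofPred_eq, mem_shiftSet]
  rw [show (fun j => t j + (k j : ℝ) - i j) = fun j => t j - i j + k j from
    funext fun j => by ring]

lemma mem_sites_sub_iff (t : Fin d → ℝ) (i k : Fin d → ℤ) (A : Set (Fin d → ℝ)) :
    k ∈ sites (fun j => t j - i j) A ↔ k - i ∈ sites t A := by
  simp only [sites, Set.mem_ofPred_eq, Pi.sub_apply, Int.cast_sub]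
  rw [show (fun j => t j - i j + (k j : ℝ)) = fun j => t j + ((k j : ℝ) - i j) from
    funext fun j => by ring]

lemma sites_scaleSet_shiftSet {l : Fin d → ℝ} (hl : ∀ i, 0 < l i) (t : Fin d → ℝ)
    (i : Fin d → ℤ) (A : Set (Fin d → ℝ)) :
    sites t (scaleSet l (shiftSet i A)) = sites (fun j => t j - l j * i j) (scaleSet l A) := by
  ext k
  rw [mem_sites_scaleSet hl, mem_sites_scaleSet hl, mem_shiftSet]
  rw [show (fun j => (t j + (k j : ℝ)) / l j - i j) = fun j => (t j - l j * i j + k j) / l j from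
    funext fun j => by have := (hl j).ne'; field_simp; ring]

/-- The integer points of the box with corners `lo` and `hi`. -/
noncomputable def realBox (lo hi : Fin d → ℝ) : Finset (Fin d → ℤ) :=
  Fintype.piFinset fun i => Finset.Icc ⌈lo i⌉ ⌊hi i⌋

lemma mem_realBox {lo hi : Fin d → ℝ} {k : Fin d → ℤ} :
    k ∈ realBox lo hi ↔ ∀ i, lo i ≤ k i ∧ (k i : ℝ) ≤ hi i := by
  simp [realBox, Fintype.mem_piFinset, Int.ceil_le, Int.le_floor]

lemma card_realBox (lo hi : Fin d → ℝ) :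
    ((realBox lo hi).card : ℝ) = ∏ i, (((⌊hi i⌋ + 1 - ⌈lo i⌉).toNat : ℕ) : ℝ) := by
  simp [realBox, Fintype.card_piFinset]

lemma card_realBox_le {lo hi : Fin d → ℝ} (h : ∀ i, lo i ≤ hi i + 1) :
    ((realBox lo hi).card : ℝ) ≤ ∏ i, (hi i - lo i + 1) := by
  rw [card_realBox]
  refine Finset.prod_le_prod (fun _ _ => Nat.cast_nonneg _) fun i _ => ?_
  have h1 : (((⌊hi i⌋ + 1 - ⌈lo i⌉).toNat : ℕ) : ℝ) = ((max (⌊hi i⌋ + 1 - ⌈lo i⌉) 0 : ℤ) : ℝ) := by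
    rw [← Int.toNat_eq_max, Int.cast_natCast]
  rw [h1]
  push_cast
  have h2 := Int.floor_le (hi i)
  have h3 := Int.le_ceil (lo i)
  exact max_le (by linarith) (by linarith [h i])

lemma prod_le_card_realBox {lo hi : Fin d → ℝ} {w : Fin d → ℝ} (hw : ∀ i, 0 ≤ w i)
    (h : ∀ i, w i ≤ hi i - lo i - 1) : ∏ i, w i ≤ ((realBox lo hi).card : ℝ) := by
  rw [card_realBox]
  refine Finset.prod_le_prod (fun i _ => hw i) fun i _ => ?_
  have h1 : ((⌊hi i⌋ + 1 - ⌈lo i⌉ : ℤ) : ℝ) ≤ (((⌊hi i⌋ + 1 - ⌈lo i⌉).toNat : ℕ) : ℝ) := by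
    exact_mod_cast Int.self_le_toNat _
  refine le_trans ?_ h1
  push_cast
  linarith [h i, (Int.lt_floor_add_one (hi i)), (Int.ceil_lt_add_one (lo i))]

/-- The elements of a set as a finset, empty if the set is infinite. -/
noncomputable def toFinsetOrEmpty {α : Type*} (s : Set α) : Finset α :=
  open Classical in if h : s.Finite then h.toFinset else ∅

lemma mem_toFinsetOrEmpty {α : Type*} {s : Set α} (h : s.Finite) {a : α} :
    a ∈ toFinsetOrEmpty s ↔ a ∈ s := by
  simp [toFinsetOrEmpty, h]

lemma ncard_eq_card_toFinsetOrEmpty {α : Type*} (s : Set α) :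
    s.ncard = (toFinsetOrEmpty s).card := by
  by_cases h : s.Finite
  · simp [toFinsetOrEmpty, h, Set.ncard_eq_toFinset_card s h]
  · simp [toFinsetOrEmpty, h, Set.Infinite.ncard h]

/-- No finiteness is needed: for infinite `J` the factor `ncard` is `0` on one side and the finset
is empty on the other. -/
lemma finAverage_eq {ι E : Type*} [AddCommGroup E] [Module ℝ E] (J : Set ι) (f : ι → E) :
    finAverage J f = ((toFinsetOrEmpty J).card : ℝ)⁻¹ • ∑ i ∈ toFinsetOrEmpty J, f i := by
  rw [finAverage, ncard_eq_card_toFinsetOrEmpty]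
  by_cases h : J.Finite
  · rw [finsum_mem_eq_finite_toFinset_sum _ h]
    simp [toFinsetOrEmpty, h]
  · simp [toFinsetOrEmpty, h]

/-- The finite set of sites of the lattice in the region `A`. -/
noncomputable def siteFinset (t : Fin d → ℝ) (A : Set (Fin d → ℝ)) : Finset (Fin d → ℤ) :=
  toFinsetOrEmpty (sites t A)

lemma siteCount_eq (t : Fin d → ℝ) (A : Set (Fin d → ℝ)) :
    siteCount t A = (siteFinset t A).card := ncard_eq_card_toFinsetOrEmpty _

lemma thetaHat_eq {p : ℕ} {Ω : Type*} [MeasurableSpace Ω] (t : Fin d → ℝ)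
    (Z : (Fin d → ℤ) → Ω → EuclideanSpace ℝ (Fin p)) (H : EuclideanSpace ℝ (Fin p) → ℝ)
    (A : Set (Fin d → ℝ)) (ω : Ω) :
    thetaHat t Z H A ω = H (siteMean Z (siteFinset t A) ω) := by
  rw [thetaHat, finAverage_eq]; rfl

lemma siteFinset_shiftSet (t : Fin d → ℝ) (i : Fin d → ℤ) (A : Set (Fin d → ℝ)) :
    siteFinset t (shiftSet i A) = siteFinset (fun j => t j - i j) A := by
  rw [siteFinset, sites_shiftSet, siteFinset]

lemma siteFinset_scaleSet_shiftSet {l : Fin d → ℝ} (hl : ∀ i, 0 < l i) (t : Fin d → ℝ)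
    (i : Fin d → ℤ) (A : Set (Fin d → ℝ)) : siteFinset t (scaleSet l (shiftSet i A)) =
      siteFinset (fun j => t j - l j * i j) (scaleSet l A) := by
  rw [siteFinset, sites_scaleSet_shiftSet hl, siteFinset]

variable {R₀ : Set (Fin d → ℝ)}

lemma IsTemplate.abs_apply_le (hR₀ : IsTemplate R₀) {x : Fin d → ℝ} (hx : x ∈ R₀) (i : Fin d) :
    |x i| ≤ 1 / 2 := by
  have := hR₀.subset_unitCube hx i
  rw [abs_le]; constructor <;> linarith

lemma IsTemplate.exists_box (hR₀ : IsTemplate R₀) :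
    ∃ ε : ℝ, 0 < ε ∧ ∀ x : Fin d → ℝ, (∀ i, |x i| ≤ ε) → x ∈ R₀ := by
  obtain ⟨ε, hε, h⟩ := Metric.nhds_basis_closedBall.mem_iff.1 hR₀.nhds_origin
  refine ⟨ε, hε, fun x hx => h ?_⟩
  rw [mem_closedBall_zero_iff, pi_norm_le_iff_of_nonneg hε.le]
  exact hx

lemma IsTemplate.sites_subset (hR₀ : IsTemplate R₀) {l : Fin d → ℝ} (hl : ∀ i, 0 < l i)
    (t : Fin d → ℝ) : sites t (scaleSet l R₀) ⊆
      (realBox (fun i => -t i - l i / 2) (fun i => -t i + l i / 2) : Set (Fin d → ℤ)) := by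
  intro k hk
  rw [mem_sites_scaleSet hl] at hk
  rw [Finset.mem_coe, mem_realBox]
  intro i
  have := hR₀.abs_apply_le hk i
  rw [abs_div, abs_of_pos (hl i), div_le_iff₀ (hl i), abs_le] at this
  constructor <;> linarith [this.1, this.2]

lemma IsTemplate.finite_sites (hR₀ : IsTemplate R₀) {l : Fin d → ℝ} (hl : ∀ i, 0 < l i)
    (t : Fin d → ℝ) : (sites t (scaleSet l R₀)).Finite :=
  (Finset.finite_toSet _).subset (hR₀.sites_subset hl t)

lemma IsTemplate.mem_siteFinset (hR₀ : IsTemplate R₀) {l : Fin d → ℝ} (hl : ∀ i, 0 < l i)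
    {t : Fin d → ℝ} {k : Fin d → ℤ} :
    k ∈ siteFinset t (scaleSet l R₀) ↔ (fun i => (t i + k i) / l i) ∈ R₀ := by
  rw [siteFinset, mem_toFinsetOrEmpty (hR₀.finite_sites hl t), mem_sites_scaleSet hl]

/-- The number of sites in a scaled template is comparable to the determinant of the scaling,
uniformly in the position of the lattice. -/
lemma IsTemplate.exists_card_siteFinset (hR₀ : IsTemplate R₀) :
    ∃ c Λ : ℝ, 0 < c ∧ 1 ≤ Λ ∧ ∀ l : Fin d → ℝ, (∀ i, Λ ≤ l i) → ∀ t : Fin d → ℝ,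
      c * ∏ i, l i ≤ (siteFinset t (scaleSet l R₀)).card ∧
      ((siteFinset t (scaleSet l R₀)).card : ℝ) ≤ 2 ^ d * ∏ i, l i := by
  obtain ⟨ε, hε, hbox⟩ := hR₀.exists_box
  -- `1 / ε ≤ l i` ensures that an interval of length `2 * ε * l i` contains at least `ε * l i`
  -- integers; `1 ≤ l i` turns the upper count `l i + 1` into `2 * l i`.
  refine ⟨ε ^ d, max 1 (1 / ε), by positivity, le_max_left _ _, fun l hl t => ?_⟩
  have hl1 : ∀ i, 1 ≤ l i := fun i => (le_max_left _ _).trans (hl i)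
  have hl0 : ∀ i, 0 < l i := fun i => zero_lt_one.trans_le (hl1 i)
  have hεl : ∀ i, 1 ≤ ε * l i := fun i => by
    have := (le_max_right 1 (1 / ε)).trans (hl i)
    rw [div_le_iff₀ hε] at this
    linarith
  constructor
  · have hsub : realBox (fun i => -t i - ε * l i) (fun i => -t i + ε * l i) ⊆
        siteFinset t (scaleSet l R₀) := by
      intro k hk
      rw [mem_realBox] at hk
      rw [hR₀.mem_siteFinset hl0]
      refine hbox _ fun i => ?_
      rw [abs_div, abs_of_pos (hl0 i), div_le_iff₀ (hl0 i), abs_le]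
      constructor <;> linarith [hk i]
    calc ε ^ d * ∏ i, l i = ∏ i, ε * l i := by
          rw [Finset.prod_mul_distrib]; simp
      _ ≤ ((realBox (fun i => -t i - ε * l i) (fun i => -t i + ε * l i)).card : ℝ) :=
          prod_le_card_realBox (fun i => by linarith [hεl i]) fun i => by linarith [hεl i]
      _ ≤ _ := by exact_mod_cast Finset.card_le_card hsub
  · have hsub : siteFinset t (scaleSet l R₀) ⊆
        realBox (fun i => -t i - l i / 2) (fun i => -t i + l i / 2) := by
      intro k hk
      rw [siteFinset, mem_toFinsetOrEmpty (hR₀.finite_sites hl0 t)] at hk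
      exact hR₀.sites_subset hl0 t hk
    calc ((siteFinset t (scaleSet l R₀)).card : ℝ)
        ≤ ((realBox (fun i => -t i - l i / 2) (fun i => -t i + l i / 2)).card : ℝ) := by
          exact_mod_cast Finset.card_le_card hsub
      _ ≤ ∏ i, ((-t i + l i / 2) - (-t i - l i / 2) + 1) :=
          card_realBox_le fun i => by linarith [hl0 i]
      _ ≤ ∏ i, 2 * l i := Finset.prod_le_prod (fun i _ => by linarith [hl0 i])
          fun i _ => by linarith [hl1 i]
      _ = _ := by rw [Finset.prod_mul_distrib]; simp

/-- Finiteness gives the boundary condition its content, since `ncard` of an infinite set is `0`.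
The cubes in question meet the closure of `R₀`, which is bounded. -/
lemma IsTemplate.finite_boundaryCubes (hR₀ : IsTemplate R₀) {a : ℝ} (ha : 0 < a) :
    {k : Fin d → ℤ | (latticeCube a k ∩ closure R₀).Nonempty ∧
      (latticeCube a k ∩ closure R₀ᶜ).Nonempty}.Finite := by
  refine (Finset.finite_toSet (realBox (fun _ => -(1 / 2) / a - 1) fun _ => 1 / 2 / a)).subset ?_
  rintro k ⟨⟨x, hx, hxR⟩, -⟩
  rw [Finset.mem_coe, mem_realBox]
  have hcl : closure R₀ ⊆ {x | ∀ i, |x i| ≤ 1 / 2} := by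
    refine closure_minimal (fun x hx => hR₀.abs_apply_le hx) ?_
    simp only [Set.ofPred_forall]
    exact isClosed_iInter fun i => isClosed_le (continuous_apply i).abs continuous_const
  intro i
  have h1 := abs_le.1 (hcl hxR i)
  have h2 := hx i
  rw [sub_le_iff_le_add, div_le_iff₀ ha, le_div_iff₀ ha]
  constructor <;> nlinarith [h1.1, h1.2, h2.1, h2.2]

/-- If a step of length at most one leaves the scaled template, it crosses one of the boundary
cubes. -/
lemma IsTemplate.card_leaving_step_le (hR₀ : IsTemplate R₀) {l : Fin d → ℝ} (hl : ∀ i, 0 < l i)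
    (t : Fin d → ℝ) {a K : ℝ} (ha : 0 < a) (hK : ∀ i, l i * a ≤ K) {u : Fin d → ℤ}
    (hu : supNorm u ≤ 1) :
    (((siteFinset t (scaleSet l R₀)).filter fun k =>
      k + u ∉ siteFinset t (scaleSet l R₀)).card : ℝ) ≤ (K + 3) ^ d * boundaryCubeCount R₀ a := by
  set S := siteFinset t (scaleSet l R₀) with hS
  have hu1 : ∀ i, |(u i : ℝ)| ≤ 1 := fun i => by
    have := supNorm_le_iff.1 hu i
    rw [← Int.cast_abs, Int.abs_eq_natAbs]
    exact_mod_cast this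
  have key : ∀ k ∈ S.filter fun k => k + u ∉ S, ∃ κ : Fin d → ℤ,
      ((latticeCube a κ ∩ closure R₀).Nonempty ∧ (latticeCube a κ ∩ closure R₀ᶜ).Nonempty) ∧
      ∀ i, l i * a * κ i - t i - 1 ≤ k i ∧ (k i : ℝ) ≤ l i * a * κ i - t i + (K + 1) := by
    intro k hk
    obtain ⟨hk1, hk2⟩ := Finset.mem_filter.1 hk
    rw [hS, hR₀.mem_siteFinset hl] at hk1 hk2
    set y : Fin d → ℝ := fun i => (t i + k i) / l i with hy
    set y' : Fin d → ℝ := fun i => (t i + ((k + u) i : ℤ)) / l i with hy'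
    -- The rescaled segment from `k` to `k + u` is connected and covered by the closures of `R₀` and
    -- its complement, and meets both; hence they share a point `z` of it. The mesh cube around `z`
    -- is a boundary cube.
    obtain ⟨z, hz, hzf⟩ := isPreconnected_closed_iff.1 (convex_segment y y').isPreconnected
      (closure R₀) (closure R₀ᶜ) isClosed_closure isClosed_closure
      (fun w _ => (em (w ∈ R₀)).imp (fun h => subset_closure h) fun h => subset_closure h)
      ⟨y, left_mem_segment ℝ y y', subset_closure hk1⟩
      ⟨y', right_mem_segment ℝ y y', subset_closure hk2⟩
    have hzc : z ∈ latticeCube a (fun i => ⌊z i / a⌋) := fun i => by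
      have h1 := Int.floor_le (z i / a)
      have h2 := (Int.lt_floor_add_one (z i / a)).le
      rw [le_div_iff₀ ha] at h1
      rw [div_le_iff₀ ha] at h2
      constructor <;> linarith
    refine ⟨fun i => ⌊z i / a⌋, ⟨⟨z, hzc, hzf.1⟩, ⟨z, hzc, hzf.2⟩⟩, fun i => ?_⟩
    obtain ⟨θ, hθ, rfl⟩ := (segment_eq_image ℝ y y' ▸ hz :)
    have hzi : l i * ((1 - θ) • y + θ • y') i = t i + k i + θ * u i := by
      simp only [hy, hy', Pi.add_apply, Pi.smul_apply, smul_eq_mul, Int.cast_add]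
      have := (hl i).ne'
      field_simp
      ring
    have h1 := hzc i
    set zi := ((1 - θ) • y + θ • y') i
    have h2 : l i * (a * ⌊zi / a⌋) ≤ l i * zi := mul_le_mul_of_nonneg_left h1.1 (hl i).le
    have h3 : l i * zi ≤ l i * (a * (⌊zi / a⌋ + 1)) := mul_le_mul_of_nonneg_left h1.2 (hl i).le
    have h4 : |θ * u i| ≤ 1 := by
      rw [abs_mul]
      exact mul_le_one₀ (by rw [abs_le]; constructor <;> linarith [hθ.1, hθ.2]) (abs_nonneg _)
        (hu1 i)
    rw [abs_le] at h4
    have h5 := hK i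
    constructor
    · linarith [h4.1, h4.2]
    · linarith [h4.1, h4.2]
  choose! κ hκ1 hκ2 using key
  have hfin := hR₀.finite_boundaryCubes ha
  -- The sites assigned to one cube lie in a box with sides of length `K + 2`, which holds at most
  -- `(K + 3) ^ d` integer points.
  have hcard := Finset.card_le_mul_card_image_of_maps_to (f := κ)
    (s := S.filter fun k => k + u ∉ S) (t := hfin.toFinset)
    (fun k hk => hfin.mem_toFinset.2 (hκ1 k hk)) ⌊(K + 3) ^ d⌋₊ fun c _ => by
      refine Nat.le_floor ?_
      have hsub : (S.filter fun k => k + u ∉ S).filter (fun k => κ k = c) ⊆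
          realBox (fun i => l i * a * c i - t i - 1) fun i => l i * a * c i - t i + (K + 1) := by
        intro k hk
        obtain ⟨hk1, rfl⟩ := Finset.mem_filter.1 hk
        exact mem_realBox.2 (hκ2 k hk1)
      have hK0 : ∀ i, 0 ≤ K := fun i => (mul_pos (hl i) ha).le.trans (hK i)
      calc _ ≤ ((realBox (fun i => l i * a * c i - t i - 1)
            fun i => l i * a * c i - t i + (K + 1)).card : ℝ) := by
            exact_mod_cast Finset.card_le_card hsub
        _ ≤ ∏ i : Fin d, ((l i * a * c i - t i + (K + 1)) - (l i * a * c i - t i - 1) + 1) :=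
            card_realBox_le fun i => by linarith [hK0 i]
        _ = ∏ _i : Fin d, (K + 3) := Finset.prod_congr rfl fun i _ => by ring
        _ = _ := by simp
  have hcount : boundaryCubeCount R₀ a = hfin.toFinset.card := by
    rw [boundaryCubeCount, Set.ncard_eq_toFinset_card _ hfin]
  have hK3 : 0 ≤ (K + 3) ^ d := by
    rcases Nat.eq_zero_or_pos d with rfl | hd
    · simp
    · have := (mul_pos (hl ⟨0, hd⟩) ha).le.trans (hK ⟨0, hd⟩)
      positivity
  rw [hcount]
  calc _ ≤ ((⌊(K + 3) ^ d⌋₊ * hfin.toFinset.card : ℕ) : ℝ) := by exact_mod_cast hcard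
    _ ≤ _ := by
        push_cast
        gcongr
        exact Nat.floor_le hK3

/-- A jump by `v` decomposes into at most `n` steps of norm at most one, the first being the vector
of signs of `v`. A site that leaves `S` under the jump leaves it at one of the steps, and each step
accounts for at most `b` sites. -/
lemma card_leaving_le {S : Finset (Fin d → ℤ)} {b : ℝ}
    (hb : ∀ u, supNorm u ≤ 1 → ((S.filter fun k => k + u ∉ S).card : ℝ) ≤ b) (n : ℕ) :
    ∀ v, supNorm v ≤ n → ((S.filter fun k => k + v ∉ S).card : ℝ) ≤ b * n := by
  induction n with
  | zero =>
    intro v hv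
    have : v = 0 := by
      ext i
      have := supNorm_le_iff.1 hv i
      simp only [Pi.zero_apply]
      omega
    subst this
    simp
  | succ n ih =>
    intro v hv
    set u : Fin d → ℤ := fun i => (v i).sign with hu
    have hu1 : supNorm u ≤ 1 := supNorm_le_iff.2 fun i => by
      simp only [hu, Int.natAbs_sign]
      split_ifs <;> simp
    have hvu : supNorm (v - u) ≤ n := supNorm_le_iff.2 fun i => by
      have h1 := supNorm_le_iff.1 hv i
      simp only [hu, Pi.sub_apply]
      rcases lt_trichotomy (v i) 0 with h | h | h
      · rw [Int.sign_eq_neg_one_of_neg h]; omega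
      · rw [h]; simp
      · rw [Int.sign_eq_one_of_pos h]; omega
    have hsub : (S.filter fun k => k + v ∉ S) ⊆ (S.filter fun k => k + u ∉ S) ∪
        ((S.filter fun k => k + (v - u) ∉ S).image fun k => k - u) := by
      intro k hk
      obtain ⟨h1, h2⟩ := Finset.mem_filter.1 hk
      rw [Finset.mem_union]
      by_cases h3 : k + u ∈ S
      · right
        refine Finset.mem_image.2 ⟨k + u, Finset.mem_filter.2 ⟨h3, ?_⟩, by simp⟩
        rwa [add_assoc, add_sub_cancel]
      · exact Or.inl (Finset.mem_filter.2 ⟨h1, h3⟩)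
    have hcard : (S.filter fun k => k + v ∉ S).card ≤ (S.filter fun k => k + u ∉ S).card +
        (S.filter fun k => k + (v - u) ∉ S).card :=
      (Finset.card_le_card hsub).trans ((Finset.card_union_le _ _).trans
        (add_le_add_right Finset.card_image_le _))
    calc ((S.filter fun k => k + v ∉ S).card : ℝ) ≤ (S.filter fun k => k + u ∉ S).card +
          (S.filter fun k => k + (v - u) ∉ S).card := by exact_mod_cast hcard
      _ ≤ b + b * n := add_le_add (hb u hu1) (ih _ hvu)
      _ = _ := by push_cast; ring

end Geometry

/-! ### Scaling sequences -/

section Scaling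

variable {d : ℕ}

/-- All entries of a sequence of vectors are of the same order. -/
def HasComparableEntries (l : ℕ → Fin d → ℝ) : Prop :=
  ∃ K : ℝ, 1 ≤ K ∧ ∀ᶠ n in atTop, ∀ i j, l n i ≤ K * l n j

/-- A nonzero determinant excludes vanishing limits, so all ratios of entries converge and are
eventually bounded. -/
lemma AssumptionA1.hasComparableEntries [NeZero d] {slam : ℕ → Fin d → ℝ}
    (h : AssumptionA1 slam) (hpos : ∀ n i, 0 < slam n i) : HasComparableEntries slam := by
  obtain ⟨l₀, hprod, hlim⟩ := h
  have hl₀ : ∀ i, l₀ i ≠ 0 := fun i => (Finset.prod_ne_zero_iff.1 hprod.ne') i (Finset.mem_univ i)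
  have hratio : ∀ i j, Tendsto (fun n => slam n i / slam n j) atTop (𝓝 (l₀ i / l₀ j)) :=
    fun i j => ((hlim i).div (hlim j) (hl₀ j)).congr fun n => by
      have := (hpos n 0).ne'
      have := (hpos n j).ne'
      simp only [Pi.div_apply]
      field_simp
  refine ⟨1 + ∑ i, ∑ j, |l₀ i / l₀ j + 1|, by
    have : 0 ≤ ∑ i, ∑ j, |l₀ i / l₀ j + 1| := by positivity
    linarith, ?_⟩
  refine eventually_all.2 fun i => eventually_all.2 fun j => ?_
  filter_upwards [(hratio i j).eventually_le_const (lt_add_one _)] with n hn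
  rw [div_le_iff₀ (hpos n j)] at hn
  refine hn.trans (mul_le_mul_of_nonneg_right ?_ (hpos n j).le)
  calc l₀ i / l₀ j + 1 ≤ |l₀ i / l₀ j + 1| := le_abs_self _
    _ ≤ ∑ j, |l₀ i / l₀ j + 1| :=
        Finset.single_le_sum (f := fun j => |l₀ i / l₀ j + 1|) (fun _ _ => abs_nonneg _)
          (Finset.mem_univ j)
    _ ≤ ∑ i, ∑ j, |l₀ i / l₀ j + 1| :=
        Finset.single_le_sum (f := fun i => ∑ j, |l₀ i / l₀ j + 1|)
          (fun _ _ => Finset.sum_nonneg fun _ _ => abs_nonneg _) (Finset.mem_univ i)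
    _ ≤ _ := by linarith

lemma AssumptionA2.hasComparableEntries [NeZero d] {lam slam : ℕ → Fin d → ℝ}
    (h : AssumptionA2 lam slam) (hpos : ∀ n i, 0 < lam n i) : HasComparableEntries lam := by
  obtain ⟨C, hC⟩ := h.2.bound
  refine ⟨max 1 C, le_max_left _ _, hC.mono fun n hn i j => ?_⟩
  have hinf : 0 ≤ ⨅ i, lam n i := Real.iInf_nonneg fun i => (hpos n i).le
  rw [Real.norm_of_nonneg hinf] at hn
  calc lam n i ≤ ⨆ i, lam n i := le_ciSup (Set.finite_range _).bddAbove i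
    _ ≤ C * ⨅ i, lam n i := (le_abs_self _).trans hn
    _ ≤ max 1 C * ⨅ i, lam n i := mul_le_mul_of_nonneg_right (le_max_right _ _) hinf
    _ ≤ max 1 C * lam n j := mul_le_mul_of_nonneg_left
        (ciInf_le (Set.finite_range _).bddBelow j) (zero_le_one.trans (le_max_left _ _))

lemma prod_ge_of_comparable [NeZero d] {l : Fin d → ℝ} (hl : ∀ i, 0 < l i) {K : ℝ} (hK : 1 ≤ K)
    (h : ∀ i j, l i ≤ K * l j) : (l 0 / K) ^ d ≤ ∏ i, l i := by
  have hK0 : 0 < K := zero_lt_one.trans_le hK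
  calc (l 0 / K) ^ d = ∏ _i : Fin d, l 0 / K := by rw [Finset.prod_const, Finset.card_fin]
    _ ≤ ∏ i, l i := Finset.prod_le_prod (fun _ _ => (div_pos (hl 0) hK0).le) fun i _ => by
        rw [div_le_iff₀ hK0, mul_comm]
        exact h 0 i

/-- Along a sequence of scalings with comparable entries, the normalized variance of an
asymptotically linear statistic approaches its limit at the rate of the inverse scaling factor,
uniformly in the position of the lattice. -/
lemma IsAsymptoticallyLinear.exists_abs_card_mul_variance_sub_le [NeZero d] {Ω : Type*}
    [MeasurableSpace Ω] {P : Measure Ω} [IsProbabilityMeasure P]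
    {θ : Finset (Fin d → ℤ) → Ω → ℝ} {h₀ : ℝ} {Y : (Fin d → ℤ) → Ω → ℝ}
    {σ : (Fin d → ℤ) → ℝ} {B C γ : ℝ} (h : IsAsymptoticallyLinear P θ h₀ Y σ B C γ)
    (hγ : 1 ≤ γ * d) {R₀ : Set (Fin d → ℝ)} (hR₀ : IsTemplate R₀) {l : ℕ → Fin d → ℝ}
    (hpos : ∀ n i, 0 < l n i) (htend : ∀ i, Tendsto (fun n => l n i) atTop atTop)
    (hcomp : HasComparableEntries l) :
    ∃ D : ℝ, 0 ≤ D ∧ ∀ᶠ n in atTop, ∀ t : Fin d → ℝ,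
      |((siteFinset t (scaleSet (l n) R₀)).card : ℝ) *
        variance (θ (siteFinset t (scaleSet (l n) R₀))) P - ∑' k, σ k| ≤ D / l n 0 := by
  obtain ⟨c, Λ, hc, hΛ, hcard⟩ := hR₀.exists_card_siteFinset
  obtain ⟨K, hK1, hK⟩ := hcomp
  have hK0 : 0 < K := zero_lt_one.trans_le hK1
  -- The mesh `1 / l n 0` corresponds to cubes of bounded size at the scale of the sites, so the
  -- boundary condition counts boundary sites up to a constant.
  obtain ⟨Cb, hCb0, hCb⟩ := (hR₀.boundary (fun n => (l n 0)⁻¹) (fun n => inv_pos.2 (hpos n 0))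
    (tendsto_inv_atTop_zero.comp (htend 0))).exists_nonneg
  have hB := h.bound_nonneg
  have hC := h.const_nonneg
  set c' := c / K ^ d with hc'
  have hc'0 : 0 < c' := by positivity
  refine ⟨c'⁻¹ * ((K + 3) ^ d * Cb * B) + 2 * C * c' ^ (-γ) + C * c'⁻¹, by positivity, ?_⟩
  filter_upwards [hK, hCb.bound, eventually_all.2 fun i => (htend i).eventually_ge_atTop Λ]
    with n hKn hbn hΛn t
  set L := l n 0 with hL
  have hL1 : 1 ≤ L := hΛ.trans (hΛn 0)
  have hL0 : 0 < L := zero_lt_one.trans_le hL1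
  set S := siteFinset t (scaleSet (l n) R₀) with hS
  have hcardL : c' * L ^ d ≤ S.card := by
    calc c' * L ^ d = c * (L / K) ^ d := by rw [hc', div_pow]; ring
      _ ≤ c * ∏ i, l n i :=
          mul_le_mul_of_nonneg_left (prod_ge_of_comparable (hpos n) hK1 hKn) hc.le
      _ ≤ S.card := (hcard (l n) hΛn t).1
  have hcL0 : 0 < c' * L ^ d := by positivity
  have hSpos : (0 : ℝ) < S.card := hcL0.trans_le hcardL
  have hSne : S.Nonempty := Finset.card_pos.1 (by exact_mod_cast hSpos)
  have hbd : (boundaryCubeCount R₀ L⁻¹ : ℝ) ≤ Cb * (L ^ d / L) := by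
    rw [Real.norm_of_nonneg (Nat.cast_nonneg _), inv_inv,
      Real.norm_of_nonneg (Real.rpow_nonneg hL0.le _), Real.rpow_sub_one hL0.ne',
      Real.rpow_natCast] at hbn
    exact hbn
  set b := (K + 3) ^ d * (Cb * (L ^ d / L)) with hb
  have hb0 : 0 ≤ b := by positivity
  have hleave := card_leaving_le (S := S) (b := b) fun u hu =>
    (hR₀.card_leaving_step_le (hpos n) t (inv_pos.2 hL0) (K := K) (fun i => by
      rw [← div_eq_mul_inv, div_le_iff₀ hL0]; exact hKn i 0) hu).trans
      (mul_le_mul_of_nonneg_left hbd (by positivity))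
  refine (h.abs_card_mul_variance_sub_le hSne hb0 fun v => hleave _ v le_rfl).trans ?_
  have hd1 : 1 ≤ d := Nat.one_le_iff_ne_zero.2 (NeZero.ne d)
  have hinv : (S.card : ℝ)⁻¹ ≤ c'⁻¹ * (L ^ d)⁻¹ := by
    rw [← mul_inv]; exact inv_anti₀ hcL0 hcardL
  have hinv' : (S.card : ℝ)⁻¹ ≤ c'⁻¹ * L⁻¹ := hinv.trans (mul_le_mul_of_nonneg_left
    (inv_anti₀ hL0 (le_self_pow₀ hL1 (by omega))) (by positivity))
  have hγ0 : 0 < γ := by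
    by_contra hneg
    have : γ * d ≤ 0 := mul_nonpos_of_nonpos_of_nonneg (not_lt.1 hneg) (Nat.cast_nonneg _)
    linarith
  -- With at least `c' * L ^ d` sites, `1 ≤ γ * d` is what makes the cross term `O(1 / L)`.
  have hrpow : (S.card : ℝ) ^ (-γ) ≤ c' ^ (-γ) * L⁻¹ := by
    calc (S.card : ℝ) ^ (-γ) ≤ (c' * L ^ d) ^ (-γ) :=
          Real.rpow_le_rpow_of_nonpos hcL0 hcardL (by linarith)
      _ = c' ^ (-γ) * L ^ (-(γ * d)) := by
          rw [Real.mul_rpow hc'0.le (by positivity), ← Real.rpow_natCast L d,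
            ← Real.rpow_mul hL0.le]
          congr 2; ring
      _ ≤ c' ^ (-γ) * L ^ (-1 : ℝ) := by
          gcongr
      _ = _ := by rw [Real.rpow_neg_one]
  have h1 : (S.card : ℝ)⁻¹ * (b * B) ≤ c'⁻¹ * ((K + 3) ^ d * Cb * B) * L⁻¹ := by
    calc (S.card : ℝ)⁻¹ * (b * B) ≤ c'⁻¹ * (L ^ d)⁻¹ * (b * B) :=
          mul_le_mul_of_nonneg_right hinv (by positivity)
      _ = _ := by rw [hb]; field_simp
  calc _ ≤ c'⁻¹ * ((K + 3) ^ d * Cb * B) * L⁻¹ + 2 * C * (c' ^ (-γ) * L⁻¹) +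
        C * (c'⁻¹ * L⁻¹) := by gcongr
    _ = _ := by rw [div_eq_mul_inv]; ring

end Scaling

/-! ### The two families of subsampling regions -/

section Blocks

variable {d : ℕ} {R₀ : Set (Fin d → ℝ)}

lemma IsTemplate.zero_mem (hR₀ : IsTemplate R₀) : (0 : Fin d → ℝ) ∈ R₀ :=
  mem_of_mem_nhds hR₀.nhds_origin

lemma IsTemplate.finite_JOL (hR₀ : IsTemplate R₀) {l : Fin d → ℝ} (hl : ∀ i, 0 < l i)
    (s : Fin d → ℝ) : (JOL R₀ l s).Finite := by
  refine (hR₀.finite_sites hl 0).subset fun i hi => ?_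
  have h0 : (fun j => (i j : ℝ) + 0) ∈ shiftSet i (scaleSet s R₀) :=
    ⟨fun _ => 0, ⟨0, hR₀.zero_mem, funext fun _ => by simp⟩, rfl⟩
  have := hi h0
  simp only [add_zero] at this
  simpa [sites] using this

lemma IsTemplate.finite_JNOL (hR₀ : IsTemplate R₀) {l s : Fin d → ℝ} (hl : ∀ i, 0 < l i)
    (hs : ∀ i, 0 < s i) : (JNOL R₀ l s).Finite := by
  refine (Finset.finite_toSet (realBox (fun i => -(l i / 2) / s i)
    fun i => l i / 2 / s i)).subset fun i hi => ?_
  have h0 : (fun j => s j * (i j : ℝ)) ∈ scaleSet s (shiftSet i (unitCube d)) :=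
    ⟨fun j => i j, ⟨0, fun _ => by norm_num, funext fun _ => by simp⟩, rfl⟩
  have h1 := (mem_scaleSet hl).1 (hi h0)
  rw [Finset.mem_coe, mem_realBox]
  intro j
  have h2 := hR₀.abs_apply_le h1 j
  rw [abs_div, abs_of_pos (hl j), div_le_iff₀ (hl j), abs_le] at h2
  rw [div_le_iff₀ (hs j), le_div_iff₀ (hs j)]
  constructor <;> linarith [h2.1, h2.2]

/-- Lower bounds for the numbers of overlapping and nonoverlapping subsampling regions. -/
lemma IsTemplate.exists_card_J (hR₀ : IsTemplate R₀) :
    ∃ c ε : ℝ, 0 < c ∧ 0 < ε ∧ ∀ l s : Fin d → ℝ, (∀ i, 0 < s i) →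
      (∀ i, ε⁻¹ ≤ l i) → (∀ i, s i / l i ≤ ε) →
      c * ∏ i, l i ≤ (toFinsetOrEmpty (JOL R₀ l s)).card ∧
      c * ∏ i, l i / s i ≤ (toFinsetOrEmpty (JNOL R₀ l s)).card := by
  obtain ⟨ε, hε, hbox⟩ := hR₀.exists_box
  -- Half of the inner box of `R₀` accommodates the index of a block, the other half the extent of
  -- the block around it.
  refine ⟨(ε / 2) ^ d, ε / 2, by positivity, by positivity, fun l s hs hl hsl => ?_⟩
  have hl0 : ∀ i, 0 < l i := fun i => (by positivity : 0 < (ε / 2)⁻¹).trans_le (hl i)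
  have hl2 : ∀ i, 1 ≤ ε / 2 * l i := fun i => by
    have := mul_le_mul_of_nonneg_left (hl i) (by positivity : 0 ≤ ε / 2)
    rwa [mul_inv_cancel₀ (by positivity)] at this
  have hs2 : ∀ i, s i ≤ ε / 2 * l i := fun i => (div_le_iff₀ (hl0 i)).1 (hsl i)
  constructor
  · have hsub : realBox (fun i => -(ε / 2 * l i)) (fun i => ε / 2 * l i) ⊆
        toFinsetOrEmpty (JOL R₀ l s) := by
      intro i hi
      rw [mem_realBox] at hi
      rw [mem_toFinsetOrEmpty (hR₀.finite_JOL hl0 s)]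
      rintro _ ⟨_, ⟨x, hx, rfl⟩, rfl⟩
      rw [mem_scaleSet hl0]
      refine hbox _ fun j => ?_
      have h1 : |s j * x j| ≤ ε / 2 * l j := by
        rw [abs_mul, abs_of_pos (hs j)]
        nlinarith [hR₀.abs_apply_le hx j, hs j, hs2 j]
      rw [abs_le] at h1
      rw [abs_div, abs_of_pos (hl0 j), div_le_iff₀ (hl0 j), abs_le]
      constructor <;> linarith [hi j, h1.1, h1.2]
    calc (ε / 2) ^ d * ∏ i, l i = ∏ i, ε / 2 * l i := by
          rw [Finset.prod_mul_distrib, Finset.prod_const, Finset.card_fin]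
      _ ≤ ((realBox (fun i => -(ε / 2 * l i)) fun i => ε / 2 * l i).card : ℝ) := prod_le_card_realBox (fun i => by linarith [hl2 i]) fun i => by linarith [hl2 i]
      _ ≤ _ := by exact_mod_cast Finset.card_le_card hsub
  · have hq : ∀ i, 1 ≤ ε / 2 * (l i / s i) := fun i => by
      rw [← mul_div_assoc, le_div_iff₀ (hs i), one_mul]; exact hs2 i
    have hsub : realBox (fun i => -(ε / 2 * (l i / s i))) (fun i => ε / 2 * (l i / s i)) ⊆
        toFinsetOrEmpty (JNOL R₀ l s) := by
      intro i hi
      rw [mem_realBox] at hi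
      rw [mem_toFinsetOrEmpty (hR₀.finite_JNOL hl0 hs)]
      rintro _ ⟨_, ⟨x, hx, rfl⟩, rfl⟩
      rw [mem_scaleSet hl0]
      refine hbox _ fun j => ?_
      have h1 := hx j
      have h2 : |(i j : ℝ) + x j| ≤ ε * (l j / s j) := by
        rw [abs_le]
        constructor <;> linarith [hi j, hq j, h1.1, h1.2]
      rw [abs_div, abs_of_pos (hl0 j), div_le_iff₀ (hl0 j), abs_mul, abs_of_pos (hs j)]
      calc s j * |(i j : ℝ) + x j| ≤ s j * (ε * (l j / s j)) :=
            mul_le_mul_of_nonneg_left h2 (hs j).le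
        _ = _ := by have := (hs j).ne'; field_simp
    calc (ε / 2) ^ d * ∏ i, l i / s i = ∏ i, ε / 2 * (l i / s i) := by
          rw [Finset.prod_mul_distrib, Finset.prod_const, Finset.card_fin]
      _ ≤ ((realBox (fun i => -(ε / 2 * (l i / s i))) fun i => ε / 2 * (l i / s i)).card : ℝ) :=
        prod_le_card_realBox (fun i => by linarith [hq i]) fun i => by linarith [hq i]
      _ ≤ _ := by exact_mod_cast Finset.card_le_card hsub

lemma mem_siteFinset_shiftSet {t : Fin d → ℝ} {i k : Fin d → ℤ} {A : Set (Fin d → ℝ)} :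
    k ∈ siteFinset t (shiftSet i A) ↔ k - i ∈ siteFinset t A := by
  have hset : sites t (shiftSet i A) = (Equiv.addRight i) '' sites t A := by
    ext k
    rw [sites_shiftSet, mem_sites_sub_iff, Equiv.image_eq_preimage_symm]
    simp [sub_eq_add_neg]
  by_cases h : (sites t A).Finite
  · have h' : (sites t (shiftSet i A)).Finite := hset ▸ h.image _
    rw [siteFinset, siteFinset, mem_toFinsetOrEmpty h, mem_toFinsetOrEmpty h', sites_shiftSet,
      mem_sites_sub_iff]
  · have h' : ¬ (sites t (shiftSet i A)).Finite := by
      rwa [hset, Set.finite_image_iff (Equiv.injective _).injOn]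
    simp [siteFinset, toFinsetOrEmpty, h, h']

/-- Integer translates contain equally many sites, so the common weight in the overlapping estimator
is each block's own size. -/
lemma card_siteFinset_shiftSet (t : Fin d → ℝ) (i : Fin d → ℤ) (A : Set (Fin d → ℝ)) :
    (siteFinset t (shiftSet i A)).card = (siteFinset t A).card :=
  Finset.card_bij (fun k _ => k - i) (fun _ hk => mem_siteFinset_shiftSet.1 hk)
    (fun _ _ _ _ h => sub_left_injective h)
    fun k hk => ⟨k + i, mem_siteFinset_shiftSet.2 (by simpa using hk), by simp⟩

/-- A site `k` in the block `i` determines the site `k - i` of the untranslated block, and distinct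
`i` give distinct sites. -/
lemma card_filter_mem_siteFinset_shiftSet_le (t : Fin d → ℝ) (A : Set (Fin d → ℝ))
    (J : Finset (Fin d → ℤ)) (k : Fin d → ℤ) :
    (J.filter fun i => k ∈ siteFinset t (shiftSet i A)).card ≤ (siteFinset t A).card :=
  Finset.card_le_card_of_injOn (fun i => k - i)
    (fun _ hi => mem_siteFinset_shiftSet.1 (Finset.mem_filter.1 hi).2)
    fun _ _ _ _ h => sub_right_injective h

/-- The blocks lie in translates of a half-open cube that tile space, hence are disjoint. -/
lemma IsTemplate.card_filter_mem_siteFinset_scaleSet_shiftSet_le (hR₀ : IsTemplate R₀)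
    {s : Fin d → ℝ} (hs : ∀ i, 0 < s i) (t : Fin d → ℝ) (J : Finset (Fin d → ℤ))
    (k : Fin d → ℤ) :
    (J.filter fun i => k ∈ siteFinset t (scaleSet s (shiftSet i R₀))).card ≤ 1 := by
  refine Finset.card_le_one.2 fun i hi i' hi' => funext fun j => ?_
  have key : ∀ i, k ∈ siteFinset t (scaleSet s (shiftSet i R₀)) →
      -(1 / 2) < (t j + k j) / s j - i j ∧ (t j + k j) / s j - i j ≤ 1 / 2 := fun i hi => by
    rw [siteFinset_scaleSet_shiftSet hs, hR₀.mem_siteFinset hs] at hi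
    have h1 := hR₀.subset_unitCube hi j
    have h2 : (t j - s j * i j + k j) / s j = (t j + k j) / s j - i j := by
      have := (hs j).ne'
      field_simp
      ring
    rwa [h2] at h1
  have h1 := key i (Finset.mem_filter.1 hi).2
  have h2 := key i' (Finset.mem_filter.1 hi').2
  have h3 : (i j : ℝ) < i' j + 1 := by linarith [h1.1, h2.2]
  have h4 : (i' j : ℝ) < i j + 1 := by linarith [h2.1, h1.2]
  have h5 : i j < i' j + 1 := by exact_mod_cast h3
  have h6 : i' j < i j + 1 := by exact_mod_cast h4
  omega

end Blocks

/-! ### The expected subsample variance -/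

lemma integrable_blockVariance {ι Ω : Type*} [MeasurableSpace Ω] {P : Measure Ω}
    [IsProbabilityMeasure P] {J : Finset ι} (w : ι → ℝ) {X : ι → Ω → ℝ}
    (hX : ∀ i ∈ J, MemLp (X i) 2 P) :
    Integrable (fun ω => (J.card : ℝ)⁻¹ * ∑ i ∈ J, w i *
      (X i ω - (J.card : ℝ)⁻¹ * ∑ j ∈ J, X j ω) ^ 2) P := by
  refine Integrable.const_mul (integrable_finsetSum _ fun i hi => Integrable.const_mul ?_ _) _
  exact ((hX i hi).sub ((memLp_finsetSum J hX).const_mul _)).integrable_sq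

/-! ### The estimators as block variances -/

section Estimators

variable {d p : ℕ} {Ω : Type*} {t : Fin d → ℝ}
  {Z : (Fin d → ℤ) → Ω → EuclideanSpace ℝ (Fin p)} {H : EuclideanSpace ℝ (Fin p) → ℝ}
  {R₀ : Set (Fin d → ℝ)} {l s : Fin d → ℝ}

/-- The sample variance of the statistics of the blocks `S i`, `i ∈ J`, weighted by the block
sizes. -/
noncomputable def blockVariance (θ : Finset (Fin d → ℤ) → Ω → ℝ) (J : Finset (Fin d → ℤ))
    (S : (Fin d → ℤ) → Finset (Fin d → ℤ)) (ω : Ω) : ℝ :=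
  (J.card : ℝ)⁻¹ * ∑ i ∈ J, ((S i).card : ℝ) *
    (θ (S i) ω - (J.card : ℝ)⁻¹ * ∑ j ∈ J, θ (S j) ω) ^ 2

lemma tauHatOL_eq [MeasurableSpace Ω] : tauHatOL t Z H R₀ l s =
    blockVariance (fun S ω => H (siteMean Z S ω)) (toFinsetOrEmpty (JOL R₀ l s))
      (fun i => siteFinset t (shiftSet i (scaleSet s R₀))) := by
  funext ω
  simp only [tauHatOL, blockVariance, finAverage_eq, thetaHat_eq, siteCount_eq, smul_eq_mul,
    card_siteFinset_shiftSet]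

lemma tauHatNOL_eq [MeasurableSpace Ω] : tauHatNOL t Z H R₀ l s =
    blockVariance (fun S ω => H (siteMean Z S ω)) (toFinsetOrEmpty (JNOL R₀ l s))
      (fun i => siteFinset t (scaleSet s (shiftSet i R₀))) := by
  funext ω
  simp only [tauHatNOL, blockVariance, finAverage_eq, thetaHat_eq, siteCount_eq, smul_eq_mul]

lemma tauSqN_eq [MeasurableSpace Ω] (P : Measure Ω) : tauSqN t Z H R₀ P l =
    (siteFinset t (scaleSet l R₀)).card *
      variance (fun ω => H (siteMean Z (siteFinset t (scaleSet l R₀)) ω)) P := by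
  rw [tauSqN, siteCount_eq]
  congr 2
  exact funext fun ω => thetaHat_eq t Z H _ ω

end Estimators

/-! ### The bias of block variances -/

section Bias

variable {d : ℕ} {Ω : Type*} [MeasurableSpace Ω] {P : Measure Ω} [IsProbabilityMeasure P]
  {θ : Finset (Fin d → ℤ) → Ω → ℝ} {h₀ : ℝ} {Y : (Fin d → ℤ) → Ω → ℝ}
  {σ : (Fin d → ℤ) → ℝ} {B C γ : ℝ}

lemma integrable_blockVariance_of_memLp (hθ : ∀ S, MemLp (θ S) 2 P) (J : Finset (Fin d → ℤ))
    (S : (Fin d → ℤ) → Finset (Fin d → ℤ)) : Integrable (blockVariance θ J S) P :=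
  integrable_blockVariance _ fun i _ => hθ (S i)

/-- The ratio of the volumes of a subsample and of the sampling region is at most of the order of
the inverse subsample scaling factor. -/
lemma AssumptionA2.eventually_prod_div_prod_le [NeZero d] {lam slam : ℕ → Fin d → ℝ}
    (h : AssumptionA2 lam slam) (hscale : IsScaling lam slam) {K : ℝ} (hK1 : 1 ≤ K)
    (hK : ∀ᶠ n in atTop, ∀ i j, slam n i ≤ K * slam n j) :
    ∀ᶠ n in atTop, (∏ i, slam n i) / ∏ i, lam n i ≤ K / slam n 0 := by
  have hK0 : 0 < K := zero_lt_one.trans_le hK1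
  filter_upwards [hK, h.1.eventually_le_const zero_lt_one] with n hKn hn
  have hs := hscale.slam_pos n
  have hl := hscale.lam_pos n
  have hV : 0 < ∏ i, slam n i := Finset.prod_pos fun i _ => hs i
  have hW : 0 < ∏ i, lam n i := Finset.prod_pos fun i _ => hl i
  have h1 : 0 ≤ ∑ i, 1 / slam n i := Finset.sum_nonneg fun i _ => (one_div_pos.2 (hs i)).le
  have h2 : 0 ≤ ∑ i, slam n i / lam n i :=
    Finset.sum_nonneg fun i _ => (div_pos (hs i) (hl i)).le
  have hd : (d : ℝ) ≠ 0 := Nat.cast_ne_zero.2 (NeZero.ne d)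
  have h3 : (∏ i, slam n i) ^ (((d : ℝ) + 1) / d) / ∏ i, lam n i ≤ 1 := by linarith
  -- The exponent `(d + 1) / d` leaves, besides the volume itself, its `d`-th root, which is
  -- comparable to one scaling factor.
  have h4 : (∏ i, slam n i) ^ (((d : ℝ) + 1) / d) =
      (∏ i, slam n i) * (∏ i, slam n i) ^ ((d : ℝ)⁻¹) := by
    rw [add_div, div_self hd, Real.rpow_add hV, Real.rpow_one, one_div]
  have h5 : slam n 0 / K ≤ (∏ i, slam n i) ^ ((d : ℝ)⁻¹) := by
    rw [← Real.pow_rpow_inv_natCast (div_pos (hs 0) hK0).le (NeZero.ne d)]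
    exact Real.rpow_le_rpow (by have := hs 0; positivity) (prod_ge_of_comparable hs hK1 hKn)
      (by positivity)
  rw [div_le_one hW, h4] at h3
  rw [div_le_div_iff₀ hW (hs 0)]
  have h6 := (mul_le_mul_of_nonneg_left h5 hV.le).trans h3
  rwa [← mul_div_assoc, div_le_iff₀ hK0, mul_comm _ K] at h6

/-- The expected subsample variance over scaled templates, whose multiplicity relative to their
number is at most of the order of the volume ratio, approximates the normalized variance of the
statistic of the sampling region. -/
theorem IsAsymptoticallyLinear.isBigO_integral_blockVariance_sub [NeZero d]
    (h : IsAsymptoticallyLinear P θ h₀ Y σ B C γ) (hγ : 1 ≤ γ * d) {R₀ : Set (Fin d → ℝ)}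
    (hR₀ : IsTemplate R₀) {lam slam : ℕ → Fin d → ℝ} (hscale : IsScaling lam slam)
    (hA1 : AssumptionA1 slam) (hA2 : AssumptionA2 lam slam) (t : Fin d → ℝ)
    {J : ℕ → Finset (Fin d → ℤ)} {S : ℕ → (Fin d → ℤ) → Finset (Fin d → ℤ)}
    (hS : ∀ n i, ∃ t', S n i = siteFinset t' (scaleSet (slam n) R₀)) {Q : ℝ}
    (hJ : ∀ᶠ n in atTop, (J n).Nonempty ∧ ∃ M : ℝ, 0 ≤ M ∧
      (∀ k, (((J n).filter fun i => k ∈ S n i).card : ℝ) ≤ M) ∧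
      M / (J n).card ≤ Q * ((∏ i, slam n i) / ∏ i, lam n i)) :
    (fun n => (∫ ω, blockVariance θ (J n) (S n) ω ∂P) -
      (siteFinset t (scaleSet (lam n) R₀)).card *
        variance (θ (siteFinset t (scaleSet (lam n) R₀))) P) =O[atTop] fun n => 1 / slam n 0 := by
  have hcomp := hA1.hasComparableEntries hscale.slam_pos
  obtain ⟨D₁, hD₁, hlarge⟩ := h.exists_abs_card_mul_variance_sub_le hγ hR₀ hscale.lam_pos
    hscale.lam_tendsto (hA2.hasComparableEntries hscale.lam_pos)
  obtain ⟨D₂, hD₂, hsmall⟩ := h.exists_abs_card_mul_variance_sub_le hγ hR₀ hscale.slam_pos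
    hscale.slam_tendsto hcomp
  obtain ⟨K, hK1, hK⟩ := hcomp
  have hK0 : 0 < K := zero_lt_one.trans_le hK1
  obtain ⟨c, Λ, hc, hΛ, hcard⟩ := hR₀.exists_card_siteFinset
  obtain ⟨E, hE, hblock⟩ := h.abs_integral_blockVariance_sub_le hc (by positivity : (0 : ℝ) ≤ 2 ^ d)
  -- `D₂` is the bias of the variance of a single block, the middle term the cost of centring by the
  -- average, and `D₁` the error for the whole sampling region.
  refine IsBigO.of_bound (D₂ + E * (K ^ d + |Q| * K) + D₁) ?_
  filter_upwards [hlarge, hsmall, hK, hJ, hA2.eventually_prod_div_prod_le hscale hK1 hK,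
    eventually_all.2 fun i => (hscale.slam_tendsto i).eventually_ge_atTop Λ,
    (hscale.ratio_tendsto 0).eventually_le_const zero_lt_one]
    with n hlargen hsmalln hKn hJn hvol hΛn hration
  obtain ⟨hJne, M, hM0, hM, hMJ⟩ := hJn
  set L := slam n 0 with hL
  have hL1 : 1 ≤ L := hΛ.trans (hΛn 0)
  have hL0 : 0 < L := zero_lt_one.trans_le hL1
  have hs := hscale.slam_pos n
  have hl := hscale.lam_pos n
  have hV : 0 < ∏ i, slam n i := Finset.prod_pos fun i _ => hs i
  have hW : 0 < ∏ i, lam n i := Finset.prod_pos fun i _ => hl i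
  have h1 := hblock (J n) (S n) (∏ i, slam n i) M (∑' k, σ k) (D₂ / L) hJne hV hM0
    (fun i _ => by obtain ⟨t', ht'⟩ := hS n i; rw [ht']; exact (hcard _ hΛn t').1)
    (fun i _ => by obtain ⟨t', ht'⟩ := hS n i; rw [ht']; exact (hcard _ hΛn t').2) hM
    (fun i _ => by obtain ⟨t', ht'⟩ := hS n i; rw [ht']; exact hsmalln t')
  have hd1 : d ≠ 0 := NeZero.ne d
  have h2 : (∏ i, slam n i)⁻¹ ≤ K ^ d / L := by
    calc (∏ i, slam n i)⁻¹ ≤ ((L / K) ^ d)⁻¹ :=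
          inv_anti₀ (by positivity) (prod_ge_of_comparable hs hK1 hKn)
      _ = K ^ d / L ^ d := by rw [div_pow, inv_div]
      _ ≤ K ^ d / L := by
          gcongr
          exact le_self_pow₀ hL1 hd1
  have h3 : M / (J n).card ≤ |Q| * K / L := by
    calc M / (J n).card ≤ Q * ((∏ i, slam n i) / ∏ i, lam n i) := hMJ
      _ ≤ |Q| * (K / L) := by
          refine (mul_le_mul_of_nonneg_right (le_abs_self Q) (by positivity)).trans ?_
          exact mul_le_mul_of_nonneg_left hvol (abs_nonneg Q)
      _ = _ := by ring
  -- The error for the sampling region is of order `1 / lam n 0`, which is eventually no larger than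
  -- `1 / slam n 0`.
  have h4 : D₁ / lam n 0 ≤ D₁ / L := by
    refine div_le_div_of_nonneg_left hD₁ hL0 ?_
    rwa [div_le_one (hl 0)] at hration
  have h5 := hlargen t
  have h6 : E * ((∏ i, slam n i)⁻¹ + M / (J n).card) ≤ E * (K ^ d / L + |Q| * K / L) := by gcongr
  rw [Real.norm_eq_abs, Real.norm_of_nonneg (one_div_pos.2 hL0).le]
  have h7 : (D₂ + E * (K ^ d + |Q| * K) + D₁) * (1 / L) =
      D₂ / L + E * (K ^ d / L + |Q| * K / L) + D₁ / L := by ring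
  rw [h7]
  have h8 : |(∫ ω, blockVariance θ (J n) (S n) ω ∂P) - ∑' k, σ k| ≤
      D₂ / L + E * (K ^ d / L + |Q| * K / L) := h1.trans (by linarith)
  rw [abs_le] at h5 h8 ⊢
  constructor <;> linarith [h5.1, h5.2, h8.1, h8.2]

end Bias

end SpatialSubsampling

theorem lemma4p1 {d p : ℕ} [NeZero d] {Ω : Type*} [MeasurableSpace Ω]
    (P : Measure Ω) [IsProbabilityMeasure P]
    (t : Fin d → ℝ) (ht : ∀ i, -(1 / 2) ≤ t i ∧ t i ≤ 1 / 2)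
    (Z : (Fin d → ℤ) → Ω → EuclideanSpace ℝ (Fin p)) (hZ : ∀ k, Measurable (Z k))
    (hstat : IsStationary P Z)
    (H : EuclideanSpace ℝ (Fin p) → ℝ)
    (R₀ : Set (Fin d → ℝ)) (hR₀ : IsTemplate R₀)
    (lam slam : ℕ → Fin d → ℝ) (hscale : IsScaling lam slam)
    (α₁ g : ℝ → ℝ) (a : ℕ)
    (hA1 : AssumptionA1 slam) (hA2 : AssumptionA2 lam slam) (hA3 : AssumptionA3 P Z α₁ g)
    (hA4 : AssumptionA4 P Z) (hA5 : AssumptionA5 P Z H)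
    (hDM : (2 ≤ d ∧ ConditionD H 2 a ∧ ConditionM P Z α₁ g (2 + a)) ∨
      (d = 1 ∧ ConditionD H 3 a ∧ ConditionM P Z α₁ g (3 + a))) :
    (∀ n, MemLp (thetaHat t Z H (scaleSet (lam n) R₀)) 2 P ∧
      Integrable (tauHatOL t Z H R₀ (lam n) (slam n)) P ∧
      Integrable (tauHatNOL t Z H R₀ (lam n) (slam n)) P) ∧
    (fun n => (∫ ω, tauHatOL t Z H R₀ (lam n) (slam n) ω ∂P) - tauSqN t Z H R₀ P (lam n))
      =O[atTop] (fun n => 1 / slam n 0) ∧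
    (fun n => (∫ ω, tauHatNOL t Z H R₀ (lam n) (slam n) ω ∂P) - tauSqN t Z H R₀ P (lam n))
      =O[atTop] (fun n => 1 / slam n 0) := by
  obtain ⟨Y, B, C, γ, hγ, hlin⟩ := exists_isAsymptoticallyLinear hZ hstat hA3 hDM
  have hmem : ∀ S, MemLp (fun ω => H (siteMean Z S ω)) 2 P := fun S => by
    rcases S.eq_empty_or_nonempty with rfl | hS
    -- A small region may contain no site. Its mean is then `0` by convention and the statistic the
    -- constant `H 0`, so the integrability claims hold for every `n`.
    · simpa [siteMean] using memLp_const (H 0)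
    · exact hlin.memLp_stat hS
  obtain ⟨c, ε, hc, hε, hJ⟩ := hR₀.exists_card_J
  obtain ⟨_, Λ, _, hΛ, hcard⟩ := hR₀.exists_card_siteFinset
  have hJev : ∀ᶠ n in atTop,
      c * ∏ i, lam n i ≤ (toFinsetOrEmpty (JOL R₀ (lam n) (slam n))).card ∧
      c * ∏ i, lam n i / slam n i ≤ (toFinsetOrEmpty (JNOL R₀ (lam n) (slam n))).card := by
    filter_upwards [eventually_all.2 fun i => (hscale.lam_tendsto i).eventually_ge_atTop ε⁻¹,
      eventually_all.2 fun i => (hscale.ratio_tendsto i).eventually_le_const hε] with n h1 h2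
    exact hJ _ _ (hscale.slam_pos n) h1 h2
  refine ⟨fun n => ⟨?_, ?_, ?_⟩, ?_, ?_⟩
  · rw [show thetaHat t Z H (scaleSet (lam n) R₀) = _ from funext (thetaHat_eq t Z H _)]
    exact hmem _
  · rw [tauHatOL_eq]
    exact integrable_blockVariance_of_memLp hmem _ _
  · rw [tauHatNOL_eq]
    exact integrable_blockVariance_of_memLp hmem _ _
  · simp only [tauHatOL_eq, tauSqN_eq]
    -- A site lies in at most as many overlapping blocks as a block has sites, that is `2 ^ d * ∏
    -- slam`, and there are at least `c * ∏ lam` blocks.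
    refine hlin.isBigO_integral_blockVariance_sub hγ hR₀ hscale hA1 hA2 t (Q := 2 ^ d / c)
      (fun n i => ⟨_, siteFinset_shiftSet t i _⟩) ?_
    filter_upwards [hJev, eventually_all.2 fun i => (hscale.slam_tendsto i).eventually_ge_atTop Λ]
      with n hn hΛn
    have hW : 0 < ∏ i, lam n i := Finset.prod_pos fun i _ => hscale.lam_pos n i
    have hV : 0 < ∏ i, slam n i := Finset.prod_pos fun i _ => hscale.slam_pos n i
    have hpos : 0 < c * ∏ i, lam n i := by positivity
    refine ⟨Finset.card_pos.1 (by exact_mod_cast hpos.trans_le hn.1), 2 ^ d * ∏ i, slam n i,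
      by positivity, fun k => le_trans ?_ (hcard _ hΛn t).2, ?_⟩
    · exact_mod_cast card_filter_mem_siteFinset_shiftSet_le t _ _ k
    · calc _ ≤ 2 ^ d * (∏ i, slam n i) / (c * ∏ i, lam n i) :=
            div_le_div_of_nonneg_left (by positivity) hpos hn.1
        _ = _ := by rw [mul_div_mul_comm]
  · simp only [tauHatNOL_eq, tauSqN_eq]
    -- The multiplicity is now `1`, and there are at least `c * ∏ lam / ∏ slam` blocks.
    refine hlin.isBigO_integral_blockVariance_sub hγ hR₀ hscale hA1 hA2 t (Q := 1 / c)
      (fun n i => ⟨_, siteFinset_scaleSet_shiftSet (hscale.slam_pos n) t i _⟩) ?_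
    filter_upwards [hJev] with n hn
    have hW : 0 < ∏ i, lam n i := Finset.prod_pos fun i _ => hscale.lam_pos n i
    have hV : 0 < ∏ i, slam n i := Finset.prod_pos fun i _ => hscale.slam_pos n i
    rw [Finset.prod_div_distrib] at hn
    have hpos : 0 < c * ((∏ i, lam n i) / ∏ i, slam n i) := by positivity
    refine ⟨Finset.card_pos.1 (by exact_mod_cast hpos.trans_le hn.2), 1, zero_le_one,
      fun k => ?_, ?_⟩
    · exact_mod_cast hR₀.card_filter_mem_siteFinset_scaleSet_shiftSet_le (hscale.slam_pos n) t _ k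
    · calc _ ≤ 1 / (c * ((∏ i, lam n i) / ∏ i, slam n i)) :=
            div_le_div_of_nonneg_left zero_le_one hpos hn.2
        _ = _ := by field_simp
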